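/- **Theorem 3.4.** For a Radon measure $m$ with full support on $E=\mathbb R^d$, a *Dirichlet form* $(\mathcal E,\mathcal F)$ on $L^2(E,m)$ is a densely defined, nonnegative, symmetric bilinear form that is closed and Markovian, and $\mathcal E_1(u,v)=\mathcal E(u,v)+(u,v)_m$. A *core* of $(\mathcal E,\mathcal F)$ is a set $\mathcal C\subset\mathcal F\cap C_c(E)$ that is dense in $\mathcal F$ for the norm $\mathcal E_1(u,u)^{1/2}$ and dense in $C_c(E)$ for the uniform norm; the form is *regular* if $\mathcal F\cap C_c(E)$ is a core. A regular Dirichlet form $(\mathcal E',\mathcal F')$ is a *regular subspace* of a regular Dirichlet form $(\mathcal E,\mathcal F)$ if $\mathcal F'\subset\mathcal F$ and $\mathcal E=\mathcal E'$ on $\mathcal F'\times\mathcal F'$; it is *proper* if $\mathcal F'\ne\mathcal F$. The Dirichlet form of an $m$-symmetric Markov process with transition semigroup $(P_t)$ is $\mathcal E(u,v)=\lim_{t\downarrow0}t^{-1}(u-P_tu,v)_m$, where $\mathcal F$ is the set of all $u\in L^2(E,m)$ for which $t^{-1}(u-P_tu,u)_m$ has a finite limit as $t\downarrow 0$. Let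 $\mathbf S(\mathbb R)$ be the set of all strictly increasing, locally absolutely continuous $s:\mathbb R\to\mathbb R$ with $s(0)=0$ and $s'(x)\in\{0,1\}$ for a.e. $x$, and put $E_s=\{x: s'(x)=0\}$. For $s\in\mathbf S(\mathbb R)$ with $J=s(\mathbb R)$, write $u\ll s$ if $u=\varphi\circ s$ with $\varphi$ locally absolutely continuous on $J$, and then $\frac{du}{ds}=\varphi'\circ s$. Let $$\mathcal F^{(s)}=\Big\{u\in L^2(\mathbb R): u\ll s,\ \int_{\mathbb R}\Big(\frac{du}{ds}\Big)^2ds<\infty\Big\},\qquad \mathcal E^{(s)}(u,v)=\frac12\int_{\mathbb R}\frac{du}{ds}\frac{dv}{ds}\,ds,$$ and $C^1_c(s)=\{\varphi\circ s:\varphi\in C^1_c(J)\}$. Let $H^1(\mathbb R^d)$ be the Sobolev space of $u\in L^2(\mathbb R^d)$ with weak partial derivatives in $L^2(\mathbb R^d)$, and $\mathbf D(u,v)=\int_{\mathbb R^d}\nabla u\cdot\nabla v\,dx$; thus $(\frac12\mathbf D,H^1(\mathbb R^d))$ is the Dirichlet form of $d$-dimensional Brownian motion. Let $d$ be a natural number,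 let $s_1,\dots,s_d\in\mathbf S(\mathbb R)$, and for each $i$ let $X^{s_i}$ be a Lebesgue-symmetric Markov process on $\mathbb R$ (possibly with finite lifetime) whose Dirichlet form on $L^2(\mathbb R)$ is $(\mathcal E^{(s_i)},\mathcal F^{(s_i)})$. Let $X=(X^{s_1},\dots,X^{s_d})$ be their independent coupling, that is, the Markov process on $\mathbb R^d$ with transition function $P_t(x,\cdot)=P_t^{1}(x_1,\cdot)\otimes\cdots\otimes P_t^{d}(x_d,\cdot)$, where $P^i_t$ is the transition function of $X^{s_i}$. Then $X$ is symmetric with respect to Lebesgue measure, and it has a Dirichlet form $(\mathcal E^{s_1,\dots,s_d},\mathcal F^{s_1,\dots,s_d})$ on $L^2(\mathbb R^d)$, which has the following properties. 1. It is a regular subspace of $(\frac12\mathbf D,H^1(\mathbb R^d))$. 2. The tensor product $C^1_c(s_1)\otimes\cdots\otimes C^1_c(s_d)$, i.e. the linear span of the functions $x\mapsto f_1(x_1)\cdots f_d(x_d)$ with $f_i\in C^1_c(s_i)$, is a core of it. 3. If $|E_{s_i}|>0$ for some $i$, where $|\cdot|$ is Lebesgue measure, then it is a proper regular subspace of $(\frac12\mathbf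 D,H^1(\mathbb R^d))$. -/

import Mathlib

open MeasureTheory Set Filter Topology ProbabilityTheory
open scoped NNReal ENNReal

noncomputable section

/-! ### Symmetric forms on `L²(E, m)` and Dirichlet forms -/

/-- A pair `(𝓔, 𝓕)` on `L²(E, m)`: a domain `𝓕` and a function of two variables, of which only the
values on `𝓕 × 𝓕` are ever used.  The laws of a Dirichlet form are in `IsDirichletForm`. -/
structure L2Form {E : Type*} [MeasurableSpace E] (m : Measure E) where
  domain : Set (Lp ℝ 2 m)
  form : Lp ℝ 2 m → Lp ℝ 2 m → ℝ

namespace L2Form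

variable {E : Type*} [MeasurableSpace E] {m : Measure E}

/-- `𝓔₁(u, v) = 𝓔(u, v) + (u, v)_m`. -/
def form1 (𝓔 : L2Form m) (u v : Lp ℝ 2 m) : ℝ :=
  𝓔.form u v + inner ℝ u v

/-- A Dirichlet form: a densely defined, nonnegative, symmetric bilinear form that is closed and
Markovian (the unit contraction operates on it). -/
structure IsDirichletForm (𝓔 : L2Form m) : Prop where
  zero_mem : (0 : Lp ℝ 2 m) ∈ 𝓔.domain
  add_mem : ∀ u ∈ 𝓔.domain, ∀ v ∈ 𝓔.domain, u + v ∈ 𝓔.domain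
  smul_mem : ∀ (c : ℝ), ∀ u ∈ 𝓔.domain, c • u ∈ 𝓔.domain
  dense : Dense 𝓔.domain
  add_left : ∀ u ∈ 𝓔.domain, ∀ v ∈ 𝓔.domain, ∀ w ∈ 𝓔.domain,
    𝓔.form (u + v) w = 𝓔.form u w + 𝓔.form v w
  smul_left : ∀ (c : ℝ), ∀ u ∈ 𝓔.domain, ∀ v ∈ 𝓔.domain, 𝓔.form (c • u) v = c * 𝓔.form u v
  symm : ∀ u ∈ 𝓔.domain, ∀ v ∈ 𝓔.domain, 𝓔.form u v = 𝓔.form v u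
  nonneg : ∀ u ∈ 𝓔.domain, 0 ≤ 𝓔.form u u
  closed : ∀ u : ℕ → Lp ℝ 2 m, (∀ n, u n ∈ 𝓔.domain) →
    (∀ ε > 0, ∃ N, ∀ k ≥ N, ∀ l ≥ N, 𝓔.form1 (u k - u l) (u k - u l) < ε) →
    ∃ w ∈ 𝓔.domain, Tendsto (fun n => 𝓔.form1 (u n - w) (u n - w)) atTop (𝓝 0)
  markov : ∀ u ∈ 𝓔.domain, ∀ v : Lp ℝ 2 m, (v =ᵐ[m] fun x => min (max (u x) 0) 1) →
    v ∈ 𝓔.domain ∧ 𝓔.form v v ≤ 𝓔.form u u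

variable [TopologicalSpace E]

/-- The set `𝓕 ∩ C_c(E)`. -/
def compactlySupported (𝓔 : L2Form m) : Set (E → ℝ) :=
  {f | Continuous f ∧ HasCompactSupport f ∧ ∃ u ∈ 𝓔.domain, u =ᵐ[m] f}

/-- `C` is a core of `(𝓔, 𝓕)`: a subset of `𝓕 ∩ C_c(E)` that is dense in `𝓕` for the norm
`𝓔₁^{1/2}` and dense in `C_c(E)` for the uniform norm. -/
structure IsCore (𝓔 : L2Form m) (C : Set (E → ℝ)) : Prop where
  subset : C ⊆ 𝓔.compactlySupported
  dense_domain : ∀ u ∈ 𝓔.domain, ∀ ε > 0,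
    ∃ f ∈ C, ∃ v ∈ 𝓔.domain, v =ᵐ[m] f ∧ 𝓔.form1 (u - v) (u - v) < ε
  dense_continuous : ∀ g : E → ℝ, Continuous g → HasCompactSupport g → ∀ ε > 0,
    ∃ f ∈ C, ∀ x, |g x - f x| < ε

/-- A regular Dirichlet form: a Dirichlet form for which `𝓕 ∩ C_c(E)` is dense in `𝓕` and in
`C_c(E)`. -/
def IsRegularDirichletForm (𝓔 : L2Form m) : Prop :=
  𝓔.IsDirichletForm ∧ 𝓔.IsCore 𝓔.compactlySupported

/-- `𝓔'` is a regular subspace of `𝓔`. -/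
structure IsRegularSubspace (𝓔' 𝓔 : L2Form m) : Prop where
  regular_sub : 𝓔'.IsRegularDirichletForm
  regular : 𝓔.IsRegularDirichletForm
  domain_subset : 𝓔'.domain ⊆ 𝓔.domain
  form_eq : ∀ u ∈ 𝓔'.domain, ∀ v ∈ 𝓔'.domain, 𝓔.form u v = 𝓔'.form u v

/-- `𝓔'` is a proper regular subspace of `𝓔`. -/
def IsProperRegularSubspace (𝓔' 𝓔 : L2Form m) : Prop :=
  𝓔'.IsRegularSubspace 𝓔 ∧ 𝓔'.domain ≠ 𝓔.domain

end L2Form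

/-! ### The form `(½ 𝐃, H¹(ℝ^d))` of Brownian motion -/

/-- `g` is the `i`-th weak partial derivative of `u` on `ℝ^d`. -/
def IsWeakPartial {d : ℕ} (i : Fin d) (u g : (Fin d → ℝ) → ℝ) : Prop :=
  ∀ φ : (Fin d → ℝ) → ℝ, ContDiff ℝ (⊤ : ℕ∞) φ → HasCompactSupport φ →
    ∫ x, u x * fderiv ℝ φ x (Pi.single i 1) = - ∫ x, g x * φ x

/-- The Sobolev space `H¹(ℝ^d)`. -/
def sobolevH1 (d : ℕ) : Set (Lp ℝ 2 (volume : Measure (Fin d → ℝ))) :=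
  {u | ∀ i, ∃ g : Lp ℝ 2 (volume : Measure (Fin d → ℝ)), IsWeakPartial i u g}

open Classical in
/-- The weak partial derivative `∂ᵢu ∈ L²(ℝ^d)` (unique up to null sets; `0` if there is none). -/
def weakPartial {d : ℕ} (i : Fin d) (u : Lp ℝ 2 (volume : Measure (Fin d → ℝ))) :
    Lp ℝ 2 (volume : Measure (Fin d → ℝ)) :=
  if h : ∃ g : Lp ℝ 2 (volume : Measure (Fin d → ℝ)), IsWeakPartial i u g then h.choose else 0

/-- `(½ 𝐃, H¹(ℝ^d))` with `𝐃(u, v) = ∫ ∇u · ∇v dx`, the form of `d`-dimensional Brownian motion. -/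
def brownianForm (d : ℕ) : L2Form (volume : Measure (Fin d → ℝ)) where
  domain := sobolevH1 d
  form u v := (1 / 2) * ∑ i, ∫ x, weakPartial i u x * weakPartial i v x

/-! ### The one-dimensional forms `(𝓔^{(s)}, 𝓕^{(s)})` -/

/-- The class `𝐒(ℝ)` of scale functions: strictly increasing, (locally absolutely) continuous,
`s(0) = 0`, and `s'(x) ∈ {0, 1}` for almost every `x`. -/
structure BrownianScale where
  toFun : ℝ → ℝ
  strictMono : StrictMono toFun
  continuous : Continuous toFun
  absolutelyContinuous : ∀ a b, AbsolutelyContinuousOnInterval toFun a b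
  map_zero : toFun 0 = 0
  deriv_zero_or_one : ∀ᵐ x, HasDerivAt toFun 0 x ∨ HasDerivAt toFun 1 x

namespace BrownianScale

/-- The Lebesgue–Stieltjes measure `ds`. -/
def measure (s : BrownianScale) : Measure ℝ :=
  StieltjesFunction.measure
    { toFun := s.toFun
      mono' := s.strictMono.monotone
      right_continuous' := fun _ => s.continuous.continuousWithinAt }

/-- The interval `J = s(ℝ)`. -/
def image (s : BrownianScale) : Set ℝ := range s.toFun

/-- The set `E_s = {s' = 0}`. -/
def flatSet (s : BrownianScale) : Set ℝ := {x | HasDerivAt s.toFun 0 x}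

/-- `u = φ ∘ s` with `φ` locally absolutely continuous on `J = s(ℝ)`, and the derivative
`du/ds = φ' ∘ s` is in `L²(ds)`.  On `J` the function `φ` is determined by `u` and `s`. -/
def IsRepresentedBy (s : BrownianScale) (u : ℝ → ℝ) (φ : ℝ → ℝ) : Prop :=
  (∀ a ∈ s.image, ∀ b ∈ s.image, AbsolutelyContinuousOnInterval φ a b) ∧
  (u =ᵐ[volume] φ ∘ s.toFun) ∧
  MemLp (deriv φ ∘ s.toFun) 2 s.measure

open Classical in
/-- The derivative `du/ds = φ' ∘ s` for `u = φ ∘ s` (and `0` if there is no such `φ`). -/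
def scaleDeriv (s : BrownianScale) (u : ℝ → ℝ) : ℝ → ℝ :=
  if h : ∃ φ, s.IsRepresentedBy u φ then deriv h.choose ∘ s.toFun else 0

/-- The form `(𝓔^{(s)}, 𝓕^{(s)})` on `L²(ℝ)`: `𝓕^{(s)}` consists of the `u ∈ L²(ℝ)` with `u ≪ s`
and `∫ (du/ds)² ds < ∞`, and `𝓔^{(s)}(u, v) = ½ ∫ (du/ds) (dv/ds) ds`. -/
def scaleForm (s : BrownianScale) : L2Form (volume : Measure ℝ) where
  domain := {u | ∃ φ, s.IsRepresentedBy u φ}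
  form u v := (1 / 2) * ∫ x, s.scaleDeriv u x * s.scaleDeriv v x ∂s.measure

/-- `C_c^1(s) = {φ ∘ s : φ ∈ C_c^1(J)}`, `J = s(ℝ)`; functions in `C_c^1(J)` are extended by zero
to `ℝ`. -/
def smoothCore (s : BrownianScale) : Set (ℝ → ℝ) :=
  {f | ∃ φ : ℝ → ℝ, ContDiff ℝ 1 φ ∧ HasCompactSupport φ ∧ tsupport φ ⊆ s.image ∧
    f = φ ∘ s.toFun}

end BrownianScale

/-- The algebraic tensor product `C₁ ⊗ ⋯ ⊗ C_d` of function spaces, as functions on `ℝ^d`: the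
linear span of the products `x ↦ f₁(x₁) ⋯ f_d(x_d)` with `fᵢ ∈ Cᵢ`. -/
def tensorSpan {d : ℕ} (C : Fin d → Set (ℝ → ℝ)) : Set ((Fin d → ℝ) → ℝ) :=
  (Submodule.span ℝ {F : (Fin d → ℝ) → ℝ |
    ∃ f : Fin d → ℝ → ℝ, (∀ i, f i ∈ C i) ∧ F = fun x => ∏ i, f i (x i)} :
      Submodule ℝ ((Fin d → ℝ) → ℝ))

/-! ### Markov processes, independent coupling, and the associated Dirichlet form -/

/-- A (time-homogeneous) Markov process on `E`, possibly with finite lifetime, given by its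
transition function `P_t(x, B) = ℙ^x(X_t ∈ B)`: sub-Markovian kernels with `P_0 = id` and the
Chapman–Kolmogorov equations. The missing mass `1 - P_t(x, E)` is the probability that the process
has been sent to the cemetery by time `t`. -/
structure MarkovTransition (E : Type*) [MeasurableSpace E] where
  kernel : ℝ≥0 → Kernel E E
  mass_le_one : ∀ t x, kernel t x univ ≤ 1
  kernel_zero : kernel 0 = Kernel.id
  kernel_add : ∀ r t, kernel (r + t) = kernel t ∘ₖ kernel r

namespace MarkovTransition

variable {E : Type*} [MeasurableSpace E]

instance isFiniteMeasure_kernel (P : MarkovTransition E) (t : ℝ≥0) (x : E) :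
    IsFiniteMeasure (P.kernel t x) :=
  ⟨(P.mass_le_one t x).trans_lt ENNReal.one_lt_top⟩

/-- `X` is `m`-symmetric. -/
def IsSymmetric (P : MarkovTransition E) (m : Measure E) : Prop :=
  ∀ t, ∀ A B : Set E, MeasurableSet A → MeasurableSet B →
    ∫⁻ x in A, P.kernel t x B ∂m = ∫⁻ x in B, P.kernel t x A ∂m

/-- The approximating form `t⁻¹ (u - P_t u, v)_m`. -/
def approxForm (P : MarkovTransition E) {m : Measure E} (t : ℝ≥0) (u v : Lp ℝ 2 m) : ℝ :=
  (t : ℝ)⁻¹ * ∫ x, (u x - ∫ y, u y ∂(P.kernel t x)) * v x ∂m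

/-- `𝓔` is the Dirichlet form on `L²(E, m)` of the `m`-symmetric Markov process `X`: its domain
consists of the `u` for which `t⁻¹ (u - P_t u, u)` has a finite limit as `t ↓ 0`, and
`𝓔(u, v) = lim_{t ↓ 0} t⁻¹ (u - P_t u, v)`. So `X` determines `𝓔` (on its domain). -/
structure IsAssociated (P : MarkovTransition E) {m : Measure E} (𝓔 : L2Form m) : Prop where
  symmetric : P.IsSymmetric m
  domain_eq : 𝓔.domain =
    {u | ∃ l : ℝ, Tendsto (fun t => P.approxForm t u u) (𝓝[>] (0 : ℝ≥0)) (𝓝 l)}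
  tendsto_form : ∀ u ∈ 𝓔.domain, ∀ v ∈ 𝓔.domain,
    Tendsto (fun t => P.approxForm t u v) (𝓝[>] (0 : ℝ≥0)) (𝓝 (𝓔.form u v))

theorem lintegral_pi_prod {d : ℕ} (μ : Fin d → Measure E) [∀ i, IsFiniteMeasure (μ i)]
    (f : Fin d → E → ℝ≥0∞) (hf : ∀ i, Measurable (f i)) :
    ∫⁻ x, ∏ i, f i (x i) ∂(Measure.pi μ) = ∏ i, ∫⁻ x, f i x ∂(μ i) := by
  induction d with
  | zero => simp
  | succ n ih =>
    have hm : Measurable fun x : Fin (n + 1) → E => ∏ i, f i (x i) :=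
      Finset.measurable_prod _ fun i _ => (hf i).comp (measurable_pi_apply i)
    rw [← ((measurePreserving_piFinSuccAbove μ 0).symm).lintegral_comp hm]
    simp only [MeasurableEquiv.piFinSuccAbove_symm_apply, Fin.insertNthEquiv,
      Fin.prod_univ_succ, Fin.insertNth_zero, Equiv.coe_fn_mk, Fin.cons_succ,
      Fin.zero_succAbove, Fin.cons_zero]
    rw [← ih (fun i => μ i.succ) (fun i => f i.succ) fun i => hf i.succ]
    exact lintegral_prod_mul (hf 0).aemeasurable
      (Finset.measurable_prod _ fun (i : Fin n) _ =>
        (hf i.succ).comp (measurable_pi_apply i)).aemeasurable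

theorem measurable_pi_kernel {d : ℕ} (X : Fin d → MarkovTransition E) (t : ℝ≥0) :
    Measurable fun x : Fin d → E => Measure.pi fun i => (X i).kernel t (x i) := by
  have key : ∀ s : Fin d → Set E, (∀ i, MeasurableSet (s i)) →
      Measurable fun x : Fin d → E =>
        (Measure.pi fun i => (X i).kernel t (x i)) (Set.pi univ s) := by
    intro s hs
    simp only [Measure.pi_pi]
    exact Finset.measurable_prod _ fun i _ =>
      (((X i).kernel t).measurable_coe (hs i)).comp (measurable_pi_apply i)
  refine Measurable.measure_of_isPiSystem generateFrom_pi.symm isPiSystem_pi ?_ ?_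
  · rintro _ ⟨s, hs, rfl⟩
    exact key s fun i => hs i (mem_univ i)
  · simpa using key (fun _ => univ) fun _ => MeasurableSet.univ

/-- The independent coupling `(X¹, …, X^d)`: started at `x`, the coordinates are independent copies
of `Xⁱ` started at `xᵢ`, so the transition function is the product
`P_t(x, ·) = P¹_t(x₁, ·) ⊗ ⋯ ⊗ P^d_t(x_d, ·)`. -/
def independentCoupling {d : ℕ} (X : Fin d → MarkovTransition E) :
    MarkovTransition (Fin d → E) where
  kernel t := ⟨fun x => Measure.pi fun i => (X i).kernel t (x i), measurable_pi_kernel X t⟩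
  mass_le_one t x := by
    change (Measure.pi fun i => (X i).kernel t (x i)) univ ≤ 1
    rw [Measure.pi_univ]
    exact Finset.prod_le_one' fun i _ => (X i).mass_le_one t (x i)
  kernel_zero := by
    ext1 x
    change (Measure.pi fun i => (X i).kernel 0 (x i)) = _
    refine Measure.pi_eq fun s hs => ?_
    have h1 : ∀ i, (X i).kernel 0 (x i) (s i) = (s i).indicator 1 (x i) := fun i => by
      rw [(X i).kernel_zero, Kernel.id_apply, Measure.dirac_apply' _ (hs i)]
    rw [Kernel.id_apply, Measure.dirac_apply' _ (MeasurableSet.univ_pi hs)]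
    simp only [h1]
    classical
    simp only [indicator_apply, Pi.one_apply, Finset.prod_ite_zero, Finset.prod_const_one,
      mem_univ_pi, Finset.mem_univ, true_implies]
  kernel_add r t := by
    ext1 x
    change (Measure.pi fun i => (X i).kernel (r + t) (x i)) = _
    refine Measure.pi_eq fun s hs => ?_
    rw [Kernel.comp_apply' _ _ _ (MeasurableSet.univ_pi hs)]
    change ∫⁻ y, (Measure.pi fun i => (X i).kernel t (y i)) (Set.pi univ s)
      ∂(Measure.pi fun i => (X i).kernel r (x i)) = _
    simp only [Measure.pi_pi]
    rw [lintegral_pi_prod _ (fun i y => (X i).kernel t y (s i))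
      fun i => ((X i).kernel t).measurable_coe (hs i)]
    refine Finset.prod_congr rfl fun i _ => ?_
    rw [(X i).kernel_add, Kernel.comp_apply' _ _ _ (hs i)]

end MarkovTransition

end

/-!
The form of the independent coupling is the restriction of `(½ 𝐃, H¹(ℝ^d))` to the closure of the
tensor product of the one-dimensional domains.

*One dimension.* Since `s' ∈ {0, 1}`, the measure `ds` is Lebesgue measure on `{s' = 1}`.  So
`u = φ ∘ s` in `𝓕^{(s)}` has the weak derivative `s' · (φ' ∘ s)`, which vanishes on `{s' = 0}`, and
`𝓔^{(s)}(u, v) = ½ ∫ u' v' dx` (`BrownianScale.scaleForm_form_eq`).  The functions of `C_c^1(s)` are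
dense in `𝓕^{(s)}` for the norm of `H¹(ℝ)` (`BrownianScale.exists_smoothCore_near`), and by the
Stone–Weierstrass theorem in `L²` and in `C_c` (`IsCutoffAlgebra`).

*Semigroups.* A symmetric sub-Markovian kernel acts on `L²` as a symmetric contraction with the
Markov property.  For a strongly continuous semigroup of such operators the approximating forms
`t⁻¹ (u - T_t u, u)` increase as `t ↓ 0`, because `t ↦ (T_t u, u)` is convex; the limit is a closed
form, and a dense set that is invariant under the semigroup is dense in its domain for the form norm
(`IsSymmSemigroup.exists_energy_sub_lt`).

*Coupling.* The semigroup of the coupling acts on products `f₁ ⊗ ⋯ ⊗ f_d` by the product of the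
semigroups.  Hence the tensor product of the domains `𝓕^{(sᵢ)}` is invariant, and the product rule
at `t = 0` gives the form on it (`tendsto_quot_tensorLp`), which is `½ 𝐃` by the first step
(`brownianForm_tensorLp`).  By density and completeness of `H¹(ℝ^d)`, the domain of the coupling is
contained in `H¹(ℝ^d)`, and its form is `½ 𝐃` there (`exists_tensorDomain_seq`, `energy_eq`).
Approximating each factor by `C_c^1(sᵢ)` makes the tensor product of these spaces a core
(`isCore_tensorSpan_smoothCore`).

*Brownian motion.* That `(½ 𝐃, H¹(ℝ^d))` itself is a regular Dirichlet form is proved with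
translations: `u` has an `i`-th weak derivative of norm at most `C` if and only if translating `u` by
`t` along the `i`-th axis moves it by at most `C |t|` in `L²`, a criterion that contractions of the
values preserve; and averages of translations of `u`, which are mollifications, approximate `u`.

*Properness.* The `i`-th weak derivative of a function in the domain vanishes almost everywhere on
`{x | xᵢ ∈ E_{sᵢ}}`.  A test function that equals `xᵢ` on a large ball does not have this property
if `|E_{sᵢ}| > 0`.
-/

noncomputable section

/-! ### Symmetric contraction semigroups and their forms -/

/-- A continuous midpoint-convex function on an interval is convex. -/
theorem convexOn_of_midpoint {f : ℝ → ℝ} {s : Set ℝ} (hs : Convex ℝ s) (hf : ContinuousOn f s)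
    (hm : ∀ x ∈ s, ∀ h, x + 2 * h ∈ s → 2 * f (x + h) ≤ f x + f (x + 2 * h)) :
    ConvexOn ℝ s f := by
  refine ⟨hs, fun x hx y hy a b ha hb hab => ?_⟩
  have hγ : Continuous fun r : ℝ => x + r * (y - x) := by fun_prop
  have hmem : ∀ r ∈ Icc (0 : ℝ) 1, x + r * (y - x) ∈ s := fun r hr => by
    have := hs hx hy (sub_nonneg.2 hr.2) hr.1 (sub_add_cancel 1 r)
    simp only [smul_eq_mul] at this
    convert this using 1
    ring
  set G : ℝ → ℝ := fun r => f (x + r * (y - x)) - (f x + r * (f y - f x)) with hG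
  have hGc : ContinuousOn G (Icc 0 1) :=
    (hf.comp hγ.continuousOn hmem).sub (by fun_prop)
  suffices H : ∀ r ∈ Icc (0 : ℝ) 1, G r ≤ 0 by
    have h1 := H b ⟨hb, by linarith⟩
    have e : a • x + b • y = x + b * (y - x) := by
      rw [eq_sub_of_add_eq hab]; simp only [smul_eq_mul]; ring
    have e2 : a • f x + b • f y = f x + b * (f y - f x) := by
      rw [eq_sub_of_add_eq hab]; simp only [smul_eq_mul]; ring
    rw [e, e2]
    simp only [hG] at h1
    linarith
  by_contra! hcon
  obtain ⟨r₁, hr₁, hpos⟩ := hcon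
  obtain ⟨z, hz, hzmax⟩ := isCompact_Icc.exists_isMaxOn ⟨r₁, hr₁⟩ hGc
  -- the smallest maximum point of the difference to the chord contradicts midpoint convexity
  set M := G z with hM
  have hMpos : 0 < M := hpos.trans_le (hzmax hr₁)
  have hKc : IsCompact (Icc (0 : ℝ) 1 ∩ G ⁻¹' {M}) :=
    isCompact_Icc.of_isClosed_subset (hGc.preimage_isClosed_of_isClosed isClosed_Icc
      isClosed_singleton) inter_subset_left
  obtain ⟨w, ⟨hw, hwM⟩, hwmin⟩ := hKc.exists_isLeast ⟨z, hz, rfl⟩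
  have hG0 : G 0 = 0 := by simp [hG]
  have hG1 : G 1 = 0 := by simp [hG]
  have hwM' : G w = M := hwM
  have hw0 : 0 < w := lt_of_le_of_ne hw.1 fun h => by rw [← h, hG0] at hwM'; linarith
  have hw1 : w < 1 := lt_of_le_of_ne hw.2 fun h => by rw [h, hG1] at hwM'; linarith
  set h := min w (1 - w) with hh
  have hh0 : 0 < h := lt_min hw0 (by linarith)
  have ha : w - h ∈ Icc (0 : ℝ) 1 := ⟨by linarith [min_le_left w (1 - w)], by linarith⟩
  have hb' : w + h ∈ Icc (0 : ℝ) 1 := ⟨by linarith, by linarith [min_le_right w (1 - w)]⟩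
  have h1 : G (w - h) < M := lt_of_le_of_ne (hzmax ha) fun e => by
    have := hwmin ⟨ha, e⟩; linarith
  have h2 : G (w + h) ≤ M := hzmax hb'
  have key := hm (x + (w - h) * (y - x)) (hmem _ ha) (h * (y - x))
    (by convert hmem _ hb' using 1; ring)
  have e1 : x + (w - h) * (y - x) + h * (y - x) = x + w * (y - x) := by ring
  have e2 : x + (w - h) * (y - x) + 2 * (h * (y - x)) = x + (w + h) * (y - x) := by ring
  rw [e1, e2] at key
  have h3 : 2 * G w ≤ G (w - h) + G (w + h) := by
    simp only [hG]; linarith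
  linarith

section Semigroup

variable {H : Type*} [NormedAddCommGroup H] [InnerProductSpace ℝ H]

/-- A semigroup of symmetric contractions of a real Hilbert space. -/
structure IsSymmSemigroup (T : ℝ≥0 → H →L[ℝ] H) : Prop where
  zero : ∀ u, T 0 u = u
  add : ∀ r t u, T (r + t) u = T r (T t u)
  symm : ∀ t u v, inner ℝ (T t u) v = inner ℝ u (T t v)
  contr : ∀ t u, ‖T t u‖ ≤ ‖u‖

/-- The approximating form `t⁻¹ (u - T_t u, v)`. -/
def quot (T : ℝ≥0 → H →L[ℝ] H) (t : ℝ≥0) (u v : H) : ℝ :=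
  (t : ℝ)⁻¹ * inner ℝ (u - T t u) v

/-- The form domain of a symmetric semigroup: the vectors with bounded approximating forms. -/
def formDomain (T : ℝ≥0 → H →L[ℝ] H) : Set H :=
  {u | ∃ C, ∀ t > 0, quot T t u u ≤ C}

/-- The form `lim_{t ↓ 0} t⁻¹ (u - T_t u, v)` of a symmetric semigroup. -/
def energy (T : ℝ≥0 → H →L[ℝ] H) (u v : H) : ℝ :=
  limUnder (𝓝[>] (0 : ℝ≥0)) fun t => quot T t u v

instance : (𝓝[>] (0 : ℝ≥0)).NeBot := nhdsGT_neBot 0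

theorem tendsto_coe_nhdsGT_zero : Tendsto (fun t : ℝ≥0 => (t : ℝ)) (𝓝[>] 0) (𝓝[>] 0) := by
  refine tendsto_nhdsWithin_iff.2 ⟨?_, ?_⟩
  · have : Tendsto (fun t : ℝ≥0 => (t : ℝ)) (𝓝 0) (𝓝 ((0 : ℝ≥0) : ℝ)) :=
      NNReal.continuous_coe.tendsto 0
    exact this.mono_left nhdsWithin_le_nhds
  · filter_upwards [self_mem_nhdsWithin] with t ht
    exact NNReal.coe_pos.2 ht

variable {T : ℝ≥0 → H →L[ℝ] H}

theorem quot_add_left (t : ℝ≥0) (u v w : H) : quot T t (u + v) w = quot T t u w + quot T t v w := by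
  simp only [quot, map_add]
  rw [add_sub_add_comm, inner_add_left, mul_add]

theorem quot_smul_left (t : ℝ≥0) (c : ℝ) (u w : H) : quot T t (c • u) w = c * quot T t u w := by
  simp only [quot, map_smul]
  rw [← smul_sub, real_inner_smul_left]
  ring

namespace IsSymmSemigroup

theorem quot_comm (hT : IsSymmSemigroup T) (t : ℝ≥0) (u v : H) : quot T t u v = quot T t v u := by
  simp only [quot, inner_sub_left, hT.symm t u v, real_inner_comm v u, real_inner_comm (T t v) u]

theorem quot_add_right (hT : IsSymmSemigroup T) (t : ℝ≥0) (u v w : H) :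
    quot T t u (v + w) = quot T t u v + quot T t u w := by
  rw [hT.quot_comm, quot_add_left, hT.quot_comm t v, hT.quot_comm t w]

theorem quot_smul_right (hT : IsSymmSemigroup T) (t : ℝ≥0) (c : ℝ) (u w : H) :
    quot T t u (c • w) = c * quot T t u w := by
  rw [hT.quot_comm, quot_smul_left, hT.quot_comm]

theorem quot_nonneg (hT : IsSymmSemigroup T) (t : ℝ≥0) (u : H) : 0 ≤ quot T t u u := by
  refine mul_nonneg (by positivity) ?_
  rw [inner_sub_left, real_inner_self_eq_norm_sq]
  nlinarith [real_inner_le_norm (T t u) u, hT.contr t u, norm_nonneg u]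

theorem inner_eq (hT : IsSymmSemigroup T) (r t : ℝ≥0) (u v : H) :
    inner ℝ (T (r + t) u) v = inner ℝ (T t u) (T r v) := by
  rw [hT.add, hT.symm]

theorem quot_add_add_sub_sub (hT : IsSymmSemigroup T) (t : ℝ≥0) (u v : H) :
    quot T t (u + v) (u + v) + quot T t (u - v) (u - v) =
      2 * quot T t u u + 2 * quot T t v v := by
  rw [sub_eq_add_neg, ← neg_one_smul ℝ v]
  simp only [quot_add_left, quot_smul_left, hT.quot_add_right, hT.quot_smul_right]
  ring

theorem add_mem (hT : IsSymmSemigroup T) {u v : H} (hu : u ∈ formDomain T)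
    (hv : v ∈ formDomain T) : u + v ∈ formDomain T := by
  obtain ⟨C, hC⟩ := hu
  obtain ⟨D, hD⟩ := hv
  refine ⟨2 * C + 2 * D, fun t ht => ?_⟩
  linarith [hT.quot_add_add_sub_sub t u v, hT.quot_nonneg t (u - v), hC t ht, hD t ht]

theorem smul_mem (hT : IsSymmSemigroup T) (c : ℝ) {u : H} (hu : u ∈ formDomain T) :
    c • u ∈ formDomain T := by
  obtain ⟨C, hC⟩ := hu
  refine ⟨c * c * C, fun t ht => ?_⟩
  rw [quot_smul_left, hT.quot_smul_right, ← mul_assoc]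
  exact mul_le_mul_of_nonneg_left (hC t ht) (mul_self_nonneg c)

theorem sub_mem (hT : IsSymmSemigroup T) {u v : H} (hu : u ∈ formDomain T)
    (hv : v ∈ formDomain T) : u - v ∈ formDomain T := by
  rw [sub_eq_add_neg, ← neg_one_smul ℝ v]
  exact hT.add_mem hu (hT.smul_mem _ hv)

/-- If `(u - T_t u, u) → 0` for the `u` in a dense set, then the semigroup is strongly continuous. -/
theorem tendsto_self (hT : IsSymmSemigroup T) {D : Set H} (hD : Dense D)
    (h : ∀ u ∈ D, Tendsto (fun t => inner ℝ (u - T t u) u) (𝓝[>] 0) (𝓝 0)) (u : H) :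
    Tendsto (fun t => T t u) (𝓝[>] 0) (𝓝 u) := by
  have key : ∀ v ∈ D, Tendsto (fun t => ‖v - T t v‖) (𝓝[>] 0) (𝓝 0) := fun v hv => by
    have h1 : ∀ t, ‖v - T t v‖ ^ 2 ≤ 2 * inner ℝ (v - T t v) v := fun t => by
      rw [norm_sub_sq_real, inner_sub_left, real_inner_self_eq_norm_sq, real_inner_comm]
      have := hT.contr t v
      nlinarith [norm_nonneg (T t v), norm_nonneg v]
    have h2 : Tendsto (fun t => ‖v - T t v‖ ^ 2) (𝓝[>] 0) (𝓝 0) :=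
      squeeze_zero (fun t => sq_nonneg _) h1 (by simpa using (h v hv).const_mul 2)
    simpa [Real.sqrt_sq] using h2.sqrt
  rw [Metric.tendsto_nhds]
  intro ε hε
  obtain ⟨v, hvD, hv⟩ := hD.exists_dist_lt u (show 0 < ε / 3 by positivity)
  filter_upwards [(Metric.tendsto_nhds.1 (key v hvD)) (ε / 3) (by positivity)] with t ht
  rw [Real.dist_0_eq_abs, abs_norm] at ht
  rw [dist_eq_norm] at hv ⊢
  have e : T t u - u = T t (u - v) + -(u - v) + -(v - T t v) := by rw [map_sub]; abel
  rw [e]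
  have := hT.contr t (u - v)
  calc _ ≤ ‖T t (u - v)‖ + ‖-(u - v)‖ + ‖-(v - T t v)‖ := norm_add₃_le
    _ < ε := by rw [norm_neg, norm_neg]; linarith

/-- `t ↦ (T_t u, u)` is convex. -/
theorem convexOn_inner (hT : IsSymmSemigroup T)
    (hc : ∀ u, Tendsto (fun t => T t u) (𝓝[>] 0) (𝓝 u)) (u : H) :
    ConvexOn ℝ (Ici (0 : ℝ)) fun x => inner ℝ (T x.toNNReal u) u := by
  have hmono : ∀ r t : ℝ≥0, |inner ℝ (T (r + t) u) u - inner ℝ (T r u) u| ≤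
      ‖T t u - u‖ * ‖u‖ := fun r t => by
    rw [← inner_sub_left, hT.add, ← map_sub]
    exact (abs_real_inner_le_norm _ _).trans
      (mul_le_mul_of_nonneg_right (hT.contr _ _) (norm_nonneg _))
  refine convexOn_of_midpoint (convex_Ici 0) ?_ ?_
  · refine Continuous.continuousOn ?_
    refine Continuous.comp (g := fun t : ℝ≥0 => inner ℝ (T t u) u) ?_ continuous_real_toNNReal
    rw [Metric.continuous_iff]
    intro b ε hε
    have h1 : Tendsto (fun t => ‖T t u - u‖ * ‖u‖) (𝓝[>] 0) (𝓝 0) := by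
      simpa using ((hc u).sub_const u).norm.mul_const ‖u‖
    have h2 : ∀ᶠ t in 𝓝[>] (0 : ℝ≥0), ‖T t u - u‖ * ‖u‖ < ε := h1.eventually_lt_const hε
    obtain ⟨δ, hδ, hδ2⟩ := Metric.mem_nhdsWithin_iff.1 h2
    have hle : ∀ r t : ℝ≥0, t < δ → dist (inner ℝ (T (r + t) u) u) (inner ℝ (T r u) u) < ε := by
      intro r t ht
      rcases eq_or_lt_of_le (zero_le : 0 ≤ t) with h0 | h0
      · rw [← h0]; simpa using hε
      · refine (hmono r t).trans_lt (hδ2 ⟨?_, h0⟩)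
        rw [Metric.mem_ball, NNReal.dist_eq]
        simpa using ht
    refine ⟨δ, hδ, fun a ha => ?_⟩
    rw [NNReal.dist_eq] at ha
    rcases le_total a b with hab | hab
    · obtain ⟨c, rfl⟩ := exists_add_of_le hab
      rw [dist_comm]
      refine hle a c ?_
      simpa using ha
    · obtain ⟨c, rfl⟩ := exists_add_of_le hab
      refine hle b c ?_
      simpa using ha
  · intro x hx h hxh
    simp only [mem_Ici] at hx hxh
    -- both exponents are written with the half-way points `x / 2` and `x / 2 + h`
    set a : ℝ≥0 := (x / 2).toNNReal
    set b : ℝ≥0 := (x / 2 + h).toNNReal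
    have e1 : (x + h).toNNReal = a + b := by
      rw [← Real.toNNReal_add (by linarith) (by linarith)]; congr 1; ring
    have e2 : x.toNNReal = a + a := by
      rw [← Real.toNNReal_add (by linarith) (by linarith)]; congr 1; ring
    have e3 : (x + 2 * h).toNNReal = b + b := by
      rw [← Real.toNNReal_add (by linarith) (by linarith)]; congr 1; ring
    rw [e1, e2, e3, hT.inner_eq, hT.inner_eq, hT.inner_eq, real_inner_self_eq_norm_sq,
      real_inner_self_eq_norm_sq]
    nlinarith [real_inner_le_norm (T b u) (T a u), sq_nonneg (‖T a u‖ - ‖T b u‖)]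

theorem inner_apply_apply (hT : IsSymmSemigroup T) (s t : ℝ≥0) (u : H) :
    (s : ℝ) * quot T s (T t u) (T t u) =
      inner ℝ (T (t + t) u) u - inner ℝ (T (t + t + s) u) u := by
  rcases eq_or_ne s 0 with rfl | hs
  · simp
  · rw [quot, ← mul_assoc, mul_inv_cancel₀ (NNReal.coe_ne_zero.2 hs), one_mul, inner_sub_left,
      hT.inner_eq, add_assoc, hT.inner_eq, ← hT.add, add_comm s t]

theorem coe_mul_quot (hT : IsSymmSemigroup T) (s : ℝ≥0) (u : H) :
    (s : ℝ) * quot T s u u = inner ℝ (T 0 u) u - inner ℝ (T s u) u := by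
  simpa [hT.zero] using hT.inner_apply_apply s 0 u

/-- The approximating forms increase as `t ↓ 0`. -/
theorem quot_antitone (hT : IsSymmSemigroup T)
    (hc : ∀ u, Tendsto (fun t => T t u) (𝓝[>] 0) (𝓝 u)) (u : H) {s t : ℝ≥0} (hs : 0 < s)
    (hst : s ≤ t) : quot T t u u ≤ quot T s u u := by
  have hs' : (0 : ℝ) < s := hs
  have ht' : (0 : ℝ) < t := hs.trans_le hst
  have h := (hT.convexOn_inner hc u).secant_mono (a := 0) (x := s) (y := t) (by simp) (by simp)
    (by simp) hs'.ne' ht'.ne' (by exact_mod_cast hst)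
  simp only [Real.toNNReal_coe, Real.toNNReal_zero, sub_zero] at h
  have h1 := hT.coe_mul_quot s u
  have h2 := hT.coe_mul_quot t u
  rw [div_le_div_iff₀ hs' ht'] at h
  have e1 : inner ℝ (T s u) u - inner ℝ (T 0 u) u = -((s : ℝ) * quot T s u u) := by linarith
  have e2 : inner ℝ (T t u) u - inner ℝ (T 0 u) u = -((t : ℝ) * quot T t u u) := by linarith
  rw [e1, e2] at h
  have h3 : (s : ℝ) * t * quot T t u u ≤ s * t * quot T s u u := by linarith
  exact le_of_mul_le_mul_left h3 (mul_pos hs' ht')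

theorem quot_apply_le (hT : IsSymmSemigroup T)
    (hc : ∀ u, Tendsto (fun t => T t u) (𝓝[>] 0) (𝓝 u)) (u : H) {s : ℝ≥0} (hs : 0 < s)
    (t : ℝ≥0) : quot T s (T t u) (T t u) ≤ quot T s u u := by
  have hs' : (0 : ℝ) < s := hs
  refine le_of_mul_le_mul_left ?_ hs'
  rw [hT.inner_apply_apply, hT.coe_mul_quot]
  set a : ℝ≥0 := t + t
  have hcv := (hT.convexOn_inner hc u).2
  have hpos : (0 : ℝ) < a + s := add_pos_of_nonneg_of_pos a.2 hs'
  have h1 := hcv (x := 0) (y := a + s) (by simp) (by simpa using hpos.le)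
    (a := a / (a + s)) (b := s / (a + s)) (by positivity) (by positivity) (by field_simp)
  have h2 := hcv (x := 0) (y := a + s) (by simp) (by simpa using hpos.le)
    (a := s / (a + s)) (b := a / (a + s)) (by positivity) (by positivity) (by field_simp; ring)
  simp only [smul_eq_mul, mul_zero, zero_add, div_mul_cancel₀ _ hpos.ne', Real.toNNReal_coe,
    Real.toNNReal_zero] at h1 h2
  have e : ((a : ℝ) + s).toNNReal = a + s := by
    rw [← NNReal.coe_add, Real.toNNReal_coe]
  rw [e] at h1 h2
  have e3 : (a : ℝ) / (a + s) = 1 - s / (a + s) := by field_simp; ring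
  rw [e3] at h1 h2
  linarith

/-- The smoothing effect of the semigroup: `T_t` maps the whole space into the form domain. -/
theorem quot_apply_le_div (hT : IsSymmSemigroup T)
    (hc : ∀ u, Tendsto (fun t => T t u) (𝓝[>] 0) (𝓝 u)) (u : H) {s t : ℝ≥0} (hs : 0 < s)
    (ht : 0 < t) : quot T s (T t u) (T t u) ≤ (2 * t : ℝ)⁻¹ * ‖u‖ ^ 2 := by
  have hs' : (0 : ℝ) < s := hs
  have ht' : (0 : ℝ) < t := ht
  have h := (hT.convexOn_inner hc u).slope_mono_adjacent (x := 0) (y := 2 * t) (z := 2 * t + s)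
    (by simp) (by simp only [mem_Ici]; positivity) (by positivity) (by linarith)
  have e1 : (2 * t : ℝ).toNNReal = t + t := by
    rw [two_mul, ← NNReal.coe_add, Real.toNNReal_coe]
  have e2 : (2 * t + s : ℝ).toNNReal = t + t + s := by
    rw [two_mul, ← NNReal.coe_add, ← NNReal.coe_add, Real.toNNReal_coe]
  rw [e1, e2] at h
  have h2 := hT.inner_apply_apply s t u
  have h3 : inner ℝ (T (t + t + s) u) u - inner ℝ (T (t + t) u) u =
    -((s : ℝ) * quot T s (T t u) (T t u)) := by linarith
  rw [h3, Real.toNNReal_zero, hT.zero, real_inner_self_eq_norm_sq, sub_zero, add_sub_cancel_left,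
    neg_div, mul_div_cancel_left₀ _ hs'.ne'] at h
  have h4 : 0 ≤ inner ℝ (T (t + t) u) u := by
    rw [hT.inner_eq]; exact real_inner_self_nonneg
  have h5 : -(2 * t : ℝ)⁻¹ * ‖u‖ ^ 2 ≤ (inner ℝ (T (t + t) u) u - ‖u‖ ^ 2) / (2 * t) := by
    rw [div_eq_inv_mul, neg_mul, ← mul_neg]
    exact mul_le_mul_of_nonneg_left (by linarith) (by positivity)
  linarith

theorem tendsto_quot_self (hT : IsSymmSemigroup T)
    (hc : ∀ u, Tendsto (fun t => T t u) (𝓝[>] 0) (𝓝 u)) {u : H} (hu : u ∈ formDomain T) :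
    ∃ l, Tendsto (fun t => quot T t u u) (𝓝[>] 0) (𝓝 l) ∧ ∀ t > 0, quot T t u u ≤ l := by
  obtain ⟨C, hC⟩ := hu
  set S : Set ℝ := (fun t => quot T t u u) '' Ioi 0
  have hb : BddAbove S := ⟨C, by rintro _ ⟨t, ht, rfl⟩; exact hC t ht⟩
  have hne : S.Nonempty := ⟨_, 1, mem_Ioi.2 one_pos, rfl⟩
  have hle : ∀ t > 0, quot T t u u ≤ sSup S := fun t ht => le_csSup hb ⟨t, ht, rfl⟩
  refine ⟨sSup S, ?_, hle⟩
  rw [tendsto_order]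
  refine ⟨fun a ha => ?_, fun a ha => ?_⟩
  · obtain ⟨_, ⟨t, ht, rfl⟩, hat⟩ := exists_lt_of_lt_csSup hne ha
    filter_upwards [Ioc_mem_nhdsGT ht] with s hs
    exact hat.trans_le (hT.quot_antitone hc u hs.1 hs.2)
  · filter_upwards [self_mem_nhdsWithin] with t ht
    exact (hle t ht).trans_lt ha

theorem tendsto_energy (hT : IsSymmSemigroup T)
    (hc : ∀ u, Tendsto (fun t => T t u) (𝓝[>] 0) (𝓝 u)) {u v : H} (hu : u ∈ formDomain T)
    (hv : v ∈ formDomain T) :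
    Tendsto (fun t => quot T t u v) (𝓝[>] 0) (𝓝 (energy T u v)) := by
  obtain ⟨l₁, h₁, -⟩ := hT.tendsto_quot_self hc (hT.add_mem hu hv)
  obtain ⟨l₂, h₂, -⟩ := hT.tendsto_quot_self hc (hT.sub_mem hu hv)
  refine tendsto_nhds_limUnder ⟨(l₁ - l₂) / 4, ?_⟩
  refine ((h₁.sub h₂).div_const 4).congr fun t => ?_
  rw [sub_eq_add_neg u, ← neg_one_smul ℝ v]
  simp only [quot_add_left, quot_smul_left, hT.quot_add_right, hT.quot_smul_right]
  rw [hT.quot_comm t v u]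
  ring

theorem quot_le_energy (hT : IsSymmSemigroup T)
    (hc : ∀ u, Tendsto (fun t => T t u) (𝓝[>] 0) (𝓝 u)) {u : H} (hu : u ∈ formDomain T)
    {t : ℝ≥0} (ht : 0 < t) : quot T t u u ≤ energy T u u := by
  obtain ⟨l, hl, hle⟩ := hT.tendsto_quot_self hc hu
  rw [tendsto_nhds_unique (hT.tendsto_energy hc hu hu) hl]
  exact hle t ht

/-- A vector is in the form domain if and only if its approximating forms have a finite limit. -/
theorem mem_formDomain_iff (hT : IsSymmSemigroup T)
    (hc : ∀ u, Tendsto (fun t => T t u) (𝓝[>] 0) (𝓝 u)) (u : H) :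
    u ∈ formDomain T ↔ ∃ l, Tendsto (fun t => quot T t u u) (𝓝[>] 0) (𝓝 l) := by
  refine ⟨fun hu => ⟨_, hT.tendsto_energy hc hu hu⟩, fun ⟨l, hl⟩ => ⟨l, fun t ht => ?_⟩⟩
  refine ge_of_tendsto hl ?_
  filter_upwards [Ioc_mem_nhdsGT ht] with s hs
  exact hT.quot_antitone hc u hs.1 hs.2

theorem continuous_quot (T : ℝ≥0 → H →L[ℝ] H) (t : ℝ≥0) : Continuous fun u => quot T t u u := by
  unfold quot
  fun_prop

/-- Lower semicontinuity of the form with respect to convergence in the Hilbert space. -/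
theorem mem_of_tendsto (hT : IsSymmSemigroup T)
    (hc : ∀ u, Tendsto (fun t => T t u) (𝓝[>] 0) (𝓝 u)) {u : ℕ → H} {w : H} {C : ℝ}
    (hu : ∀ n, u n ∈ formDomain T) (hC : ∀ᶠ n in atTop, energy T (u n) (u n) ≤ C)
    (hw : Tendsto u atTop (𝓝 w)) : w ∈ formDomain T ∧ energy T w w ≤ C := by
  have key : ∀ t > 0, quot T t w w ≤ C := fun t ht => by
    refine le_of_tendsto (((continuous_quot T t).tendsto w).comp hw) ?_
    filter_upwards [hC] with n hn
    exact (hT.quot_le_energy hc (hu n) ht).trans hn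
  have hmem : w ∈ formDomain T := ⟨C, key⟩
  refine ⟨hmem, le_of_tendsto (hT.tendsto_energy hc hmem hmem) ?_⟩
  filter_upwards [self_mem_nhdsWithin] with t ht using key t ht

theorem energy_add_left (hT : IsSymmSemigroup T)
    (hc : ∀ u, Tendsto (fun t => T t u) (𝓝[>] 0) (𝓝 u)) {u v w : H} (hu : u ∈ formDomain T)
    (hv : v ∈ formDomain T) (hw : w ∈ formDomain T) :
    energy T (u + v) w = energy T u w + energy T v w :=
  tendsto_nhds_unique (hT.tendsto_energy hc (hT.add_mem hu hv) hw)
    (((hT.tendsto_energy hc hu hw).add (hT.tendsto_energy hc hv hw)).congr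
      fun t => (quot_add_left t u v w).symm)

theorem energy_smul_left (hT : IsSymmSemigroup T)
    (hc : ∀ u, Tendsto (fun t => T t u) (𝓝[>] 0) (𝓝 u)) (c : ℝ) {u w : H}
    (hu : u ∈ formDomain T) (hw : w ∈ formDomain T) :
    energy T (c • u) w = c * energy T u w :=
  tendsto_nhds_unique (hT.tendsto_energy hc (hT.smul_mem c hu) hw)
    (((hT.tendsto_energy hc hu hw).const_mul c).congr fun t => (quot_smul_left t c u w).symm)

theorem energy_comm (hT : IsSymmSemigroup T)
    (hc : ∀ u, Tendsto (fun t => T t u) (𝓝[>] 0) (𝓝 u)) {u v : H} (hu : u ∈ formDomain T)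
    (hv : v ∈ formDomain T) : energy T u v = energy T v u :=
  tendsto_nhds_unique (hT.tendsto_energy hc hu hv)
    ((hT.tendsto_energy hc hv hu).congr fun t => hT.quot_comm t v u)

theorem energy_nonneg (hT : IsSymmSemigroup T)
    (hc : ∀ u, Tendsto (fun t => T t u) (𝓝[>] 0) (𝓝 u)) {u : H} (hu : u ∈ formDomain T) :
    0 ≤ energy T u u :=
  ge_of_tendsto' (hT.tendsto_energy hc hu hu) fun t => hT.quot_nonneg t u

theorem energy_add_add_sub_sub (hT : IsSymmSemigroup T)
    (hc : ∀ u, Tendsto (fun t => T t u) (𝓝[>] 0) (𝓝 u)) {u v : H} (hu : u ∈ formDomain T)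
    (hv : v ∈ formDomain T) :
    energy T (u + v) (u + v) + energy T (u - v) (u - v) =
      2 * energy T u u + 2 * energy T v v := by
  have ha := hT.add_mem hu hv
  have hs := hT.sub_mem hu hv
  refine tendsto_nhds_unique ((hT.tendsto_energy hc ha ha).add (hT.tendsto_energy hc hs hs))
    ((((hT.tendsto_energy hc hu hu).const_mul 2).add
      ((hT.tendsto_energy hc hv hv).const_mul 2)).congr fun t => ?_)
  exact (hT.quot_add_add_sub_sub t u v).symm

theorem energy_add_le (hT : IsSymmSemigroup T)
    (hc : ∀ u, Tendsto (fun t => T t u) (𝓝[>] 0) (𝓝 u)) {u v : H} (hu : u ∈ formDomain T)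
    (hv : v ∈ formDomain T) :
    energy T (u + v) (u + v) ≤ 2 * energy T u u + 2 * energy T v v := by
  linarith [hT.energy_add_add_sub_sub hc hu hv, hT.energy_nonneg hc (hT.sub_mem hu hv)]

theorem apply_mem (hT : IsSymmSemigroup T)
    (hc : ∀ u, Tendsto (fun t => T t u) (𝓝[>] 0) (𝓝 u)) {t : ℝ≥0} (ht : 0 < t) (u : H) :
    T t u ∈ formDomain T ∧ energy T (T t u) (T t u) ≤ (2 * t : ℝ)⁻¹ * ‖u‖ ^ 2 := by
  have hmem : T t u ∈ formDomain T := ⟨_, fun s hs => hT.quot_apply_le_div hc u hs ht⟩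
  refine ⟨hmem, le_of_tendsto (hT.tendsto_energy hc hmem hmem) ?_⟩
  filter_upwards [self_mem_nhdsWithin] with s hs using hT.quot_apply_le_div hc u hs ht

/-- For `u` in the form domain, `T_t u → u` in the form norm as `t ↓ 0`.  The energies of `T_t u`
are bounded by that of `u`.  The energy of `u + T_t u` is bounded from below by an approximating
form for a fixed time, which is continuous and hence tends to its value at `2u`, close to four times
the energy of `u`.  The parallelogram identity turns both bounds into one for `u - T_t u`. -/
theorem tendsto_energy_sub (hT : IsSymmSemigroup T)
    (hc : ∀ u, Tendsto (fun t => T t u) (𝓝[>] 0) (𝓝 u)) {u : H} (hu : u ∈ formDomain T) {ε : ℝ}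
    (hε : 0 < ε) : ∀ᶠ t in 𝓝[>] (0 : ℝ≥0), energy T (u - T t u) (u - T t u) < ε := by
  have hle : ∀ t > 0, energy T (T t u) (T t u) ≤ energy T u u := fun t ht => by
    have hm := (hT.apply_mem hc ht u).1
    refine le_of_tendsto (hT.tendsto_energy hc hm hm) ?_
    filter_upwards [self_mem_nhdsWithin] with s hs
    exact (hT.quot_apply_le hc u hs t).trans (hT.quot_le_energy hc hu hs)
  -- a time `s` at which the approximating form is close to its limit
  obtain ⟨s, hs, hs'⟩ : ∃ s > 0, energy T u u - ε / 8 < quot T s u u := by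
    have := (hT.tendsto_energy hc hu hu).eventually_const_lt
      (show energy T u u - ε / 8 < energy T u u by linarith)
    obtain ⟨s, h1, h2⟩ := (this.and self_mem_nhdsWithin).exists
    exact ⟨s, h2, h1⟩
  have h1 : Tendsto (fun t => quot T s (u + T t u) (u + T t u)) (𝓝[>] 0)
      (𝓝 (quot T s (u + u) (u + u))) :=
    ((continuous_quot T s).tendsto _).comp ((hc u).const_add u)
  have h2 : quot T s (u + u) (u + u) = 4 * quot T s u u := by
    simp only [quot_add_left, hT.quot_add_right]; ring
  rw [h2] at h1
  filter_upwards [h1.eventually_const_lt (show 4 * quot T s u u - ε / 2 < 4 * quot T s u u by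
    linarith), self_mem_nhdsWithin] with t ht ht0
  have hm := (hT.apply_mem hc ht0 u).1
  have h3 := hT.quot_le_energy hc (hT.add_mem hu hm) hs
  linarith [hT.energy_add_add_sub_sub hc hu hm, hle t ht0]

/-- A dense invariant subset of the form domain is dense in it for the form norm. -/
theorem exists_energy_sub_lt (hT : IsSymmSemigroup T)
    (hc : ∀ u, Tendsto (fun t => T t u) (𝓝[>] 0) (𝓝 u)) {D : Set H} (hD : Dense D)
    (hTD : ∀ t, ∀ u ∈ D, T t u ∈ D) {u : H} (hu : u ∈ formDomain T) {ε : ℝ} (hε : 0 < ε) :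
    ∃ v ∈ D, v ∈ formDomain T ∧ energy T (u - v) (u - v) < ε ∧ ‖u - v‖ < ε := by
  have h1 : Tendsto (fun t => ‖u - T t u‖) (𝓝[>] 0) (𝓝 0) := by
    simpa using ((hc u).const_sub u).norm
  obtain ⟨t, ⟨ht1, ht2⟩, ht0⟩ := (((hT.tendsto_energy_sub hc hu (show 0 < ε / 4 by
    positivity)).and (h1.eventually_lt_const (show 0 < ε / 2 by positivity))).and
    self_mem_nhdsWithin).exists
  have ht0' : (0 : ℝ) < t := ht0
  have h2 : Tendsto (fun v => (2 * t : ℝ)⁻¹ * ‖u - v‖ ^ 2) (𝓝 u) (𝓝 0) := by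
    have : Continuous fun v => (2 * t : ℝ)⁻¹ * ‖u - v‖ ^ 2 := by fun_prop
    simpa using this.tendsto u
  have h3 : Tendsto (fun v => ‖u - v‖) (𝓝 u) (𝓝 0) := by
    have : Continuous fun v => ‖u - v‖ := by fun_prop
    simpa using this.tendsto u
  obtain ⟨v, hvD, hv1, hv2⟩ := ((mem_closure_iff_frequently.1 (hD u)).and_eventually
    ((h2.eventually_lt_const (show 0 < ε / 4 by positivity)).and
      (h3.eventually_lt_const (show 0 < ε / 2 by positivity)))).exists
  obtain ⟨hm, hme⟩ := hT.apply_mem hc ht0 (u - v)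
  have hmu := (hT.apply_mem hc ht0 u).1
  have e : u - T t v = (u - T t u) + T t (u - v) := by rw [map_sub]; abel
  refine ⟨T t v, hTD t v hvD, (hT.apply_mem hc ht0 v).1, ?_, ?_⟩
  · rw [e]
    linarith [hT.energy_add_le hc (hT.sub_mem hu hmu) hm]
  · rw [e]
    linarith [norm_add_le (u - T t u) (T t (u - v)), hT.contr t (u - v)]

end IsSymmSemigroup

end Semigroup

/-! ### The action of symmetric sub-Markovian kernels on `L²` -/

section KernelOp

variable {E : Type*} [MeasurableSpace E] {m : Measure E} {κ : Kernel E E}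

theorem eLpNorm_two_sq (f : E → ℝ) (μ : Measure E) :
    eLpNorm f 2 μ ^ 2 = ∫⁻ x, ‖f x‖ₑ ^ 2 ∂μ := by
  have := eLpNorm_nnreal_pow_eq_lintegral (f := f) (μ := μ) (p := 2) two_ne_zero
  simpa only [NNReal.coe_ofNat, ENNReal.rpow_two, ENNReal.coe_ofNat] using this

/-- An `m`-symmetric kernel with total masses at most one. -/
structure IsSymmSubMarkov (κ : Kernel E E) (m : Measure E) : Prop where
  mass_le_one : ∀ x, κ x univ ≤ 1
  symm : ∀ A B : Set E, MeasurableSet A → MeasurableSet B →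
    ∫⁻ x in A, κ x B ∂m = ∫⁻ x in B, κ x A ∂m

namespace IsSymmSubMarkov

theorem isFiniteMeasure (hκ : IsSymmSubMarkov κ m) (x : E) : IsFiniteMeasure (κ x) :=
  ⟨(hκ.mass_le_one x).trans_lt ENNReal.one_lt_top⟩

/-- By symmetry the measure `m` is excessive for the kernel. -/
theorem bind_le (hκ : IsSymmSubMarkov κ m) : m.bind κ ≤ m := by
  refine Measure.le_iff.2 fun B hB => ?_
  rw [Measure.bind_apply hB κ.measurable.aemeasurable, ← setLIntegral_univ,
    hκ.symm univ B MeasurableSet.univ hB]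
  calc _ ≤ ∫⁻ _ in B, 1 ∂m := lintegral_mono fun x => hκ.mass_le_one x
    _ = m B := by simp

theorem ae_ae (hκ : IsSymmSubMarkov κ m) {p : E → Prop} (h : ∀ᵐ y ∂m, p y) :
    ∀ᵐ x ∂m, ∀ᵐ y ∂κ x, p y :=
  Measure.ae_ae_of_ae_bind κ.measurable.aemeasurable
    ((Measure.absolutelyContinuous_of_le hκ.bind_le).ae_le h)

theorem lintegral_lintegral_le (hκ : IsSymmSubMarkov κ m) {f : E → ℝ≥0∞} (hf : Measurable f) :
    ∫⁻ x, ∫⁻ y, f y ∂κ x ∂m ≤ ∫⁻ y, f y ∂m := by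
  rw [← Measure.lintegral_bind κ.measurable.aemeasurable hf.aemeasurable]
  exact lintegral_mono' hκ.bind_le le_rfl

theorem ae_memLp (hκ : IsSymmSubMarkov κ m) (u : Lp ℝ 2 m) : ∀ᵐ x ∂m, MemLp u 2 (κ x) := by
  have hm : Measurable fun y => ‖u y‖ₑ ^ 2 := (Lp.stronglyMeasurable u).measurable.enorm.pow_const 2
  have h : ∫⁻ x, ∫⁻ y, ‖u y‖ₑ ^ 2 ∂κ x ∂m ≠ ∞ := by
    refine ((hκ.lintegral_lintegral_le hm).trans_lt ?_).ne
    rw [← eLpNorm_two_sq]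
    exact ENNReal.pow_lt_top (Lp.eLpNorm_lt_top u)
  filter_upwards [ae_lt_top hm.lintegral_kernel h] with x hx
  refine ⟨(Lp.stronglyMeasurable u).aestronglyMeasurable, ?_⟩
  rw [← eLpNorm_two_sq] at hx
  by_contra hcon
  rw [not_lt, top_le_iff] at hcon
  simp [hcon] at hx

theorem ae_integrable (hκ : IsSymmSubMarkov κ m) (u : Lp ℝ 2 m) :
    ∀ᵐ x ∂m, Integrable u (κ x) := by
  filter_upwards [hκ.ae_memLp u] with x hx
  have := hκ.isFiniteMeasure x
  exact hx.integrable (by norm_num)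

/-- Jensen's inequality for the kernel. -/
theorem enorm_integral_sq_le (hκ : IsSymmSubMarkov κ m) (u : Lp ℝ 2 m) (x : E) :
    ‖∫ y, u y ∂κ x‖ₑ ^ 2 ≤ ∫⁻ y, ‖u y‖ₑ ^ 2 ∂κ x := by
  rw [← eLpNorm_two_sq]
  gcongr
  calc ‖∫ y, u y ∂κ x‖ₑ ≤ ∫⁻ y, ‖u y‖ₑ ∂κ x := enorm_integral_le_lintegral_enorm _
    _ = eLpNorm u 1 (κ x) := eLpNorm_one_eq_lintegral_enorm.symm
    _ ≤ eLpNorm u 2 (κ x) * κ x univ ^ (1 / (1 : ℝ≥0∞).toReal - 1 / (2 : ℝ≥0∞).toReal) :=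
      eLpNorm_le_eLpNorm_mul_rpow_measure_univ (by norm_num)
        (Lp.stronglyMeasurable u).aestronglyMeasurable
    _ ≤ eLpNorm u 2 (κ x) * 1 := by
      gcongr
      exact ENNReal.rpow_le_one (hκ.mass_le_one x) (by norm_num)
    _ = _ := mul_one _

theorem eLpNorm_integral_le (hκ : IsSymmSubMarkov κ m) (u : Lp ℝ 2 m) :
    eLpNorm (fun x => ∫ y, u y ∂κ x) 2 m ≤ eLpNorm u 2 m := by
  refine (ENNReal.pow_le_pow_left_iff two_ne_zero).1 ?_
  rw [eLpNorm_two_sq, eLpNorm_two_sq]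
  exact (lintegral_mono fun x => hκ.enorm_integral_sq_le u x).trans
    (hκ.lintegral_lintegral_le ((Lp.stronglyMeasurable u).measurable.enorm.pow_const 2))

theorem memLp_integral (hκ : IsSymmSubMarkov κ m) (u : Lp ℝ 2 m) :
    MemLp (fun x => ∫ y, u y ∂κ x) 2 m :=
  ⟨((Lp.stronglyMeasurable u).integral_kernel).aestronglyMeasurable,
    (hκ.eLpNorm_integral_le u).trans_lt (Lp.eLpNorm_lt_top u)⟩

/-- The operator `u ↦ ∫ u(y) κ(·, dy)` on `L²(m)`. -/
def op (hκ : IsSymmSubMarkov κ m) : Lp ℝ 2 m →L[ℝ] Lp ℝ 2 m :=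
  LinearMap.mkContinuous
    { toFun := fun u => (hκ.memLp_integral u).toLp
      map_add' := fun u v => by
        rw [← MemLp.toLp_add]
        refine MemLp.toLp_congr _ _ ?_
        filter_upwards [hκ.ae_ae (Lp.coeFn_add u v), hκ.ae_integrable u, hκ.ae_integrable v]
          with x hx hu hv
        rw [integral_congr_ae hx]
        exact integral_add hu hv
      map_smul' := fun c u => by
        rw [RingHom.id_apply, ← MemLp.toLp_const_smul]
        refine MemLp.toLp_congr _ _ ?_
        filter_upwards [hκ.ae_ae (Lp.coeFn_smul c u)] with x hx
        rw [integral_congr_ae hx]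
        exact integral_const_mul c _ }
    1 fun u => by
      rw [one_mul]
      change ‖(hκ.memLp_integral u).toLp‖ ≤ ‖u‖
      rw [Lp.norm_toLp, Lp.norm_def]
      exact ENNReal.toReal_mono (Lp.eLpNorm_ne_top u) (hκ.eLpNorm_integral_le u)

theorem coeFn_op (hκ : IsSymmSubMarkov κ m) (u : Lp ℝ 2 m) :
    hκ.op u =ᵐ[m] fun x => ∫ y, u y ∂κ x :=
  (hκ.memLp_integral u).coeFn_toLp

theorem norm_op_le (hκ : IsSymmSubMarkov κ m) (u : Lp ℝ 2 m) : ‖hκ.op u‖ ≤ ‖u‖ := by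
  rw [Lp.norm_def, Lp.norm_def]
  refine ENNReal.toReal_mono (Lp.eLpNorm_ne_top u) ?_
  rw [eLpNorm_congr_ae (hκ.coeFn_op u)]
  exact hκ.eLpNorm_integral_le u

theorem inner_op_indicator (hκ : IsSymmSubMarkov κ m) {A B : Set E} (hA : MeasurableSet A)
    (hB : MeasurableSet B) (hA' : m A ≠ ∞) (hB' : m B ≠ ∞) :
    inner ℝ (hκ.op (indicatorConstLp 2 hA hA' 1)) (indicatorConstLp 2 hB hB' 1) =
      (∫⁻ x in B, κ x A ∂m).toReal := by
  rw [real_inner_comm, L2.inner_indicatorConstLp_one]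
  rw [setIntegral_congr_ae (g := fun x => (κ x A).toReal) hB]
  · refine integral_toReal (κ.measurable_coe hA).aemeasurable (Eventually.of_forall fun x => ?_)
    have := hκ.isFiniteMeasure x
    exact measure_lt_top _ _
  · filter_upwards [hκ.coeFn_op (indicatorConstLp 2 hA hA' 1),
      hκ.ae_ae (indicatorConstLp_coeFn (p := 2) (hs := hA) (hμs := hA') (c := (1 : ℝ)))]
      with x hx hx' _
    rw [hx, integral_congr_ae hx', integral_indicator hA]
    simp [Measure.real]

theorem inner_op_left (hκ : IsSymmSubMarkov κ m) (u v : Lp ℝ 2 m) :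
    inner ℝ (hκ.op u) v = inner ℝ u (hκ.op v) := by
  have hind : ∀ {A : Set E} (hA : MeasurableSet A) (hA' : m A ≠ ∞) (c : ℝ),
      indicatorConstLp 2 hA hA' c = c • indicatorConstLp 2 hA hA' (1 : ℝ) := fun hA hA' c => by
    refine Lp.ext ?_
    filter_upwards [indicatorConstLp_coeFn (p := 2) (hs := hA) (hμs := hA') (c := c),
      indicatorConstLp_coeFn (p := 2) (hs := hA) (hμs := hA') (c := (1 : ℝ)),
      Lp.coeFn_smul c (indicatorConstLp 2 hA hA' (1 : ℝ))] with x h1 h2 h3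
    rw [h1, h3, Pi.smul_apply, h2]
    classical
    rw [indicator_apply, indicator_apply]
    split_ifs <;> simp
  have h2 : (2 : ℝ≥0∞) ≠ ∞ := by norm_num
  induction u using Lp.induction h2 with
  | indicatorConst c hA hA' =>
    rw [Lp.simpleFunc.coe_indicatorConst, hind _ _ c]
    induction v using Lp.induction h2 with
    | indicatorConst c' hB hB' =>
      rw [Lp.simpleFunc.coe_indicatorConst, hind _ _ c']
      simp only [map_smul, real_inner_smul_left, real_inner_smul_right]
      rw [hκ.inner_op_indicator hA hB, real_inner_comm, hκ.inner_op_indicator hB hA,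
        hκ.symm _ _ hA hB]
    | add hf hg _ h1 h2 => simp only [inner_add_right, map_add, h1, h2]
    | isClosed => exact isClosed_eq (by fun_prop) (by fun_prop)
  | add hf hg _ h1 h2 => simp only [inner_add_left, map_add, h1, h2]
  | isClosed => exact isClosed_eq (by fun_prop) (by fun_prop)

/-- The Markov property of the form `(u - P u, u)`.  For `v = (0 ∨ u) ∧ 1` and `w = u - v`, the
function `v - P v` is nonnegative where `w > 0` (there `v = 1`) and nonpositive where `w < 0`
(there `v = 0`), so that the cross term `(v - P v, w)` is nonnegative. -/
theorem inner_sub_op_le_of_unit_contraction (hκ : IsSymmSubMarkov κ m) {u v : Lp ℝ 2 m}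
    (hv : v =ᵐ[m] fun x => min (max (u x) 0) 1) :
    inner ℝ (v - hκ.op v) v ≤ inner ℝ (u - hκ.op u) u := by
  set w := u - v with hw
  have hu : u = v + w := by rw [hw]; abel
  have hww : 0 ≤ inner ℝ (w - hκ.op w) w := by
    rw [inner_sub_left, real_inner_self_eq_norm_sq]
    nlinarith [real_inner_le_norm (hκ.op w) w, hκ.norm_op_le w, norm_nonneg w]
  have hvw : 0 ≤ inner ℝ (v - hκ.op v) w := by
    rw [L2.inner_def]
    refine integral_nonneg_of_ae ?_
    filter_upwards [hv, hκ.ae_ae hv, hκ.coeFn_op v, Lp.coeFn_sub u v, Lp.coeFn_sub v (hκ.op v),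
      hκ.ae_integrable v] with x h1 h2 h3 h4 h5 h6
    have := hκ.isFiniteMeasure x
    have hP0 : 0 ≤ ∫ y, v y ∂κ x := integral_nonneg_of_ae (by
      filter_upwards [h2] with y hy
      rw [hy]; exact le_min (le_max_right _ _) zero_le_one)
    have hP1 : ∫ y, v y ∂κ x ≤ 1 := by
      calc ∫ y, v y ∂κ x ≤ ∫ _, (1 : ℝ) ∂κ x := integral_mono_ae h6 (integrable_const _) (by
            filter_upwards [h2] with y hy
            rw [hy]; exact min_le_right _ _)
        _ = (κ x univ).toReal := by simp [Measure.real]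
        _ ≤ 1 := ENNReal.toReal_le_of_le_ofReal zero_le_one (by simpa using hκ.mass_le_one x)
    simp only [Pi.zero_apply, RCLike.inner_apply, conj_trivial]
    rw [h4, h5, Pi.sub_apply, Pi.sub_apply, h3, h1]
    rcases le_total (u x) 0 with h0 | h0
    · rw [max_eq_right h0, min_eq_left zero_le_one]
      nlinarith
    · rw [max_eq_left h0]
      rcases le_total (u x) 1 with h7 | h7
      · rw [min_eq_left h7]; simp
      · rw [min_eq_right h7]; nlinarith
  have hwv : inner ℝ (w - hκ.op w) v = inner ℝ (v - hκ.op v) w := by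
    simp only [inner_sub_left, hκ.inner_op_left w v, real_inner_comm v w,
      real_inner_comm (hκ.op v) w]
  rw [hu, map_add, add_sub_add_comm]
  simp only [inner_add_left, inner_add_right]
  rw [hwv]
  linarith

end IsSymmSubMarkov

namespace MarkovTransition

/-- The transition semigroup on `L²(m)` of an `m`-symmetric Markov process. -/
def semigroup (P : MarkovTransition E) (hP : P.IsSymmetric m) (t : ℝ≥0) :
    Lp ℝ 2 m →L[ℝ] Lp ℝ 2 m :=
  IsSymmSubMarkov.op ⟨P.mass_le_one t, hP t⟩

theorem coeFn_semigroup (P : MarkovTransition E) (hP : P.IsSymmetric m) (t : ℝ≥0)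
    (u : Lp ℝ 2 m) : P.semigroup hP t u =ᵐ[m] fun x => ∫ y, u y ∂P.kernel t x :=
  IsSymmSubMarkov.coeFn_op _ u

theorem isSymmSemigroup (P : MarkovTransition E) (hP : P.IsSymmetric m) :
    IsSymmSemigroup (P.semigroup hP) where
  zero u := by
    refine Lp.ext ((P.coeFn_semigroup hP 0 u).trans (Eventually.of_forall fun x => ?_))
    simp only [P.kernel_zero, Kernel.id_apply]
    exact integral_dirac' _ _ (Lp.stronglyMeasurable u)
  add r t u := by
    have hr : IsSymmSubMarkov (P.kernel r) m := ⟨P.mass_le_one r, hP r⟩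
    have hrt : IsSymmSubMarkov (P.kernel (r + t)) m := ⟨P.mass_le_one _, hP _⟩
    refine Lp.ext ?_
    filter_upwards [P.coeFn_semigroup hP (r + t) u, P.coeFn_semigroup hP r (P.semigroup hP t u),
      hr.ae_ae (P.coeFn_semigroup hP t u), hrt.ae_integrable u] with x h1 h2 h3 h4
    rw [h1, h2, integral_congr_ae h3]
    rw [P.kernel_add] at h4 ⊢
    exact Kernel.integral_comp h4
  symm t u v := IsSymmSubMarkov.inner_op_left _ u v
  contr t u := IsSymmSubMarkov.norm_op_le _ u

theorem approxForm_eq_quot (P : MarkovTransition E) (hP : P.IsSymmetric m) (t : ℝ≥0)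
    (u v : Lp ℝ 2 m) : P.approxForm t u v = quot (P.semigroup hP) t u v := by
  rw [approxForm, quot, L2.inner_def]
  congr 1
  refine integral_congr_ae ?_
  filter_upwards [P.coeFn_semigroup hP t u, Lp.coeFn_sub u (P.semigroup hP t u)] with x h1 h2
  rw [h2, Pi.sub_apply, h1]
  simp [mul_comm]

end MarkovTransition

end KernelOp

/-! ### The independent coupling and tensor products -/

section Coupling

variable {d : ℕ}

/-- Measures on `ℝ^d` that are finite and agree on boxes with sides of finite length agree. -/
theorem measure_ext_of_rect {μ ν : Measure (Fin d → ℝ)}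
    (h : ∀ s : Fin d → Set ℝ, (∀ i, MeasurableSet (s i)) → (∀ i, volume (s i) < ∞) →
      μ (univ.pi s) = ν (univ.pi s) ∧ μ (univ.pi s) < ∞) : μ = ν := by
  set Q : ℕ → Fin d → Set ℝ := fun n _ => Ioc (-n : ℝ) n
  have hU : ⋃ n, univ.pi (Q n) = univ := by
    refine eq_univ_of_forall fun x => mem_iUnion.2 ?_
    obtain ⟨n, hn⟩ := exists_nat_gt (∑ i, |x i|)
    refine ⟨n, fun i _ => ?_⟩
    have h1 : |x i| ≤ ∑ i, |x i| :=
      Finset.single_le_sum (f := fun i => |x i|) (fun _ _ => abs_nonneg _) (Finset.mem_univ i)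
    have h2 := abs_lt.1 (h1.trans_lt hn)
    exact ⟨h2.1, h2.2.le⟩
  refine (Measure.ext_iff_of_iUnion_eq_univ hU).2 fun n => ?_
  have hQ : ∀ s : Fin d → Set ℝ, (∀ i, MeasurableSet (s i)) →
      μ (univ.pi s ∩ univ.pi (Q n)) = ν (univ.pi s ∩ univ.pi (Q n)) ∧
        μ (univ.pi s ∩ univ.pi (Q n)) < ∞ := fun s hs => by
    rw [← pi_inter_distrib]
    refine h _ (fun i => (hs i).inter measurableSet_Ioc) fun i => ?_
    exact (measure_mono inter_subset_right).trans_lt (by simp [Q])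
  have : IsFiniteMeasure (μ.restrict (univ.pi (Q n))) := ⟨by
    simpa using (hQ (fun _ => univ) fun _ => MeasurableSet.univ).2⟩
  refine ext_of_generate_finite _ generateFrom_pi.symm isPiSystem_pi ?_ ?_
  · rintro _ ⟨s, hs, rfl⟩
    have hs' : ∀ i, MeasurableSet (s i) := fun i => hs i (mem_univ i)
    rw [Measure.restrict_apply (MeasurableSet.univ_pi hs'),
      Measure.restrict_apply (MeasurableSet.univ_pi hs')]
    exact (hQ s hs').1
  · simpa using (hQ (fun _ => univ) fun _ => MeasurableSet.univ).1

namespace MarkovTransition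

theorem isSymmetric_independentCoupling (X : Fin d → MarkovTransition ℝ)
    (hX : ∀ i, (X i).IsSymmetric volume) : (independentCoupling X).IsSymmetric volume := by
  intro t
  set κ := (independentCoupling X).kernel t
  have hκ1 : ∀ x, κ x univ ≤ 1 := (independentCoupling X).mass_le_one t
  have hκ : ∀ x (s : Fin d → Set ℝ), κ x (univ.pi s) = ∏ i, (X i).kernel t (x i) (s i) :=
    fun x s => Measure.pi_pi _ _
  have hle : ∀ A B : Set (Fin d → ℝ), MeasurableSet A → ∫⁻ x in A, κ x B ≤ volume A :=
    fun A B _ => (lintegral_mono fun x => (measure_mono (subset_univ B)).trans (hκ1 x)).trans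
      (by simp)
  have hfin : ∀ s : Fin d → Set ℝ, (∀ i, volume (s i) < ∞) →
      (volume : Measure (Fin d → ℝ)) (univ.pi s) < ∞ := fun s hs => by
    rw [volume_pi_pi]; exact ENNReal.prod_lt_top fun i _ => hs i
  have hfac : ∀ s r : Fin d → Set ℝ, (∀ i, volume (s i) < ∞) → (∀ i, MeasurableSet (r i)) →
      ∫⁻ x in univ.pi s, κ x (univ.pi r) = ∏ i, ∫⁻ x in s i, (X i).kernel t x (r i) := by
    intro s r hs hr
    have : ∀ i, IsFiniteMeasure (volume.restrict (s i)) := fun i => ⟨by simpa using hs i⟩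
    simp only [hκ]
    rw [volume_pi, Measure.restrict_pi_pi]
    exact lintegral_pi_prod _ (fun i x => (X i).kernel t x (r i)) fun i =>
      ((X i).kernel t).measurable_coe (hr i)
  have hrect : ∀ s r : Fin d → Set ℝ, (∀ i, MeasurableSet (s i)) → (∀ i, volume (s i) < ∞) →
      (∀ i, MeasurableSet (r i)) → (∀ i, volume (r i) < ∞) →
      ∫⁻ x in univ.pi s, κ x (univ.pi r) = ∫⁻ x in univ.pi r, κ x (univ.pi s) := by
    intro s r hs hs' hr hr'
    rw [hfac s r hs' hr, hfac r s hr' hs]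
    exact Finset.prod_congr rfl fun i _ => hX i t _ _ (hs i) (hr i)
  -- the symmetry passes from rectangles to one general set, and then to two
  have hhalf : ∀ s : Fin d → Set ℝ, (∀ i, MeasurableSet (s i)) → (∀ i, volume (s i) < ∞) →
      ∀ B, MeasurableSet B →
      ∫⁻ x in univ.pi s, κ x B = ∫⁻ x in B, κ x (univ.pi s) := by
    intro s hs hs' B hB
    have key : (volume.restrict (univ.pi s)).bind κ =
        volume.withDensity fun x => κ x (univ.pi s) := by
      refine measure_ext_of_rect fun r hr hr' => ?_
      have hm := MeasurableSet.univ_pi hr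
      rw [Measure.bind_apply hm κ.measurable.aemeasurable, withDensity_apply _ hm]
      exact ⟨hrect s r hs hs' hr hr', (hle _ _ (MeasurableSet.univ_pi hs)).trans_lt (hfin s hs')⟩
    have := Measure.ext_iff.1 key B hB
    rwa [Measure.bind_apply hB κ.measurable.aemeasurable, withDensity_apply _ hB] at this
  intro A B hA hB
  have key : (volume.restrict B).bind κ = volume.withDensity fun x => κ x B := by
    refine measure_ext_of_rect fun r hr hr' => ?_
    have hm := MeasurableSet.univ_pi hr
    rw [Measure.bind_apply hm κ.measurable.aemeasurable, withDensity_apply _ hm,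
      ← hhalf r hr hr' B hB]
    exact ⟨rfl, (hle _ _ hm).trans_lt (hfin r hr')⟩
  have := Measure.ext_iff.1 key A hA
  rw [Measure.bind_apply hA κ.measurable.aemeasurable, withDensity_apply _ hA] at this
  exact this.symm

end MarkovTransition

theorem ae_eval {p : Fin d → ℝ → Prop} (h : ∀ i, ∀ᵐ x : ℝ, p i x) :
    ∀ᵐ x : Fin d → ℝ, ∀ i, p i (x i) :=
  ae_all_iff.2 fun i => (Measure.quasiMeasurePreserving_eval (fun _ => volume) i).ae (h i)

theorem memLp_tensor {f : Fin d → ℝ → ℝ} (hf : ∀ i, MemLp (f i) 2 volume) :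
    MemLp (fun x : Fin d → ℝ => ∏ i, f i (x i)) 2 volume := by
  have hm : AEStronglyMeasurable (fun x : Fin d → ℝ => ∏ i, f i (x i)) volume := by
    refine Finset.aestronglyMeasurable_fun_prod _ fun i _ => ?_
    exact (hf i).aestronglyMeasurable.comp_quasiMeasurePreserving
      (Measure.quasiMeasurePreserving_eval (fun _ => volume) i)
  rw [memLp_two_iff_integrable_sq hm]
  simp only [← Finset.prod_pow]
  exact Integrable.fintype_prod fun i => (hf i).integrable_sq

/-- The tensor product `x ↦ f₁(x₁) ⋯ f_d(x_d)` of `L²` functions. -/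
def tensorLp (f : Fin d → Lp ℝ 2 (volume : Measure ℝ)) :
    Lp ℝ 2 (volume : Measure (Fin d → ℝ)) :=
  (memLp_tensor fun i => Lp.memLp (f i)).toLp

theorem coeFn_tensorLp (f : Fin d → Lp ℝ 2 (volume : Measure ℝ)) :
    tensorLp f =ᵐ[volume] fun x => ∏ i, f i (x i) :=
  MemLp.coeFn_toLp _

theorem coeFn_tensorLp_of_ae {f : Fin d → Lp ℝ 2 (volume : Measure ℝ)} {φ : Fin d → ℝ → ℝ}
    (h : ∀ i, f i =ᵐ[volume] φ i) : tensorLp f =ᵐ[volume] fun x => ∏ i, φ i (x i) := by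
  filter_upwards [coeFn_tensorLp f, ae_eval h] with x h1 h2
  rw [h1]
  exact Finset.prod_congr rfl fun i _ => h2 i

theorem inner_tensorLp (f g : Fin d → Lp ℝ 2 (volume : Measure ℝ)) :
    inner ℝ (tensorLp f) (tensorLp g) = ∏ i, inner ℝ (f i) (g i) := by
  simp only [L2.inner_def]
  rw [← integral_fintype_prod_volume_eq_prod]
  refine integral_congr_ae ?_
  filter_upwards [coeFn_tensorLp f, coeFn_tensorLp g] with x h1 h2
  simp only [h1, h2, RCLike.inner_apply, conj_trivial, Finset.prod_mul_distrib]

namespace MarkovTransition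

/-- The semigroup of the independent coupling is the tensor product of the semigroups. -/
theorem semigroup_tensorLp (X : Fin d → MarkovTransition ℝ) (hX : ∀ i, (X i).IsSymmetric volume)
    (t : ℝ≥0) (f : Fin d → Lp ℝ 2 (volume : Measure ℝ)) :
    (independentCoupling X).semigroup (isSymmetric_independentCoupling X hX) t (tensorLp f) =
      tensorLp fun i => (X i).semigroup (hX i) t (f i) := by
  have hκ : IsSymmSubMarkov ((independentCoupling X).kernel t) volume :=
    ⟨(independentCoupling X).mass_le_one t, isSymmetric_independentCoupling X hX t⟩
  refine Lp.ext ?_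
  filter_upwards [(independentCoupling X).coeFn_semigroup (isSymmetric_independentCoupling X hX) t
    (tensorLp f), hκ.ae_ae (coeFn_tensorLp f),
    coeFn_tensorLp_of_ae fun i => (X i).coeFn_semigroup (hX i) t (f i)] with x h1 h2 h3
  rw [h1, h3, integral_congr_ae h2]
  exact integral_fintype_prod_eq_prod (μ := fun i => (X i).kernel t (x i)) fun i y => f i y

end MarkovTransition

/-- The form at `(u, v)` is minus the right derivative of `t ↦ (T_t u, v)` at zero. -/
theorem hasDerivWithinAt_inner_of_tendsto_quot {H : Type*} [NormedAddCommGroup H]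
    [InnerProductSpace ℝ H] {T : ℝ≥0 → H →L[ℝ] H} (hT : IsSymmSemigroup T) {u v : H} {e : ℝ} :
    Tendsto (fun t => quot T t u v) (𝓝[>] 0) (𝓝 e) ↔
      HasDerivWithinAt (fun x : ℝ => inner ℝ (T x.toNNReal u) v) (-e) (Ioi 0) 0 := by
  rw [hasDerivWithinAt_iff_tendsto_slope' (by simp)]
  have hslope : ∀ t : ℝ≥0,
      slope (fun x : ℝ => inner ℝ (T x.toNNReal u) v) 0 t = -quot T t u v := fun t => by
    rw [slope_def_field, quot, inner_sub_left, Real.toNNReal_coe, Real.toNNReal_zero, hT.zero,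
      sub_zero, div_eq_inv_mul]
    ring
  constructor
  · intro h
    have h1 : Tendsto Real.toNNReal (𝓝[>] 0) (𝓝[>] 0) := by
      refine tendsto_nhdsWithin_iff.2 ⟨?_, ?_⟩
      · have := continuous_real_toNNReal.tendsto 0
        rw [Real.toNNReal_zero] at this
        exact this.mono_left nhdsWithin_le_nhds
      · filter_upwards [self_mem_nhdsWithin] with x hx
        exact Real.toNNReal_pos.2 hx
    refine (h.comp h1).neg.congr' ?_
    filter_upwards [self_mem_nhdsWithin] with x hx
    have := hslope x.toNNReal
    rw [Real.coe_toNNReal x (le_of_lt hx)] at this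
    exact this.symm
  · intro h
    have := (h.comp tendsto_coe_nhdsGT_zero).neg
    rw [neg_neg] at this
    refine this.congr fun t => ?_
    simp [hslope t]

/-- The form of the independent coupling on tensor products: the derivative at `t = 0` of the
product `∏ (T_tⁱ fᵢ, gᵢ)` is given by the product rule. -/
theorem tendsto_quot_tensorLp (X : Fin d → MarkovTransition ℝ)
    (hX : ∀ i, (X i).IsSymmetric volume) {f g : Fin d → Lp ℝ 2 (volume : Measure ℝ)}
    {e : Fin d → ℝ}
    (h : ∀ i, Tendsto (fun t => quot ((X i).semigroup (hX i)) t (f i) (g i)) (𝓝[>] 0) (𝓝 (e i))) :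
    Tendsto (fun t => quot ((MarkovTransition.independentCoupling X).semigroup
        (MarkovTransition.isSymmetric_independentCoupling X hX)) t (tensorLp f) (tensorLp g))
      (𝓝[>] 0) (𝓝 (∑ k, e k * ∏ i ∈ Finset.univ.erase k, inner ℝ (f i) (g i))) := by
  rw [hasDerivWithinAt_inner_of_tendsto_quot (MarkovTransition.isSymmSemigroup _ _)]
  simp_rw [MarkovTransition.semigroup_tensorLp X hX, inner_tensorLp]
  have h1 := HasDerivWithinAt.fun_finsetProd (u := Finset.univ) fun i _ =>
    (hasDerivWithinAt_inner_of_tendsto_quot ((X i).isSymmSemigroup (hX i))).1 (h i)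
  refine h1.congr_deriv ?_
  rw [← Finset.sum_neg_distrib]
  refine Finset.sum_congr rfl fun k _ => ?_
  rw [smul_eq_mul, mul_neg, mul_comm]
  congr 2
  refine Finset.prod_congr rfl fun i _ => ?_
  rw [Real.toNNReal_zero, ((X i).isSymmSemigroup (hX i)).zero]

end Coupling

/-! ### Algebras of compactly supported continuous functions -/

section StoneWeierstrass

variable {X : Type*} [TopologicalSpace X]

/-- A set of continuous functions that is closed under addition, scalar multiplication and
multiplication, separates points, and contains cut-off functions for all compact sets. -/
structure IsCutoffAlgebra (A : Set (X → ℝ)) : Prop where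
  continuous : ∀ f ∈ A, Continuous f
  compactSupport : ∀ f ∈ A, HasCompactSupport f
  add_mem : ∀ f ∈ A, ∀ g ∈ A, f + g ∈ A
  smul_mem : ∀ (c : ℝ), ∀ f ∈ A, c • f ∈ A
  mul_mem : ∀ f ∈ A, ∀ g ∈ A, f * g ∈ A
  separates : ∀ x y, x ≠ y → ∃ f ∈ A, f x ≠ f y
  cutoff : ∀ K, IsCompact K → ∃ f ∈ A, (∀ x ∈ K, f x = 1) ∧ ∀ x, 0 ≤ f x ∧ f x ≤ 1

/-- The Stone–Weierstrass theorem for compactly supported functions, with control of the supports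
of the approximations.  The unital algebra to which the classical theorem is applied is that of the
multipliers of `A`; a multiplier times a cut-off function is in `A`. -/
theorem IsCutoffAlgebra.exists_near {A : Set (X → ℝ)} (hA : IsCutoffAlgebra A) {g : X → ℝ}
    (hg : Continuous g) (hgc : HasCompactSupport g) :
    ∃ K, IsCompact K ∧ Function.support g ⊆ K ∧
      ∀ ε > 0, ∃ f ∈ A, Function.support f ⊆ K ∧ ∀ x, |g x - f x| < ε := by
  obtain ⟨χ, hχA, hχ1, hχ01⟩ := hA.cutoff _ hgc
  set K := tsupport χ
  have hK : IsCompact K := hA.compactSupport χ hχA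
  have hgK : Function.support g ⊆ K := fun x hx => subset_tsupport χ (by
    rw [Function.mem_support, hχ1 x (subset_tsupport g hx)]; exact one_ne_zero)
  refine ⟨K, hK, hgK, fun ε hε => ?_⟩
  let M : Subalgebra ℝ C(X, ℝ) :=
    { carrier := {F | ∀ f ∈ A, (F : X → ℝ) * f ∈ A}
      mul_mem' := fun {F G} hF hG f hf => by
        have := hF _ (hG f hf)
        rwa [← mul_assoc] at this
      add_mem' := fun {F G} hF hG f hf => by
        have := hA.add_mem _ (hF f hf) _ (hG f hf)
        rwa [← add_mul] at this
      algebraMap_mem' := fun c f hf => by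
        convert hA.smul_mem c f hf using 1
        ext x
        simp }
  have : CompactSpace K := isCompact_iff_compactSpace.1 hK
  let ι : C(K, X) := ⟨Subtype.val, continuous_subtype_val⟩
  let MK : Subalgebra ℝ C(K, ℝ) := M.map (ContinuousMap.compRightAlgHom ℝ ℝ ι)
  have hsep : MK.SeparatesPoints := by
    intro x y hxy
    obtain ⟨f, hf, hfxy⟩ := hA.separates x y fun h => hxy (Subtype.ext h)
    refine ⟨_, ⟨_, ⟨⟨f, hA.continuous f hf⟩, fun h hh => hA.mul_mem _ hf _ hh, rfl⟩, rfl⟩, hfxy⟩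
  obtain ⟨⟨_, ⟨F, hFM, rfl⟩⟩, hF⟩ :=
    ContinuousMap.exists_mem_subalgebra_near_continuousMap_of_separatesPoints MK hsep
      (ContinuousMap.comp ⟨g, hg⟩ ι) ε hε
  refine ⟨(F : X → ℝ) * χ, hFM χ hχA, ?_, fun x => ?_⟩
  · exact (Function.support_mul_subset_right _ _).trans (subset_tsupport χ)
  · by_cases hx : x ∈ K
    · have h1 : |F x - g x| < ε := by
        have := (ContinuousMap.norm_lt_iff _ hε).1 hF ⟨x, hx⟩
        simpa [Real.norm_eq_abs, ι] using this
      have h2 : g x - ((F : X → ℝ) * χ) x = -(F x - g x) * χ x := by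
        by_cases hgx : g x = 0
        · simp [hgx]
        · rw [Pi.mul_apply, hχ1 x (subset_tsupport g hgx)]; ring
      rw [h2, abs_mul, abs_neg, abs_of_nonneg (hχ01 x).1]
      exact (mul_le_of_le_one_right (abs_nonneg _) (hχ01 x).2).trans_lt h1
    · have h1 : χ x = 0 := by
        by_contra h; exact hx (subset_tsupport χ h)
      have h2 : g x = 0 := by
        by_contra h; exact hx (hgK h)
      simpa [h1, h2] using hε

variable [MeasurableSpace X] [BorelSpace X] [T2Space X] {μ : Measure X}

/-- Uniform closeness and a common support of finite measure give closeness in `L²`. -/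
theorem dist_toLp_le {f g : X → ℝ} {K : Set X} (hK : IsCompact K) (hμ : μ K ≠ ∞) {c : ℝ}
    (hc : 0 ≤ c) (hf : MemLp f 2 μ) (hg : MemLp g 2 μ) (hfK : Function.support f ⊆ K)
    (hgK : Function.support g ⊆ K) (hfg : ∀ x, |f x - g x| ≤ c) :
    ‖hf.toLp - hg.toLp‖ ≤ c * (μ K ^ (1 / (2 : ℝ))).toReal := by
  rw [← MemLp.toLp_sub, Lp.norm_toLp]
  have h := eLpNorm_sub_le_of_dist_bdd μ (p := 2) (by norm_num) hK.measurableSet hc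
    (fun x => by rw [Real.dist_eq]; exact hfg x) hfK hgK
  refine (ENNReal.toReal_mono ?_ h).trans ?_
  · refine ENNReal.mul_ne_top ENNReal.ofReal_ne_top ?_
    exact ENNReal.rpow_ne_top_of_nonneg (by positivity) hμ
  · rw [ENNReal.toReal_mul, ENNReal.toReal_ofReal hc]
    simp

/-- Algebras with cut-off functions are dense in `L²`. -/
theorem IsCutoffAlgebra.dense_Lp [WeaklyLocallyCompactSpace X] [NormalSpace X] [μ.Regular]
    {A : Set (X → ℝ)} (hA : IsCutoffAlgebra A) :
    Dense {u : Lp ℝ 2 μ | ∃ f ∈ A, u =ᵐ[μ] f} := by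
  rw [Metric.dense_iff]
  intro u r hr
  obtain ⟨g, hgc, hug, hg, hgL⟩ := (Lp.memLp u).exists_hasCompactSupport_eLpNorm_sub_le
    (by norm_num) (show ENNReal.ofReal (r / 2) ≠ 0 by simpa using hr)
  obtain ⟨K, hK, hgK, hnear⟩ := hA.exists_near hg hgc
  set C := (μ K ^ (1 / (2 : ℝ))).toReal
  have hC : 0 ≤ C := ENNReal.toReal_nonneg
  obtain ⟨f, hfA, hfK, hf⟩ := hnear (r / (4 * (C + 1))) (by positivity)
  have hfL : MemLp f 2 μ :=
    (hA.continuous f hfA).memLp_of_hasCompactSupport (hA.compactSupport f hfA)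
  refine ⟨hfL.toLp, ?_, f, hfA, hfL.coeFn_toLp⟩
  rw [Metric.mem_ball, dist_comm, dist_eq_norm]
  have h1 : ‖u - hgL.toLp‖ ≤ r / 2 := by
    nth_rewrite 1 [← Lp.toLp_coeFn u (Lp.memLp u)]
    rw [← MemLp.toLp_sub, Lp.norm_toLp]
    exact ENNReal.toReal_le_of_le_ofReal (by positivity) hug
  have h2 : ‖hgL.toLp - hfL.toLp‖ ≤ r / (4 * (C + 1)) * C :=
    dist_toLp_le hK hK.measure_lt_top.ne (by positivity) hgL hfL hgK hfK fun x => (hf x).le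
  have h3 : r / (4 * (C + 1)) * C ≤ r / 4 := by
    rw [div_mul_eq_mul_div, div_le_div_iff₀ (by positivity) (by norm_num)]
    nlinarith
  calc ‖u - hfL.toLp‖ ≤ ‖u - hgL.toLp‖ + ‖hgL.toLp - hfL.toLp‖ := norm_sub_le_norm_sub_add_norm_sub _ _ _
    _ < r := by linarith

end StoneWeierstrass

/-! ### Weak derivatives on the line and the one-dimensional forms -/

/-- `g` is the weak derivative of `u` on the real line. -/
def HasWeakDeriv (u g : ℝ → ℝ) : Prop :=
  ∀ ψ : ℝ → ℝ, ContDiff ℝ (⊤ : ℕ∞) ψ → HasCompactSupport ψ →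
    ∫ x, u x * deriv ψ x = - ∫ x, g x * ψ x

theorem HasWeakDeriv.congr {u u' g g' : ℝ → ℝ} (h : HasWeakDeriv u g) (hu : u =ᵐ[volume] u')
    (hg : g =ᵐ[volume] g') : HasWeakDeriv u' g' := fun ψ hψ hψc => by
  have h1 : ∫ x, u x * deriv ψ x = ∫ x, u' x * deriv ψ x :=
    integral_congr_ae (by filter_upwards [hu] with x hx; rw [hx])
  have h2 : ∫ x, g x * ψ x = ∫ x, g' x * ψ x :=
    integral_congr_ae (by filter_upwards [hg] with x hx; rw [hx])
  rw [← h1, ← h2]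
  exact h ψ hψ hψc

theorem exists_Icc_of_hasCompactSupport {f : ℝ → ℝ} (hf : HasCompactSupport f) :
    ∃ R > 0, ∀ x, R ≤ |x| → x ∉ tsupport f := by
  obtain ⟨R, hR, h⟩ := hf.isCompact.isBounded.exists_pos_norm_lt
  refine ⟨R, hR, fun x hx hxs => ?_⟩
  exact absurd (h x hxs) (by rw [Real.norm_eq_abs]; linarith)

theorem integral_eq_intervalIntegral {f : ℝ → ℝ} {R : ℝ} (hR : 0 < R)
    (hf : ∀ x, R ≤ |x| → f x = 0) : ∫ x, f x = ∫ x in (-R)..R, f x := by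
  rw [intervalIntegral.integral_of_le (by linarith), setIntegral_eq_integral_of_forall_compl_eq_zero]
  intro x hx
  refine hf x ?_
  by_contra hlt
  rw [not_le, abs_lt] at hlt
  exact hx ⟨hlt.1, hlt.2.le⟩

/-- An indefinite integral of `g` has weak derivative `g`. -/
theorem hasWeakDeriv_of_integral {U g : ℝ → ℝ} (hg : LocallyIntegrable g volume)
    (h : ∀ a b, a ≤ b → U b - U a = ∫ x in a..b, g x) : HasWeakDeriv U g := by
  intro ψ hψ hψc
  obtain ⟨R, hR, hRs⟩ := exists_Icc_of_hasCompactSupport hψc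
  have hR0 : ∀ x, R ≤ |x| → ψ x = 0 := fun x hx => image_eq_zero_of_notMem_tsupport (hRs x hx)
  have hψR : ψ R = 0 := hR0 R (le_abs_self R)
  have hψR' : ψ (-R) = 0 := hR0 (-R) (by rw [abs_neg]; exact le_abs_self R)
  have hgi : ∀ a b, IntervalIntegrable g volume a b := fun a b =>
    (hg.integrableOn_isCompact isCompact_uIcc).intervalIntegrable
  have hac : AbsolutelyContinuousOnInterval (fun x => ∫ t in (-R)..x, g t) (-R) R :=
    (hgi (-R) R).absolutelyContinuousOnInterval_intervalIntegral (by simp)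
  have hU : ∀ x, -R ≤ x → U x = U (-R) + ∫ t in (-R)..x, g t := fun x hx => by
    rw [← h _ _ hx]; ring
  have hψac : AbsolutelyContinuousOnInterval ψ (-R) R :=
    (hψ.of_le (by exact_mod_cast le_top)).contDiffOn.absolutelyContinuousOnInterval
  have hψ' : ∀ x, R ≤ |x| → deriv ψ x = 0 := fun x hx => by
    by_contra hne
    exact hRs x hx (support_deriv_subset hne)
  rw [integral_eq_intervalIntegral hR (f := fun x => U x * deriv ψ x) fun x hx => by
      rw [hψ' x hx, mul_zero],
    integral_eq_intervalIntegral hR (f := fun x => g x * ψ x) fun x hx => by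
      rw [hR0 x hx, mul_zero]]
  have e1 : ∫ x in (-R)..R, U x * deriv ψ x =
      ∫ x in (-R)..R, (U (-R) * deriv ψ x + (∫ t in (-R)..x, g t) * deriv ψ x) := by
    refine intervalIntegral.integral_congr fun x hx => ?_
    rw [uIcc_of_le (by linarith)] at hx
    rw [hU x hx.1]
    ring
  have hdc : Continuous (deriv ψ) := hψ.continuous_deriv (by simp)
  rw [e1, intervalIntegral.integral_add, intervalIntegral.integral_const_mul,
    hψac.integral_deriv_eq_sub, hψR, hψR', hac.integral_mul_deriv_eq_deriv_mul hψac, hψR, hψR']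
  · have e2 : ∫ x in (-R)..R, deriv (fun x => ∫ t in (-R)..x, g t) x * ψ x =
        ∫ x in (-R)..R, g x * ψ x := by
      refine intervalIntegral.integral_congr_ae ?_
      filter_upwards [(hgi (-R) R).ae_hasDerivAt_integral] with x hx hx'
      rw [(hx (uIoc_subset_uIcc hx') (-R) (by simp)).deriv]
    rw [e2]
    ring
  · exact (hdc.const_mul _).intervalIntegrable _ _
  · exact (hac.continuousOn.mul hdc.continuousOn).intervalIntegrable

namespace BrownianScale

variable (s : BrownianScale)

theorem isOpen_image : IsOpen s.image := by
  rw [isOpen_iff_mem_nhds]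
  rintro _ ⟨x, rfl⟩
  refine mem_of_superset (Ioo_mem_nhds (s.strictMono (sub_one_lt x)) (s.strictMono (lt_add_one x)))
    (Ioo_subset_Icc_self.trans ?_)
  exact (intermediate_value_Icc (by linarith) s.continuous.continuousOn).trans
    (image_subset_range _ _)

theorem ordConnected_image : OrdConnected s.image :=
  (isPreconnected_range s.continuous).ordConnected

theorem isOpenEmbedding : IsOpenEmbedding s.toFun :=
  ⟨s.strictMono.isEmbedding_of_ordConnected s.ordConnected_image, s.isOpen_image⟩

theorem measurableEmbedding : MeasurableEmbedding s.toFun :=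
  s.isOpenEmbedding.measurableEmbedding

theorem image_Ioc (a b : ℝ) : s.toFun '' Ioc a b = Ioc (s.toFun a) (s.toFun b) := by
  refine Subset.antisymm ?_ ?_
  · rintro _ ⟨x, hx, rfl⟩
    exact ⟨s.strictMono hx.1, s.strictMono.monotone hx.2⟩
  · rintro y ⟨h1, h2⟩
    obtain ⟨x, rfl⟩ : y ∈ s.image :=
      s.ordConnected_image.out ⟨a, rfl⟩ ⟨b, rfl⟩ ⟨h1.le, h2⟩
    exact ⟨x, ⟨s.strictMono.lt_iff_lt.1 h1, s.strictMono.le_iff_le.1 h2⟩, rfl⟩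

theorem measure_Ioc (a b : ℝ) :
    s.measure (Ioc a b) = ENNReal.ofReal (s.toFun b - s.toFun a) :=
  StieltjesFunction.measure_Ioc _ a b

instance : IsLocallyFiniteMeasure s.measure := by
  unfold measure; infer_instance

theorem measure_eq_comap : s.measure = volume.comap s.toFun := by
  refine Measure.ext_of_Ioc _ _ fun a b _ => ?_
  rw [s.measure_Ioc, s.measurableEmbedding.comap_apply, image_Ioc, Real.volume_Ioc]

/-- The change of variables `y = s(x)`. -/
theorem map_measure : s.measure.map s.toFun = volume.restrict s.image := by
  rw [measure_eq_comap, s.measurableEmbedding.map_comap]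
  rfl

/-- The set `{s' = 1}`. -/
def growthSet : Set ℝ := {x | HasDerivAt s.toFun 1 x}

theorem measurableSet_hasDerivAt (c : ℝ) : MeasurableSet {x | HasDerivAt s.toFun c x} := by
  have : {x | HasDerivAt s.toFun c x} =
      {x | DifferentiableAt ℝ s.toFun x} ∩ deriv s.toFun ⁻¹' {c} := by
    ext x
    exact ⟨fun h => ⟨h.differentiableAt, h.deriv⟩, fun h => by
      have := h.1.hasDerivAt
      rwa [show deriv s.toFun x = c from h.2] at this⟩
  rw [this]
  exact (measurableSet_of_differentiableAt ℝ _).inter (measurable_deriv _ (measurableSet_singleton c))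

theorem measurableSet_growthSet : MeasurableSet s.growthSet := s.measurableSet_hasDerivAt 1

theorem ae_mem_growthSet_iff : ∀ᵐ x, x ∈ s.growthSet ↔ x ∉ s.flatSet := by
  filter_upwards [s.deriv_zero_or_one] with x hx
  constructor
  · exact fun h1 h0 => zero_ne_one (h0.unique h1)
  · exact fun h => hx.resolve_left h

/-- The measure `ds` is Lebesgue measure on `{s' = 1}`. -/
theorem measure_eq_restrict : s.measure = volume.restrict s.growthSet := by
  refine Measure.ext_of_Ioc _ _ fun a b hab => ?_
  have h1 : ∫ x in a..b, deriv s.toFun x = s.toFun b - s.toFun a :=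
    (s.absolutelyContinuous a b).integral_deriv_eq_sub
  have h2 : ∫ x in a..b, deriv s.toFun x = volume.real (s.growthSet ∩ Ioc a b) := by
    rw [intervalIntegral.integral_of_le hab.le, ← integral_indicator_one
      (s.measurableSet_growthSet.inter measurableSet_Ioc), inter_comm, ← indicator_indicator,
      integral_indicator measurableSet_Ioc]
    refine integral_congr_ae (ae_restrict_of_ae ?_)
    filter_upwards [s.deriv_zero_or_one] with x hx
    rcases hx with hx | hx
    · rw [hx.deriv, indicator_of_notMem]
      exact fun h => zero_ne_one (hx.unique h)
    · rw [hx.deriv, indicator_of_mem (show x ∈ s.growthSet from hx)]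
      rfl
  rw [s.measure_Ioc a b, ← h1, h2, Measure.restrict_apply measurableSet_Ioc, inter_comm, Measure.real,
    ENNReal.ofReal_toReal]
  exact ((measure_mono inter_subset_left).trans_lt
    (measure_Ioc_lt_top (μ := volume) (a := a) (b := b))).ne

variable {s}

theorem setIntegral_Ioc_comp (F : ℝ → ℝ) (a b : ℝ) :
    ∫ y in Ioc (s.toFun a) (s.toFun b), F y = ∫ x in Ioc a b, F (s.toFun x) ∂s.measure := by
  have h1 : Ioc (s.toFun a) (s.toFun b) ⊆ s.image := by
    rw [← s.image_Ioc]; exact image_subset_range _ _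
  have h2 : s.toFun ⁻¹' Ioc (s.toFun a) (s.toFun b) = Ioc a b := by
    ext x; simp [s.strictMono.lt_iff_lt, s.strictMono.le_iff_le]
  rw [← h2, ← s.measurableEmbedding.setIntegral_map, s.map_measure,
    Measure.restrict_restrict measurableSet_Ioc, inter_eq_left.2 h1]

variable (s) in
/-- The weak derivative `s' · (φ' ∘ s)` of `φ ∘ s`. -/
def pullbackDeriv (φ : ℝ → ℝ) : ℝ → ℝ := s.growthSet.indicator (deriv φ ∘ s.toFun)

theorem memLp_pullbackDeriv_iff {φ : ℝ → ℝ} :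
    MemLp (s.pullbackDeriv φ) 2 volume ↔ MemLp (deriv φ ∘ s.toFun) 2 s.measure := by
  rw [pullbackDeriv, memLp_indicator_iff_restrict s.measurableSet_growthSet, measure_eq_restrict]

theorem memLp_pullbackDeriv_iff' {φ : ℝ → ℝ} :
    MemLp (s.pullbackDeriv φ) 2 volume ↔ MemLp (deriv φ) 2 (volume.restrict s.image) := by
  rw [memLp_pullbackDeriv_iff, ← s.map_measure, s.measurableEmbedding.memLp_map_measure_iff]

theorem sub_eq_integral_pullbackDeriv {φ : ℝ → ℝ}
    (hφ : ∀ a ∈ s.image, ∀ b ∈ s.image, AbsolutelyContinuousOnInterval φ a b) {a b : ℝ}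
    (hab : a ≤ b) : φ (s.toFun b) - φ (s.toFun a) = ∫ x in a..b, s.pullbackDeriv φ x := by
  rw [← (hφ _ ⟨a, rfl⟩ _ ⟨b, rfl⟩).integral_deriv_eq_sub,
    intervalIntegral.integral_of_le (s.strictMono.monotone hab), setIntegral_Ioc_comp,
    intervalIntegral.integral_of_le hab, pullbackDeriv, measure_eq_restrict,
    setIntegral_indicator s.measurableSet_growthSet,
    Measure.restrict_restrict measurableSet_Ioc]
  rfl

theorem hasWeakDeriv_comp {φ : ℝ → ℝ}
    (hφ : ∀ a ∈ s.image, ∀ b ∈ s.image, AbsolutelyContinuousOnInterval φ a b)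
    (hL : MemLp (s.pullbackDeriv φ) 2 volume) : HasWeakDeriv (φ ∘ s.toFun) (s.pullbackDeriv φ) :=
  hasWeakDeriv_of_integral (hL.locallyIntegrable (by norm_num)) fun _ _ hab =>
    sub_eq_integral_pullbackDeriv hφ hab

end BrownianScale

theorem HasWeakDeriv.ae_eq {u g g' : ℝ → ℝ} (h : HasWeakDeriv u g) (h' : HasWeakDeriv u g')
    (hg : LocallyIntegrable g volume) (hg' : LocallyIntegrable g' volume) :
    g =ᵐ[volume] g' := by
  refine ae_eq_of_integral_contDiff_smul_eq hg hg' fun ψ hψ hψc => ?_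
  have := (h ψ hψ hψc).symm.trans (h' ψ hψ hψc)
  simp only [smul_eq_mul, mul_comm (ψ _)]
  linarith

theorem Lp.locallyIntegrable {d : ℕ} (u : Lp ℝ 2 (volume : Measure (Fin d → ℝ))) :
    LocallyIntegrable u volume :=
  (Lp.memLp u).locallyIntegrable (by norm_num)

theorem abs_setIntegral_le_norm {X : Type*} [MeasurableSpace X] {μ : Measure X} {f : X → ℝ}
    (hf : MemLp f 2 μ) {K : Set X} (hK : MeasurableSet K) (hμ : μ K ≠ ∞) :
    |∫ x in K, f x ∂μ| ≤ ‖hf.toLp‖ * √(μ.real K) := by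
  have h1 : ∫ x in K, f x ∂μ = inner ℝ (indicatorConstLp 2 hK hμ (1 : ℝ)) hf.toLp := by
    rw [L2.inner_indicatorConstLp_one]
    refine setIntegral_congr_ae hK ?_
    filter_upwards [hf.coeFn_toLp] with x hx _ using hx.symm
  rw [h1, mul_comm]
  refine (abs_real_inner_le_norm _ _).trans (le_of_eq ?_)
  rw [norm_indicatorConstLp two_ne_zero (by norm_num), norm_one, one_mul, Real.sqrt_eq_rpow]
  simp

/-- A bounded sequence whose inner products with a dense set converge to those of a vector of at
least the same norm converges to it. -/
theorem tendsto_of_tendsto_inner {H : Type*} [NormedAddCommGroup H] [InnerProductSpace ℝ H]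
    {D : Set H} (hD : Dense D) {g : ℕ → H} {w : H} (hg : ∀ n, ‖g n‖ ≤ ‖w‖)
    (h : ∀ v ∈ D, Tendsto (fun n => inner ℝ (g n) v) atTop (𝓝 (inner ℝ w v))) :
    Tendsto g atTop (𝓝 w) := by
  have h1 : Tendsto (fun n => inner ℝ (g n) w) atTop (𝓝 (inner ℝ w w)) := by
    rw [Metric.tendsto_nhds]
    intro ε hε
    have hw : 0 ≤ ‖w‖ := norm_nonneg w
    obtain ⟨v, hv, hvw⟩ := hD.exists_dist_lt w (show 0 < ε / (4 * (‖w‖ + 1)) by positivity)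
    rw [dist_eq_norm, lt_div_iff₀ (by positivity)] at hvw
    filter_upwards [(Metric.tendsto_nhds.1 (h v hv)) (ε / 2) (by positivity)] with n hn
    rw [Real.dist_eq] at hn ⊢
    have e : inner ℝ (g n) w - inner ℝ w w =
        (inner ℝ (g n) v - inner ℝ w v) + (inner ℝ (g n) (w - v) - inner ℝ w (w - v)) := by
      simp only [inner_sub_right]; ring
    rw [e]
    have h2 := abs_real_inner_le_norm (g n) (w - v)
    have h3 := abs_real_inner_le_norm w (w - v)
    have h4 : ‖g n‖ * ‖w - v‖ ≤ ‖w‖ * ‖w - v‖ := mul_le_mul_of_nonneg_right (hg n) (norm_nonneg _)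
    calc _ ≤ |inner ℝ (g n) v - inner ℝ w v| + (|inner ℝ (g n) (w - v)| + |inner ℝ w (w - v)|) :=
          (abs_add_le _ _).trans (add_le_add le_rfl (abs_sub _ _))
      _ < ε := by nlinarith [norm_nonneg (w - v)]
  rw [tendsto_iff_norm_sub_tendsto_zero]
  have h2 : ∀ n, ‖g n - w‖ ^ 2 ≤ 2 * (inner ℝ w w - inner ℝ (g n) w) := fun n => by
    rw [norm_sub_sq_real, real_inner_self_eq_norm_sq]
    nlinarith [hg n, norm_nonneg (g n), norm_nonneg w]
  have h3 : Tendsto (fun n => ‖g n - w‖ ^ 2) atTop (𝓝 0) :=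
    squeeze_zero (fun n => sq_nonneg _) h2 (by simpa using (h1.const_sub (inner ℝ w w)).const_mul 2)
  simpa [Real.sqrt_sq] using h3.sqrt

namespace BrownianScale

variable {s : BrownianScale}

/-- The properties of the elements of `𝓕^{(s)}` that are used: such a function has a weak
derivative in `L²(ℝ)` that vanishes on the flat set. -/
theorem IsRepresentedBy.hasWeakDeriv {u : Lp ℝ 2 (volume : Measure ℝ)} {φ : ℝ → ℝ}
    (h : s.IsRepresentedBy u φ) :
    MemLp (s.pullbackDeriv φ) 2 volume ∧ HasWeakDeriv u (s.pullbackDeriv φ) := by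
  have hL := memLp_pullbackDeriv_iff.2 h.2.2
  exact ⟨hL, (hasWeakDeriv_comp h.1 hL).congr h.2.1.symm EventuallyEq.rfl⟩

theorem exists_hasWeakDeriv {u : Lp ℝ 2 (volume : Measure ℝ)} (hu : u ∈ s.scaleForm.domain) :
    ∃ g : Lp ℝ 2 (volume : Measure ℝ), HasWeakDeriv u g ∧ ∀ᵐ x, x ∈ s.flatSet → g x = 0 := by
  obtain ⟨φ, hφ⟩ := hu
  obtain ⟨hL, hw⟩ := hφ.hasWeakDeriv
  refine ⟨hL.toLp, hw.congr EventuallyEq.rfl hL.coeFn_toLp.symm, ?_⟩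
  filter_upwards [hL.coeFn_toLp, s.ae_mem_growthSet_iff] with x h1 h2 h3
  rw [h1]
  exact indicator_of_notMem (fun h => h2.1 h h3) _

theorem scaleForm_form_eq {u v gu gv : Lp ℝ 2 (volume : Measure ℝ)}
    (hu : u ∈ s.scaleForm.domain) (hv : v ∈ s.scaleForm.domain) (hgu : HasWeakDeriv u gu)
    (hgv : HasWeakDeriv v gv) : s.scaleForm.form u v = (1 / 2) * inner ℝ gu gv := by
  have key : ∀ w gw : Lp ℝ 2 (volume : Measure ℝ), w ∈ s.scaleForm.domain → HasWeakDeriv w gw →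
      s.growthSet.indicator (s.scaleDeriv w) =ᵐ[volume] gw := by
    intro w gw hw hgw
    have hw' : ∃ φ, s.IsRepresentedBy w φ := hw
    obtain ⟨hL, hd⟩ := hw'.choose_spec.hasWeakDeriv
    have e : s.scaleDeriv w = deriv hw'.choose ∘ s.toFun := dif_pos hw'
    rw [e]
    exact hd.ae_eq hgw (hL.locallyIntegrable (by norm_num))
      ((Lp.memLp gw).locallyIntegrable (by norm_num))
  change (1 / 2) * ∫ x, s.scaleDeriv u x * s.scaleDeriv v x ∂s.measure = _
  rw [L2.inner_def, measure_eq_restrict, ← integral_indicator s.measurableSet_growthSet]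
  congr 1
  refine integral_congr_ae ?_
  filter_upwards [key u gu hu hgu, key v gv hv hgv] with x h1 h2
  rw [indicator_mul (f := s.scaleDeriv u) (g := s.scaleDeriv v)]
  simp only [h1, h2, RCLike.inner_apply, conj_trivial, mul_comm]

/-! ### The core `C_c^1(s)` -/

theorem mem_smoothCore_of_contDiff {φ : ℝ → ℝ} (h1 : ContDiff ℝ 1 φ) (h2 : HasCompactSupport φ)
    (h3 : tsupport φ ⊆ s.image) : φ ∘ s.toFun ∈ s.smoothCore := ⟨φ, h1, h2, h3, rfl⟩

theorem isCompact_preimage {K : Set ℝ} (hK : IsCompact K) (hKs : K ⊆ s.image) :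
    IsCompact (s.toFun ⁻¹' K) :=
  s.isOpenEmbedding.isInducing.isCompact_preimage_iff hKs |>.2 hK

theorem hasCompactSupport_comp {φ : ℝ → ℝ} (h2 : HasCompactSupport φ)
    (h3 : tsupport φ ⊆ s.image) : HasCompactSupport (φ ∘ s.toFun) :=
  HasCompactSupport.intro (isCompact_preimage h2 h3) fun _ hx =>
    image_eq_zero_of_notMem_tsupport (f := φ) hx

theorem exists_cutoff {K : Set ℝ} (hK : IsCompact K) :
    ∃ χ : ℝ → ℝ, ContDiff ℝ 1 χ ∧ HasCompactSupport χ ∧ tsupport χ ⊆ s.image ∧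
      (∀ x ∈ K, χ (s.toFun x) = 1) ∧ ∀ y, 0 ≤ χ y ∧ χ y ≤ 1 := by
  obtain ⟨R, hR, hKR⟩ := hK.isBounded.exists_pos_norm_le
  have h1 : s.toFun (-R - 1) < s.toFun (-R) := s.strictMono (by linarith)
  have h2 : s.toFun (-R) < s.toFun R := s.strictMono (by linarith)
  have h3 : s.toFun R < s.toFun (R + 1) := s.strictMono (by linarith)
  set δ := min (s.toFun (-R) - s.toFun (-R - 1)) (s.toFun (R + 1) - s.toFun R)
  have hδ : 0 < δ := lt_min (by linarith) (by linarith)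
  let b : ContDiffBump ((s.toFun (-R) + s.toFun R) / 2) :=
    { rIn := (s.toFun R - s.toFun (-R)) / 2
      rOut := (s.toFun R - s.toFun (-R)) / 2 + δ
      rIn_pos := by linarith
      rIn_lt_rOut := by linarith }
  refine ⟨b, b.contDiff, b.hasCompactSupport, ?_, fun x hx => ?_, fun y => ⟨b.nonneg, b.le_one⟩⟩
  · rw [b.tsupport_eq, Real.closedBall_eq_Icc]
    refine Subset.trans (Icc_subset_Icc ?_ ?_) (s.ordConnected_image.out ⟨-R - 1, rfl⟩ ⟨R + 1, rfl⟩)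
    · have := min_le_left (s.toFun (-R) - s.toFun (-R - 1)) (s.toFun (R + 1) - s.toFun R)
      change _ ≤ _ - ((s.toFun R - s.toFun (-R)) / 2 + δ)
      linarith
    · have := min_le_right (s.toFun (-R) - s.toFun (-R - 1)) (s.toFun (R + 1) - s.toFun R)
      change _ + ((s.toFun R - s.toFun (-R)) / 2 + δ) ≤ _
      linarith
  · refine b.one_of_mem_closedBall ?_
    rw [Real.closedBall_eq_Icc]
    have hx' := abs_le.1 (hKR x hx)
    have h4 := s.strictMono.monotone hx'.1
    have h5 := s.strictMono.monotone hx'.2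
    constructor
    · change _ - (s.toFun R - s.toFun (-R)) / 2 ≤ _
      linarith
    · change _ ≤ _ + (s.toFun R - s.toFun (-R)) / 2
      linarith

variable (s) in
theorem isCutoffAlgebra_smoothCore : IsCutoffAlgebra s.smoothCore where
  continuous := by
    rintro _ ⟨φ, h1, -, -, rfl⟩
    exact h1.continuous.comp s.continuous
  compactSupport := by
    rintro _ ⟨φ, -, h2, h3, rfl⟩
    exact hasCompactSupport_comp h2 h3
  add_mem := by
    rintro _ ⟨φ, h1, h2, h3, rfl⟩ _ ⟨ψ, h1', h2', h3', rfl⟩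
    exact ⟨φ + ψ, h1.add h1', h2.add h2', (tsupport_add φ ψ).trans (union_subset h3 h3'), rfl⟩
  smul_mem := by
    rintro c _ ⟨φ, h1, h2, h3, rfl⟩
    exact ⟨c • φ, contDiff_const.smul h1, h2.smul_left (f := fun _ => c),
      (tsupport_smul_subset_right (fun _ => c) φ).trans h3, rfl⟩
  mul_mem := by
    rintro _ ⟨φ, h1, h2, h3, rfl⟩ _ ⟨ψ, h1', h2', h3', rfl⟩
    exact ⟨φ * ψ, h1.mul h1', h2.mul_right, (tsupport_mul_subset_left).trans h3, rfl⟩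
  separates x y hxy := by
    obtain ⟨χ, h1, h2, h3, h4, -⟩ := s.exists_cutoff (isCompact_singleton (x := x))
    -- multiply the cut-off function by a coordinate vanishing at `s y`
    refine ⟨_, ⟨fun z => χ z * (z - s.toFun y), h1.mul (by fun_prop), h2.mul_right,
      (tsupport_mul_subset_left).trans h3, rfl⟩, ?_⟩
    simp [h4 x rfl, sub_eq_zero, s.strictMono.injective.ne hxy]
  cutoff K hK := by
    obtain ⟨χ, h1, h2, h3, h4, h5⟩ := s.exists_cutoff hK
    exact ⟨_, ⟨χ, h1, h2, h3, rfl⟩, h4, fun x => h5 _⟩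

theorem isRepresentedBy_of_contDiff {φ : ℝ → ℝ} (h1 : ContDiff ℝ 1 φ) (h2 : HasCompactSupport φ)
    (h3 : tsupport φ ⊆ s.image) {u : ℝ → ℝ} (hu : u =ᵐ[volume] φ ∘ s.toFun) :
    s.IsRepresentedBy u φ := by
  refine ⟨fun a _ b _ => h1.contDiffOn.absolutelyContinuousOnInterval, hu, ?_⟩
  have hc : HasCompactSupport (deriv φ) := h2.deriv
  exact ((h1.continuous_deriv le_rfl).comp s.continuous).memLp_of_hasCompactSupport
    (hasCompactSupport_comp hc ((closure_mono (support_deriv_subset)).trans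
      (by rw [(isClosed_tsupport φ).closure_eq]; exact h3)))

theorem mem_domain_of_mem_smoothCore {f : ℝ → ℝ} (hf : f ∈ s.smoothCore)
    {u : Lp ℝ 2 (volume : Measure ℝ)} (hu : u =ᵐ[volume] f) : u ∈ s.scaleForm.domain := by
  obtain ⟨φ, h1, h2, h3, rfl⟩ := hf
  exact ⟨φ, isRepresentedBy_of_contDiff h1 h2 h3 hu⟩

theorem memLp_of_mem_smoothCore {f : ℝ → ℝ} (hf : f ∈ s.smoothCore) : MemLp f 2 volume :=
  (s.isCutoffAlgebra_smoothCore.continuous f hf).memLp_of_hasCompactSupport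
    (s.isCutoffAlgebra_smoothCore.compactSupport f hf)

variable (s) in
theorem dense_domain : Dense s.scaleForm.domain := by
  refine (s.isCutoffAlgebra_smoothCore.dense_Lp (μ := volume)).mono ?_
  rintro u ⟨f, hf, hu⟩
  exact mem_domain_of_mem_smoothCore hf hu

end BrownianScale

/-! ### Density of `C_c^1(s)` in `𝓕^{(s)}` -/

namespace BrownianScale

variable {s : BrownianScale}

/-- Absolutely continuous functions `φ` with compact support in `J` and `φ' ∈ L²` are approximated
by functions `ψ ∈ C_c^1(J)`: approximate `φ'` in `L²` by a continuous function, correct its integral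
to zero, and integrate. -/
theorem exists_contDiff_near {φ : ℝ → ℝ}
    (hφ : ∀ a ∈ s.image, ∀ b ∈ s.image, AbsolutelyContinuousOnInterval φ a b)
    (hL : MemLp (s.pullbackDeriv φ) 2 volume) (hL0 : MemLp (φ ∘ s.toFun) 2 volume) {R : ℝ}
    (hsupp : ∀ x, R ≤ |x| → φ (s.toFun x) = 0) {ε : ℝ} (hε : 0 < ε) :
    ∃ ψ : ℝ → ℝ, ContDiff ℝ 1 ψ ∧ HasCompactSupport ψ ∧ tsupport ψ ⊆ s.image ∧
      ∃ (h1 : MemLp (ψ ∘ s.toFun) 2 volume) (h2 : MemLp (s.pullbackDeriv ψ) 2 volume),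
        ‖hL0.toLp - h1.toLp‖ ≤ ε ∧ ‖hL.toLp - h2.toLp‖ ≤ ε := by
  wlog hR : 0 < R generalizing R
  · exact this (R := 1) (fun x hx => hsupp x (by linarith)) one_pos
  set k : ℝ → ℝ := s.image.indicator (deriv φ) with hk
  have hJm : MeasurableSet s.image := s.isOpen_image.measurableSet
  have hkL : MemLp k 2 volume :=
    (memLp_indicator_iff_restrict hJm).2 (memLp_pullbackDeriv_iff'.1 hL)
  obtain ⟨χ, hχ1, hχc, hχJ, hχ1', hχ01⟩ := s.exists_cutoff (isCompact_Icc (a := -R) (b := R))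
  obtain ⟨R', hR', hχR'⟩ := (isCompact_preimage (s := s) hχc hχJ).isBounded.exists_pos_norm_lt
  -- `χ = 1` on `s([-R, R])`, and `χ` is supported in `s((-R', R'))`
  have hRR' : R < R' := by
    have : R ∈ s.toFun ⁻¹' tsupport χ := subset_tsupport χ (by
      rw [Function.mem_support, hχ1' R ⟨by linarith, le_rfl⟩]; exact one_ne_zero)
    simpa [abs_of_pos hR] using hχR' R this
  set c := s.toFun (-R') with hc
  set d := s.toFun R' with hd
  have hcd : c < d := s.strictMono (by linarith)
  have hIcc : Icc c d ⊆ s.image := s.ordConnected_image.out ⟨_, rfl⟩ ⟨_, rfl⟩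
  have hχIoo : ∀ y, y ∉ Ioo c d → χ y = 0 := by
    intro y hy
    by_contra hne
    have hy' : y ∈ tsupport χ := subset_tsupport χ hne
    obtain ⟨x, rfl⟩ := hχJ hy'
    have h3 := abs_lt.1 (hχR' x hy')
    exact hy ⟨s.strictMono h3.1, s.strictMono h3.2⟩
  have hφ0 : ∀ x, R < |x| → deriv φ (s.toFun x) = 0 := by
    intro x hx
    have : φ =ᶠ[𝓝 (s.toFun x)] fun _ => 0 := by
      rw [← s.isOpenEmbedding.map_nhds_eq]
      refine eventually_map.2 ?_
      filter_upwards [(isOpen_lt continuous_const continuous_abs).mem_nhds hx] with y hy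
      exact hsupp y (le_of_lt hy)
    rw [this.deriv_eq]
    simp
  have hk0 : ∀ y, χ y ≠ 1 → k y = 0 := by
    intro y hy
    by_cases hyJ : y ∈ s.image
    · rw [hk, indicator_of_mem hyJ]
      obtain ⟨x, rfl⟩ := hyJ
      refine hφ0 x ?_
      by_contra hle
      exact hy (hχ1' x (abs_le.1 (not_lt.1 hle)))
    · exact indicator_of_notMem hyJ _
  have hχL : MemLp χ 2 volume := hχ1.continuous.memLp_of_hasCompactSupport hχc
  have hχint : 0 < ∫ y, χ y := by
    refine (integral_pos_iff_support_of_nonneg (fun y => (hχ01 y).1)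
      (hχ1.continuous.integrable_of_hasCompactSupport hχc)).2 ?_
    refine lt_of_lt_of_le ?_ (measure_mono (s := Ioo (s.toFun (-R)) (s.toFun R)) ?_)
    · rw [Real.volume_Ioo, ENNReal.ofReal_pos, sub_pos]
      exact s.strictMono (by linarith)
    · intro y hy
      obtain ⟨x, rfl⟩ := s.ordConnected_image.out ⟨-R, rfl⟩ ⟨R, rfl⟩ ⟨hy.1.le, hy.2.le⟩
      rw [Function.mem_support, hχ1' x ⟨(s.strictMono.lt_iff_lt.1 hy.1).le,
        (s.strictMono.lt_iff_lt.1 hy.2).le⟩]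
      exact one_ne_zero
  set A := ∫ y, χ y
  -- the constants in the estimates
  set V := √(volume.real (Icc c d)) with hV
  set B := 1 + V / A * ‖hχL.toLp‖ with hB
  set W := (volume (Icc (-R') R') ^ (1 / (2 : ℝ))).toReal with hW
  have hB0 : 0 ≤ B := by positivity
  have hW0 : 0 ≤ W := ENNReal.toReal_nonneg
  obtain ⟨η, hη, hη1, hη2⟩ : ∃ η > 0, η * B ≤ ε ∧ η * B * V * W ≤ ε := by
    refine ⟨ε / (B + B * V * W + 1), by positivity, ?_, ?_⟩
    · rw [div_mul_eq_mul_div, div_le_iff₀ (by positivity)]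
      have : 0 ≤ B * V * W := by positivity
      nlinarith
    · rw [mul_assoc, mul_assoc, div_mul_eq_mul_div, div_le_iff₀ (by positivity)]
      have : 0 ≤ B * V * W := by positivity
      nlinarith
  obtain ⟨h, hhc, hkh, hhcont, hhL⟩ := hkL.exists_hasCompactSupport_eLpNorm_sub_le
    (by norm_num) (show ENNReal.ofReal η ≠ 0 by simpa using hη)
  set H : ℝ → ℝ := fun y => χ y * h y with hH
  have hHcont : Continuous H := hχ1.continuous.mul hhcont
  have hHc : HasCompactSupport H := hχc.mul_right
  have hHL : MemLp H 2 volume := hHcont.memLp_of_hasCompactSupport hHc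
  have hHk : ‖hHL.toLp - hkL.toLp‖ ≤ η := by
    rw [← MemLp.toLp_sub, Lp.norm_toLp]
    refine ENNReal.toReal_le_of_le_ofReal hη.le (le_trans (eLpNorm_mono fun y => ?_) hkh)
    simp only [Pi.sub_apply, hH, Real.norm_eq_abs]
    by_cases hy : χ y = 1
    · rw [hy, one_mul, abs_sub_comm]
    · rw [hk0 y hy, sub_zero, zero_sub, abs_neg, abs_mul, abs_of_nonneg (hχ01 y).1]
      exact mul_le_of_le_one_left (abs_nonneg _) (hχ01 y).2
  have hc0 : φ c = 0 := hsupp _ (by rw [abs_neg]; exact hRR'.le.trans (le_abs_self _))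
  have hd0 : φ d = 0 := hsupp _ (hRR'.le.trans (le_abs_self _))
  have hφk : ∀ y ∈ Icc c d, φ y = ∫ z in Ioc c y, k z := by
    intro y hy
    have h1 := (hφ c ⟨_, rfl⟩ y (hIcc hy)).integral_deriv_eq_sub
    rw [hc0, sub_zero, intervalIntegral.integral_of_le hy.1] at h1
    rw [← h1]
    refine setIntegral_congr_fun measurableSet_Ioc fun z hz => ?_
    rw [hk, indicator_of_mem (hIcc ⟨hz.1.le, hz.2.trans hy.2⟩)]
  have hkHm : |∫ y, H y| ≤ η * V := by
    have e1 : ∫ y, H y = ∫ y in Icc c d, (H - k) y := by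
      have e2 : ∫ y in Icc c d, k y = 0 := by
        rw [integral_Icc_eq_integral_Ioc, ← hφk d ⟨hcd.le, le_rfl⟩, hd0]
      have e3 : ∫ y in Icc c d, H y = ∫ y, H y :=
        setIntegral_eq_integral_of_forall_compl_eq_zero fun y hy => by
          simp only [hH]
          rw [hχIoo y fun h => hy ⟨h.1.le, h.2.le⟩, zero_mul]
      have hi : IntegrableOn k (Icc c d) volume :=
        (hkL.locallyIntegrable (by norm_num)).integrableOn_isCompact isCompact_Icc
      simp only [Pi.sub_apply]
      rw [integral_sub (hHcont.integrableOn_Icc) hi, e2, e3, sub_zero]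
    rw [e1]
    refine (abs_setIntegral_le_norm (hHL.sub hkL) measurableSet_Icc
      (by simp)).trans ?_
    rw [MemLp.toLp_sub hHL hkL]
    exact mul_le_mul_of_nonneg_right hHk (by positivity)
  set m := (∫ y, H y) / A with hm
  set g : ℝ → ℝ := fun y => H y - m * χ y with hg
  have hgcont : Continuous g := hHcont.sub (continuous_const.mul hχ1.continuous)
  have hgIoo : ∀ y, y ∉ Ioo c d → g y = 0 := fun y hy => by simp [hg, hH, hχIoo y hy]
  have hgL : MemLp g 2 volume := hHL.sub (hχL.const_mul m)
  have hgk : ‖hkL.toLp - hgL.toLp‖ ≤ η * B := by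
    have e : hkL.toLp - hgL.toLp = -(hHL.toLp - hkL.toLp) + m • hχL.toLp := by
      rw [← MemLp.toLp_const_smul, ← MemLp.toLp_sub, ← MemLp.toLp_sub, ← MemLp.toLp_neg,
        ← MemLp.toLp_add]
      refine MemLp.toLp_congr _ _ (Eventually.of_forall fun y => ?_)
      simp [hg]
      ring
    rw [e]
    refine (norm_add_le _ _).trans ?_
    rw [norm_neg, norm_smul, Real.norm_eq_abs, hm, abs_div, abs_of_pos hχint, hB]
    have h5 : |∫ y, H y| / A ≤ η * V / A := div_le_div_of_nonneg_right hkHm hχint.le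
    have h6 := mul_le_mul_of_nonneg_right h5 (norm_nonneg hχL.toLp)
    calc _ ≤ η + η * V / A * ‖hχL.toLp‖ := add_le_add hHk h6
      _ = _ := by ring
  have hgint : ∫ y, g y = 0 := by
    have hi := hχ1.continuous.integrable_of_hasCompactSupport (μ := volume) hχc
    rw [hg, integral_sub (hHcont.integrable_of_hasCompactSupport hHc) (hi.const_mul m),
      integral_const_mul, hm, div_mul_cancel₀ _ hχint.ne', sub_self]
  set ψ : ℝ → ℝ := fun y => ∫ z in c..y, g z with hψ
  have hψd : ∀ y, HasDerivAt ψ (g y) y := fun y =>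
    intervalIntegral.integral_hasDerivAt_right (hgcont.intervalIntegrable _ _)
      (hgcont.stronglyMeasurableAtFilter _ _) hgcont.continuousAt
  have hψd' : deriv ψ = g := funext fun y => (hψd y).deriv
  have hψ1 : ContDiff ℝ 1 ψ :=
    contDiff_one_iff_deriv.2 ⟨fun y => (hψd y).differentiableAt, by rwa [hψd']⟩
  have hψ0 : ∀ y, y ∉ Icc c d → ψ y = 0 := by
    intro y hy
    rcases lt_or_ge y c with hyc | hyc
    · refine intervalIntegral.integral_zero_ae (Eventually.of_forall fun z hz => ?_)
      rw [uIoc_of_ge hyc.le] at hz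
      exact hgIoo z fun h => absurd hz.2 (not_le.2 h.1)
    · have hyd : d < y := by
        by_contra hle
        exact hy ⟨hyc, not_lt.1 hle⟩
      simp only [hψ]
      rw [intervalIntegral.integral_of_le hyc, setIntegral_eq_integral_of_forall_compl_eq_zero,
        hgint]
      exact fun z hz => hgIoo z fun h => hz ⟨h.1, (h.2.trans hyd).le⟩
  have hψts : tsupport ψ ⊆ Icc c d :=
    closure_minimal (fun y hy => by_contra fun h => hy (hψ0 y h)) isClosed_Icc
  have hψc : HasCompactSupport ψ := isCompact_Icc.of_isClosed_subset (isClosed_tsupport _) hψts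
  have hψJ : tsupport ψ ⊆ s.image := hψts.trans hIcc
  have hrep := isRepresentedBy_of_contDiff (s := s) hψ1 hψc hψJ (EventuallyEq.refl _ _)
  have h1 : MemLp (ψ ∘ s.toFun) 2 volume :=
    memLp_of_mem_smoothCore (mem_smoothCore_of_contDiff hψ1 hψc hψJ)
  have h2 : MemLp (s.pullbackDeriv ψ) 2 volume := memLp_pullbackDeriv_iff.2 hrep.2.2
  refine ⟨ψ, hψ1, hψc, hψJ, h1, h2, ?_, ?_⟩
  · refine (dist_toLp_le (c := η * B * V) (isCompact_Icc (a := -R') (b := R')) (by simp)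
      (by positivity) hL0 h1 ?_ ?_ fun x => ?_).trans hη2
    · intro x hx
      refine abs_le.1 ?_
      by_contra hle
      exact hx (hsupp x (hRR'.trans (not_le.1 hle)).le)
    · intro x hx
      have := hψts (subset_tsupport ψ hx)
      exact ⟨s.strictMono.le_iff_le.1 this.1, s.strictMono.le_iff_le.1 this.2⟩
    · simp only [Function.comp_apply]
      by_cases hx : s.toFun x ∈ Icc c d
      · have e : φ (s.toFun x) - ψ (s.toFun x) = ∫ z in Ioc c (s.toFun x), (k - g) z := by
          have hi : IntegrableOn k (Ioc c (s.toFun x)) volume :=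
            ((hkL.locallyIntegrable (by norm_num)).integrableOn_isCompact
              (isCompact_Icc (a := c) (b := s.toFun x))).mono_set Ioc_subset_Icc_self
          simp only [Pi.sub_apply]
          rw [integral_sub hi (hgcont.integrableOn_Ioc), hφk _ hx, hψ]
          simp only
          rw [intervalIntegral.integral_of_le hx.1]
        rw [e]
        refine (abs_setIntegral_le_norm (hkL.sub hgL) measurableSet_Ioc (by simp)).trans ?_
        rw [MemLp.toLp_sub hkL hgL]
        refine mul_le_mul hgk (Real.sqrt_le_sqrt ?_) (by positivity) (by positivity)
        exact measureReal_mono (Ioc_subset_Icc_self.trans (Icc_subset_Icc_right hx.2)) (by simp)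
      · have h3 : φ (s.toFun x) = 0 := by
          refine hsupp x ?_
          by_contra hlt
          have := abs_lt.1 ((not_le.1 hlt).trans hRR')
          exact hx ⟨s.strictMono.monotone this.1.le, s.strictMono.monotone this.2.le⟩
        rw [h3, hψ0 _ hx, sub_zero, abs_zero]
        positivity
  · refine le_trans ?_ (hgk.trans hη1)
    rw [← MemLp.toLp_sub, ← MemLp.toLp_sub, Lp.norm_toLp, Lp.norm_toLp]
    refine ENNReal.toReal_mono (hkL.sub hgL).eLpNorm_ne_top ?_
    -- both sides are norms over `J`, compared by the change of variables `y = s(x)`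
    have e1 : s.pullbackDeriv φ - s.pullbackDeriv ψ = s.growthSet.indicator ((k - g) ∘ s.toFun) := by
      funext x
      by_cases hx : x ∈ s.growthSet
      · have : s.toFun x ∈ s.image := ⟨x, rfl⟩
        simp [pullbackDeriv, hx, hk, hψd', this]
      · simp [pullbackDeriv, hx]
    rw [e1, eLpNorm_indicator_eq_eLpNorm_restrict s.measurableSet_growthSet, ← measure_eq_restrict,
      ← s.measurableEmbedding.eLpNorm_map_measure, s.map_measure]
    exact eLpNorm_mono_measure _ Measure.restrict_le_self

end BrownianScale

/-- The contraction of the real line that moves every point towards zero by at most `δ`. -/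
def shrink (δ y : ℝ) : ℝ := y - max (-δ) (min y δ)

theorem abs_shrink_sub_le {δ : ℝ} (hδ : 0 ≤ δ) (y z : ℝ) :
    |shrink δ y - shrink δ z| ≤ |y - z| := by
  wlog hyz : z ≤ y generalizing y z
  · rw [abs_sub_comm, abs_sub_comm y z]
    exact this z y (le_of_not_ge hyz)
  have h1 : max (-δ) (min z δ) ≤ max (-δ) (min y δ) := max_le_max le_rfl (min_le_min hyz le_rfl)
  have h2 : max (-δ) (min y δ) - max (-δ) (min z δ) ≤ y - z := by
    rcases le_total z δ with ha | ha <;> rcases le_total y δ with hb | hb <;>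
      simp only [ha, hb, min_eq_left, min_eq_right] <;>
      rcases le_total (-δ) z with hc | hc <;> rcases le_total (-δ) y with hd | hd <;>
      simp only [hc, hd, max_eq_left, max_eq_right, max_eq_right (neg_le_self hδ)] <;> linarith
  rw [abs_of_nonneg (by linarith : 0 ≤ y - z), abs_le]
  simp only [shrink]
  constructor <;> linarith

theorem abs_sub_shrink_le {δ : ℝ} (hδ : 0 ≤ δ) (y : ℝ) :
    |y - shrink δ y| ≤ δ ∧ |y - shrink δ y| ≤ |y| := by
  have e : y - shrink δ y = max (-δ) (min y δ) := by simp [shrink]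
  rw [e]
  refine ⟨abs_le.2 ⟨le_max_left _ _, max_le (by linarith) (min_le_right _ _)⟩, abs_le.2 ⟨?_, ?_⟩⟩
  · rcases le_total y δ with h | h
    · rw [min_eq_left h]; exact (neg_abs_le y).trans (le_max_right _ _)
    · rw [min_eq_right h]; exact (by linarith [abs_nonneg y] : -|y| ≤ δ).trans (le_max_right _ _)
  · refine max_le (by linarith [abs_nonneg y]) ((min_le_left _ _).trans (le_abs_self y))

theorem shrink_eq_zero {δ y : ℝ} (h : |y| ≤ δ) : shrink δ y = 0 := by
  have h' := abs_le.1 h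
  rw [shrink, min_eq_left h'.2, max_eq_right h'.1, sub_self]

theorem continuous_shrink (δ : ℝ) : Continuous (shrink δ) := by
  unfold shrink
  fun_prop

theorem AbsolutelyContinuousOnInterval.comp_of_contraction {φ τ : ℝ → ℝ} {a b : ℝ}
    (hφ : AbsolutelyContinuousOnInterval φ a b) (hτ : ∀ y z, |τ y - τ z| ≤ |y - z|) :
    AbsolutelyContinuousOnInterval (τ ∘ φ) a b := by
  unfold AbsolutelyContinuousOnInterval at hφ ⊢
  refine squeeze_zero (fun _ => Finset.sum_nonneg fun _ _ => dist_nonneg)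
    (fun E => Finset.sum_le_sum fun i _ => ?_) hφ
  rw [Real.dist_eq, Real.dist_eq]
  exact hτ _ _

theorem abs_deriv_comp_le {φ τ : ℝ → ℝ} {y : ℝ} (hφ : DifferentiableAt ℝ φ y)
    (hτ : ∀ y z, |τ y - τ z| ≤ |y - z|) : |deriv (τ ∘ φ) y| ≤ |deriv φ y| := by
  by_cases h : DifferentiableAt ℝ (τ ∘ φ) y
  · refine le_of_tendsto_of_tendsto' (hasDerivAt_iff_tendsto_slope.1 h.hasDerivAt).abs
      (hasDerivAt_iff_tendsto_slope.1 hφ.hasDerivAt).abs fun z => ?_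
    rw [slope_def_field, slope_def_field, abs_div, abs_div]
    exact div_le_div_of_nonneg_right (hτ _ _) (abs_nonneg _)
  · rw [deriv_zero_of_not_differentiableAt h, abs_zero]
    exact abs_nonneg _

/-- A square integrable, Hölder continuous function vanishes at infinity. -/
theorem exists_abs_le_of_memLp {U : ℝ → ℝ} (hU : MemLp U 2 volume) {C : ℝ}
    (hC : ∀ a b, a ≤ b → |U b - U a| ≤ C * √(b - a)) {δ : ℝ} (hδ : 0 < δ) :
    ∃ R, ∀ x, R ≤ |x| → |U x| ≤ δ := by
  have hCC : 0 ≤ C := by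
    have := hC 0 1 zero_le_one
    simp only [sub_zero, Real.sqrt_one, mul_one] at this
    exact (abs_nonneg _).trans this
  set r : ℝ := (δ / (2 * (C + 1))) ^ 2 with hr
  have hr0 : 0 < r := by positivity
  have hsq : √r = δ / (2 * (C + 1)) := Real.sqrt_sq (by positivity)
  have hUc : ∀ x, ∀ y ∈ Icc x (x + r), δ < |U x| → δ / 2 ≤ |U y| := by
    intro x y hy hx
    have h1 := hC x y hy.1
    have h2 : √(y - x) ≤ √r := Real.sqrt_le_sqrt (by linarith [hy.2])
    have h3 : C * √(y - x) ≤ δ / 2 := by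
      refine (mul_le_mul_of_nonneg_left h2 hCC).trans ?_
      rw [hsq, mul_div_assoc', div_le_div_iff₀ (by positivity) two_pos]
      nlinarith
    have h4 : |U x| ≤ |U y| + |U y - U x| := by
      have := abs_sub_abs_le_abs_sub (U x) (U y)
      rw [abs_sub_comm (U x)] at this
      linarith
    linarith
  set S : Set ℝ := {y | (δ / 2).toNNReal ≤ ‖U y‖₊}
  have hS : NullMeasurableSet S volume :=
    nullMeasurableSet_le aemeasurable_const hU.aestronglyMeasurable.aemeasurable.nnnorm
  have hSfin : volume S < ∞ :=
    hU.meas_ge_lt_top two_ne_zero (by norm_num) (by simpa using hδ)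
  have hlim : Tendsto (fun n : ℕ => volume (S ∩ {y | (n : ℝ) ≤ |y|})) atTop (𝓝 0) := by
    have h1 : ⋂ n : ℕ, S ∩ {y | (n : ℝ) ≤ |y|} = ∅ := by
      refine eq_empty_of_forall_notMem fun y hy => ?_
      obtain ⟨n, hn⟩ := exists_nat_gt |y|
      exact absurd (mem_iInter.1 hy n).2 (not_le.2 hn)
    have := tendsto_measure_iInter_atTop (μ := volume) (s := fun n : ℕ => S ∩ {y | (n : ℝ) ≤ |y|})
      (fun n => hS.inter (measurableSet_le measurable_const measurable_norm).nullMeasurableSet)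
      (fun n k hnk => inter_subset_inter_right _ fun y (hy : (k : ℝ) ≤ |y|) =>
        show (n : ℝ) ≤ |y| from (Nat.cast_le.2 hnk).trans hy)
      ⟨0, ((measure_mono inter_subset_left).trans_lt hSfin).ne⟩
    rwa [h1, measure_empty] at this
  obtain ⟨n, hn⟩ := (hlim.eventually_lt_const (ENNReal.ofReal_pos.2 hr0)).exists
  refine ⟨n + r, fun x hx => ?_⟩
  by_contra hlt
  rw [not_le] at hlt
  refine absurd hn (not_lt.2 ?_)
  have hvol : ENNReal.ofReal r = volume (Icc x (x + r)) := by rw [Real.volume_Icc]; simp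
  rw [hvol]
  refine measure_mono fun y hy => mem_inter ?_ ?_
  · have := hUc x y hy hlt
    change (δ / 2).toNNReal ≤ ‖U y‖₊
    rw [Real.toNNReal_le_iff_le_coe]
    simpa using this
  · change (n : ℝ) ≤ |y|
    have h1 : |x| ≤ |y| + |y - x| := by
      have := abs_sub_abs_le_abs_sub x y
      rw [abs_sub_comm x] at this
      linarith
    have h2 : |y - x| ≤ r := by
      rw [abs_of_nonneg (by linarith [hy.1])]; linarith [hy.2]
    linarith

theorem norm_toLp_sub_sq {X : Type*} [MeasurableSpace X] {μ : Measure X} {f g : X → ℝ}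
    (hf : MemLp f 2 μ) (hg : MemLp g 2 μ) :
    ‖hf.toLp - hg.toLp‖ ^ 2 = ∫ x, (f x - g x) ^ 2 ∂μ := by
  rw [← MemLp.toLp_sub hf hg, ← real_inner_self_eq_norm_sq, L2.inner_def]
  refine integral_congr_ae ?_
  filter_upwards [(hf.sub hg).coeFn_toLp] with x hx
  rw [hx]
  simp [sq]

/-- Dominated convergence in `L²`. -/
theorem tendsto_toLp_of_dominated {X : Type*} [MeasurableSpace X] {μ : Measure X}
    {f : ℕ → X → ℝ} {g : X → ℝ} (hf : ∀ n, MemLp (f n) 2 μ) (hg : MemLp g 2 μ)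
    (hle : ∀ n x, |g x - f n x| ≤ |g x|)
    (hlim : ∀ x, Tendsto (fun n => f n x) atTop (𝓝 (g x))) :
    Tendsto (fun n => (hf n).toLp) atTop (𝓝 hg.toLp) := by
  rw [tendsto_iff_norm_sub_tendsto_zero]
  have h : Tendsto (fun n => ‖(hf n).toLp - hg.toLp‖ ^ 2) atTop (𝓝 0) := by
    simp only [norm_toLp_sub_sq]
    have h0 : ∫ _, (0 : ℝ) ∂μ = 0 := by simp
    rw [← h0]
    refine tendsto_integral_of_dominated_convergence (fun x => g x ^ 2)
      (fun n => (((hf n).sub hg).aestronglyMeasurable.pow 2)) hg.integrable_sq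
      (fun n => Eventually.of_forall fun x => ?_) (Eventually.of_forall fun x => ?_)
    · rw [Real.norm_eq_abs, abs_of_nonneg (sq_nonneg _), ← sq_abs, ← sq_abs (g x), abs_sub_comm]
      exact pow_le_pow_left₀ (abs_nonneg _) (hle n x) 2
    · simpa using ((hlim x).sub_const (g x)).pow 2
  simpa [Real.sqrt_sq] using h.sqrt

theorem HasWeakDeriv.inner_eq {u g v w : Lp ℝ 2 (volume : Measure ℝ)} (h : HasWeakDeriv u g)
    {ψ : ℝ → ℝ} (hψ : ContDiff ℝ (⊤ : ℕ∞) ψ) (hψc : HasCompactSupport ψ) (hv : v =ᵐ[volume] ψ)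
    (hw : w =ᵐ[volume] deriv ψ) : inner ℝ g v = -inner ℝ u w := by
  rw [L2.inner_def, L2.inner_def, eq_neg_iff_add_eq_zero, add_comm, ← eq_neg_iff_add_eq_zero]
  convert h ψ hψ hψc using 1
  · refine integral_congr_ae ?_
    filter_upwards [hw] with x hx
    rw [hx]; simp [mul_comm]
  · congr 1
    refine integral_congr_ae ?_
    filter_upwards [hv] with x hx
    rw [hx]; simp [mul_comm]

namespace BrownianScale

variable {s : BrownianScale}

theorem eLpNorm_pullbackDeriv (φ : ℝ → ℝ) :
    eLpNorm (s.pullbackDeriv φ) 2 volume = eLpNorm (deriv φ) 2 (volume.restrict s.image) := by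
  rw [pullbackDeriv, eLpNorm_indicator_eq_eLpNorm_restrict s.measurableSet_growthSet,
    ← measure_eq_restrict, ← s.measurableEmbedding.eLpNorm_map_measure, s.map_measure]

theorem ae_differentiableAt {φ : ℝ → ℝ}
    (hφ : ∀ a ∈ s.image, ∀ b ∈ s.image, AbsolutelyContinuousOnInterval φ a b) :
    ∀ᵐ y ∂volume.restrict s.image, DifferentiableAt ℝ φ y := by
  rw [ae_restrict_iff' s.isOpen_image.measurableSet]
  have h : ∀ n : ℕ, ∀ᵐ y, y ∈ uIcc (s.toFun (-n)) (s.toFun n) → DifferentiableAt ℝ φ y := fun n =>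
    (hφ _ ⟨_, rfl⟩ _ ⟨_, rfl⟩).ae_differentiableAt
  filter_upwards [ae_all_iff.2 h] with y hy
  rintro ⟨x, rfl⟩
  obtain ⟨n, hn⟩ := exists_nat_ge |x|
  have hx := abs_le.1 hn
  refine hy n ?_
  rw [uIcc_of_le (s.strictMono.monotone (hx.1.trans hx.2))]
  exact ⟨s.strictMono.monotone hx.1, s.strictMono.monotone hx.2⟩

theorem abs_comp_sub_le {φ : ℝ → ℝ}
    (hφ : ∀ a ∈ s.image, ∀ b ∈ s.image, AbsolutelyContinuousOnInterval φ a b)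
    (hL : MemLp (s.pullbackDeriv φ) 2 volume) (a b : ℝ) (hab : a ≤ b) :
    |φ (s.toFun b) - φ (s.toFun a)| ≤ ‖hL.toLp‖ * √(b - a) := by
  rw [sub_eq_integral_pullbackDeriv hφ hab, intervalIntegral.integral_of_le hab]
  refine (abs_setIntegral_le_norm hL measurableSet_Ioc (by simp)).trans (le_of_eq ?_)
  rw [Real.volume_real_Ioc_of_le hab]

/-- `C_c^1(s)` is dense in `𝓕^{(s)}`.  The elements of `𝓕^{(s)}` vanish at infinity, so that they
have compact support after being moved towards zero by `δ`; this contraction does not increase the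
norm of the derivative, which makes the derivatives converge strongly as `δ → 0`. -/
theorem exists_smoothCore_near {u : Lp ℝ 2 (volume : Measure ℝ)} (hu : u ∈ s.scaleForm.domain)
    {ε : ℝ} (hε : 0 < ε) :
    ∃ f ∈ s.smoothCore, ∃ v gu gv : Lp ℝ 2 (volume : Measure ℝ), v =ᵐ[volume] f ∧
      HasWeakDeriv u gu ∧ HasWeakDeriv v gv ∧ ‖u - v‖ < ε ∧ ‖gu - gv‖ < ε := by
  obtain ⟨φ, hφ⟩ := hu
  obtain ⟨hL, hw⟩ := hφ.hasWeakDeriv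
  have hL0 : MemLp (φ ∘ s.toFun) 2 volume := (memLp_congr_ae hφ.2.1).1 (Lp.memLp u)
  have huL : u = hL0.toLp := Lp.ext (hφ.2.1.trans hL0.coeFn_toLp.symm)
  have hwL : HasWeakDeriv u hL.toLp := hw.congr EventuallyEq.rfl hL.coeFn_toLp.symm
  set δ : ℕ → ℝ := fun n => 1 / (n + 1)
  have hδ : ∀ n, 0 < δ n := fun n => by positivity
  have hδ0 : Tendsto δ atTop (𝓝 0) := tendsto_one_div_add_atTop_nhds_zero_nat
  set τ : ℕ → ℝ → ℝ := fun n => shrink (δ n)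
  have hτ : ∀ n y z, |τ n y - τ n z| ≤ |y - z| := fun n => abs_shrink_sub_le (hδ n).le
  have hτφ : ∀ n, ∀ a ∈ s.image, ∀ b ∈ s.image, AbsolutelyContinuousOnInterval (τ n ∘ φ) a b :=
    fun n a ha b hb => (hφ.1 a ha b hb).comp_of_contraction (hτ n)
  have hder : ∀ n, eLpNorm (deriv (τ n ∘ φ)) 2 (volume.restrict s.image) ≤
      eLpNorm (deriv φ) 2 (volume.restrict s.image) := fun n => by
    refine eLpNorm_mono_ae ?_
    filter_upwards [ae_differentiableAt hφ.1] with y hy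
    exact abs_deriv_comp_le hy (hτ n)
  have hLn : ∀ n, MemLp (s.pullbackDeriv (τ n ∘ φ)) 2 volume := fun n =>
    memLp_pullbackDeriv_iff'.2 ⟨(measurable_deriv _).aestronglyMeasurable,
      (hder n).trans_lt (memLp_pullbackDeriv_iff'.1 hL).eLpNorm_lt_top⟩
  have hle : ∀ n x, |(φ ∘ s.toFun) x - ((τ n ∘ φ) ∘ s.toFun) x| ≤ |(φ ∘ s.toFun) x| := fun n x =>
    (abs_sub_shrink_le (hδ n).le _).2
  have hL0n : ∀ n, MemLp ((τ n ∘ φ) ∘ s.toFun) 2 volume := fun n => by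
    have h1 : AEStronglyMeasurable ((τ n ∘ φ) ∘ s.toFun) volume :=
      (continuous_shrink (δ n)).comp_aestronglyMeasurable hL0.aestronglyMeasurable
    refine MemLp.of_le hL0 h1 (Eventually.of_forall fun x => ?_)
    have := hτ n (φ (s.toFun x)) 0
    have h0 : τ n 0 = 0 := shrink_eq_zero (by simpa using (hδ n).le)
    simpa [h0] using this
  have hu_lim : Tendsto (fun n => (hL0n n).toLp) atTop (𝓝 hL0.toLp) := by
    refine tendsto_toLp_of_dominated hL0n hL0 hle fun x => ?_
    rw [tendsto_iff_norm_sub_tendsto_zero]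
    refine squeeze_zero (fun n => norm_nonneg _) (fun n => ?_) hδ0
    rw [Real.norm_eq_abs, abs_sub_comm]
    exact (abs_sub_shrink_le (hδ n).le _).1
  have hwn : ∀ n, HasWeakDeriv ((hL0n n).toLp) ((hLn n).toLp) := fun n =>
    (hasWeakDeriv_comp (hτφ n) (hLn n)).congr (hL0n n).coeFn_toLp.symm (hLn n).coeFn_toLp.symm
  have hg_lim : Tendsto (fun n => (hLn n).toLp) atTop (𝓝 hL.toLp) := by
    refine tendsto_of_tendsto_inner
      (Lp.dense_hasCompactSupport_contDiff (F := ℝ) (μ := (volume : Measure ℝ)) (p := 2)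
        (by norm_num)) (fun n => ?_) ?_
    · rw [Lp.norm_toLp, Lp.norm_toLp, eLpNorm_pullbackDeriv, eLpNorm_pullbackDeriv]
      exact ENNReal.toReal_mono (memLp_pullbackDeriv_iff'.1 hL).eLpNorm_ne_top (hder n)
    · rintro v ⟨ψ, hvψ, hψc, hψ⟩
      have hψ' : MemLp (deriv ψ) 2 volume :=
        (hψ.continuous_deriv (by simp)).memLp_of_hasCompactSupport hψc.deriv
      rw [hwL.inner_eq hψ hψc hvψ hψ'.coeFn_toLp, huL]
      refine Tendsto.congr (fun n => ((hwn n).inner_eq hψ hψc hvψ hψ'.coeFn_toLp).symm) ?_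
      exact (hu_lim.inner tendsto_const_nhds).neg
  obtain ⟨n, hn1, hn2⟩ := (((Metric.tendsto_nhds.1 hu_lim) (ε / 2) (by positivity)).and
    ((Metric.tendsto_nhds.1 hg_lim) (ε / 2) (by positivity))).exists
  obtain ⟨R, hR⟩ := exists_abs_le_of_memLp hL0 (abs_comp_sub_le hφ.1 hL) (hδ n)
  obtain ⟨ψ, hψ1, hψc, hψJ, h1, h2, h3, h4⟩ := exists_contDiff_near (hτφ n) (hLn n) (hL0n n)
    (fun x hx => shrink_eq_zero (hR x hx)) (show 0 < ε / 2 by positivity)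
  have hrep := isRepresentedBy_of_contDiff (s := s) hψ1 hψc hψJ (EventuallyEq.refl _ _)
  refine ⟨_, mem_smoothCore_of_contDiff hψ1 hψc hψJ, h1.toLp, hL.toLp, h2.toLp, h1.coeFn_toLp, hwL,
    (hasWeakDeriv_comp hrep.1 h2).congr h1.coeFn_toLp.symm h2.coeFn_toLp.symm, ?_, ?_⟩
  · rw [huL]
    rw [dist_comm, dist_eq_norm] at hn1
    linarith [norm_sub_le_norm_sub_add_norm_sub hL0.toLp (hL0n n).toLp h1.toLp]
  · rw [dist_comm, dist_eq_norm] at hn2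
    linarith [norm_sub_le_norm_sub_add_norm_sub hL.toLp (hLn n).toLp h2.toLp]

end BrownianScale

/-! ### Weak partial derivatives in `L²(ℝ^d)` -/

/-- The Hilbert space `L²(ℝ^d)`. -/
abbrev L2Space (d : ℕ) := Lp ℝ 2 (volume : Measure (Fin d → ℝ))

/-- The space `C_c^∞(ℝ^d)` of test functions. -/
def testFunctions (d : ℕ) : Submodule ℝ ((Fin d → ℝ) → ℝ) where
  carrier := {φ | ContDiff ℝ (⊤ : ℕ∞) φ ∧ HasCompactSupport φ}
  add_mem' := fun hφ hψ => ⟨hφ.1.add hψ.1, hφ.2.add hψ.2⟩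
  zero_mem' := ⟨contDiff_const, HasCompactSupport.zero⟩
  smul_mem' := fun c _ hφ => ⟨contDiff_const.smul hφ.1, hφ.2.smul_left (f := fun _ => c)⟩

/-- The type of test functions on `ℝ^d`. -/
abbrev SmoothTest (d : ℕ) := ↥(testFunctions d)

namespace SmoothTest

variable {d : ℕ}

theorem contDiff (φ : SmoothTest d) : ContDiff ℝ (⊤ : ℕ∞) (φ : (Fin d → ℝ) → ℝ) := φ.2.1

theorem hasCompactSupport (φ : SmoothTest d) : HasCompactSupport (φ : (Fin d → ℝ) → ℝ) := φ.2.2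

theorem differentiable (φ : SmoothTest d) : Differentiable ℝ (φ : (Fin d → ℝ) → ℝ) :=
  φ.contDiff.differentiable (by simp)

theorem continuous (φ : SmoothTest d) : Continuous (φ : (Fin d → ℝ) → ℝ) := φ.contDiff.continuous

/-- The product of two test functions. -/
def mul (φ ψ : SmoothTest d) : SmoothTest d :=
  ⟨fun x => φ.1 x * ψ.1 x, φ.contDiff.mul ψ.contDiff, φ.hasCompactSupport.mul_right⟩

/-- The translated test function `x ↦ φ (x + a)`. -/
def translate (a : Fin d → ℝ) (φ : SmoothTest d) : SmoothTest d :=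
  ⟨fun x => φ.1 (x + a), φ.contDiff.comp (contDiff_id.add contDiff_const),
    φ.hasCompactSupport.comp_homeomorph (Homeomorph.addRight a)⟩

/-- The partial derivative `∂ᵢφ` of a test function. -/
def partialDeriv (i : Fin d) : SmoothTest d →ₗ[ℝ] SmoothTest d where
  toFun φ := ⟨fun x => fderiv ℝ φ.1 x (Pi.single i 1),
    (φ.contDiff.fderiv_right (m := (⊤ : ℕ∞)) (by simp)).clm_apply contDiff_const,
    φ.hasCompactSupport.fderiv_apply (𝕜 := ℝ) _⟩
  map_add' φ ψ := by
    ext x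
    exact congrArg (· (Pi.single i 1)) (fderiv_add φ.differentiable.differentiableAt
      ψ.differentiable.differentiableAt)
  map_smul' c φ := by
    ext x
    exact congrArg (· (Pi.single i 1)) (fderiv_const_smul φ.differentiable.differentiableAt c)

theorem partialDeriv_apply (i : Fin d) (φ : SmoothTest d) (x : Fin d → ℝ) :
    (partialDeriv i φ).1 x = fderiv ℝ φ.1 x (Pi.single i 1) := rfl

theorem partialDeriv_mul (i : Fin d) (φ ψ : SmoothTest d) (x : Fin d → ℝ) :
    (partialDeriv i (φ.mul ψ)).1 x =
      φ.1 x * (partialDeriv i ψ).1 x + ψ.1 x * (partialDeriv i φ).1 x := by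
  have h := fderiv_fun_mul (𝕜 := ℝ) (φ.differentiable.differentiableAt (x := x))
    (ψ.differentiable.differentiableAt (x := x))
  change (fderiv ℝ (fun y => φ.1 y * ψ.1 y) x) (Pi.single i 1) = _
  rw [h]
  rfl

theorem partialDeriv_translate (i : Fin d) (a : Fin d → ℝ) (φ : SmoothTest d) :
    partialDeriv i (φ.translate a) = (partialDeriv i φ).translate a := by
  ext x
  exact congrArg (· (Pi.single i 1)) (fderiv_comp_add_right (𝕜 := ℝ) (f := φ.1) (x := x) a)

theorem hasDerivAt (φ : SmoothTest d) (i : Fin d) (x : Fin d → ℝ) (t : ℝ) :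
    HasDerivAt (fun t : ℝ => φ.1 (x + Pi.single i t)) ((partialDeriv i φ).1 (x + Pi.single i t)) t := by
  have h1 : HasDerivAt (fun t : ℝ => x + Pi.single i t) (Pi.single i 1) t := by
    have h := ((hasDerivAt_id t).smul_const (Pi.single i (1 : ℝ) : Fin d → ℝ)).const_add x
    simpa [← Pi.single_smul] using h
  exact (φ.differentiable (x + Pi.single i t)).hasFDerivAt.comp_hasDerivAt t h1

theorem memLp (φ : SmoothTest d) : MemLp φ.1 2 (volume : Measure (Fin d → ℝ)) :=
  φ.continuous.memLp_of_hasCompactSupport φ.hasCompactSupport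

variable (d) in
/-- The embedding of the test functions into `L²(ℝ^d)`. -/
def toL2 : SmoothTest d →ₗ[ℝ] L2Space d where
  toFun φ := φ.memLp.toLp
  map_add' φ ψ := MemLp.toLp_add φ.memLp ψ.memLp
  map_smul' c φ := MemLp.toLp_const_smul c φ.memLp

theorem coeFn_toL2 (φ : SmoothTest d) : toL2 d φ =ᵐ[volume] φ.1 := φ.memLp.coeFn_toLp

theorem inner_toL2 (u : L2Space d) (φ : SmoothTest d) :
    inner ℝ u (toL2 d φ) = ∫ x, u x * φ.1 x := by
  rw [L2.inner_def]
  refine integral_congr_ae ?_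
  filter_upwards [coeFn_toL2 φ] with x hx
  rw [hx]; simp [mul_comm]

variable (d) in
theorem denseRange_toL2 : DenseRange (toL2 d) := by
  refine (Lp.dense_hasCompactSupport_contDiff (F := ℝ) (μ := (volume : Measure (Fin d → ℝ)))
    (p := 2) (by norm_num)).mono ?_
  rintro u ⟨φ, hu, hφc, hφ⟩
  exact ⟨⟨φ, hφ, hφc⟩, Lp.ext ((coeFn_toL2 _).trans hu.symm)⟩

end SmoothTest

open SmoothTest

variable {d : ℕ} {i : Fin d}

theorem isWeakPartial_iff {u g : L2Space d} :
    IsWeakPartial i u g ↔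
      ∀ φ : SmoothTest d, inner ℝ u (toL2 d (partialDeriv i φ)) = -inner ℝ g (toL2 d φ) := by
  simp only [inner_toL2, partialDeriv_apply]
  exact ⟨fun h φ => h φ.1 φ.2.1 φ.2.2, fun h φ h1 h2 => h ⟨φ, h1, h2⟩⟩

/-- Vectors with the same inner products with a dense set agree. -/
theorem eq_of_inner_toL2 {g g' : L2Space d}
    (h : ∀ φ : SmoothTest d, inner ℝ g (toL2 d φ) = inner ℝ g' (toL2 d φ)) : g = g' := by
  exact (denseRange_toL2 d).eq_of_inner_left ℝ h

namespace IsWeakPartial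

theorem unique {u g g' : L2Space d} (h : IsWeakPartial i u g) (h' : IsWeakPartial i u g') :
    g = g' :=
  eq_of_inner_toL2 fun φ : SmoothTest d => by
    linarith [isWeakPartial_iff.1 h φ, isWeakPartial_iff.1 h' φ]

theorem add {u v g h : L2Space d} (hu : IsWeakPartial i u g) (hv : IsWeakPartial i v h) :
    IsWeakPartial i (u + v : L2Space d) (g + h : L2Space d) :=
  isWeakPartial_iff.2 fun φ : SmoothTest d => by
    rw [inner_add_left, inner_add_left, isWeakPartial_iff.1 hu, isWeakPartial_iff.1 hv]; ring

theorem smul {u g : L2Space d} (c : ℝ) (hu : IsWeakPartial i u g) :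
    IsWeakPartial i (c • u : L2Space d) (c • g : L2Space d) :=
  isWeakPartial_iff.2 fun φ : SmoothTest d => by
    rw [real_inner_smul_left, real_inner_smul_left, isWeakPartial_iff.1 hu]; ring

theorem sub {u v g h : L2Space d} (hu : IsWeakPartial i u g) (hv : IsWeakPartial i v h) :
    IsWeakPartial i (u - v : L2Space d) (g - h : L2Space d) :=
  isWeakPartial_iff.2 fun φ : SmoothTest d => by
    rw [inner_sub_left, inner_sub_left, isWeakPartial_iff.1 hu, isWeakPartial_iff.1 hv]; ring

theorem zero : IsWeakPartial i (0 : L2Space d) (0 : L2Space d) :=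
  isWeakPartial_iff.2 fun φ : SmoothTest d => by simp

/-- The weak derivative is a closed operator. -/
theorem of_tendsto {u g : ℕ → L2Space d} {v h : L2Space d} (hu : ∀ n, IsWeakPartial i (u n) (g n))
    (huv : Tendsto u atTop (𝓝 v)) (hgh : Tendsto g atTop (𝓝 h)) : IsWeakPartial i v h :=
  isWeakPartial_iff.2 fun φ : SmoothTest d => tendsto_nhds_unique (huv.inner tendsto_const_nhds)
    (((hgh.inner tendsto_const_nhds).neg).congr fun n => (isWeakPartial_iff.1 (hu n) φ).symm)

theorem weakPartial_eq {u g : L2Space d} (h : IsWeakPartial i u g) : weakPartial i u = g := by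
  have h' : ∃ g : L2Space d, IsWeakPartial i u g := ⟨g, h⟩
  rw [weakPartial, dif_pos h']
  exact h'.choose_spec.unique h

end IsWeakPartial

theorem isWeakPartial_weakPartial {u : L2Space d} (hu : u ∈ sobolevH1 d) (i : Fin d) :
    IsWeakPartial i u (weakPartial i u) := by
  obtain ⟨g, hg⟩ := hu i
  rwa [hg.weakPartial_eq]

theorem isWeakPartial_toL2 (φ : SmoothTest d) (i : Fin d) :
    IsWeakPartial i (toL2 d φ) (toL2 d (partialDeriv i φ)) := by
  refine isWeakPartial_iff.2 fun ψ => ?_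
  have e : ∀ a b : SmoothTest d, inner ℝ (toL2 d a) (toL2 d b) = ∫ x, a.1 x * b.1 x := by
    intro a b
    rw [inner_toL2]
    refine integral_congr_ae ?_
    filter_upwards [coeFn_toL2 a] with x hx
    rw [hx]
  have hint : ∀ a b : SmoothTest d, Integrable (fun x => a.1 x * b.1 x) := fun a b =>
    (a.mul b).continuous.integrable_of_hasCompactSupport (a.mul b).hasCompactSupport
  rw [e, e]
  exact integral_mul_fderiv_eq_neg_fderiv_mul_of_integrable (hint (partialDeriv i φ) ψ)
    (hint φ (partialDeriv i ψ)) (hint φ ψ) (fun x _ => φ.differentiable x)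
    (fun x _ => ψ.differentiable x)

theorem toL2_mem_sobolevH1 (φ : SmoothTest d) : toL2 d φ ∈ sobolevH1 d :=
  fun i => ⟨_, isWeakPartial_toL2 φ i⟩

theorem brownianForm_form (u v : L2Space d) :
    (brownianForm d).form u v = (1 / 2) * ∑ i, inner ℝ (weakPartial i u) (weakPartial i v) := by
  change (1 / 2) * ∑ i, ∫ x, weakPartial i u x * weakPartial i v x = _
  congr 1
  refine Finset.sum_congr rfl fun i _ => ?_
  rw [L2.inner_def]
  exact integral_congr_ae (Eventually.of_forall fun x => by simp [mul_comm])

theorem brownianForm_self (u : L2Space d) :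
    (brownianForm d).form u u = (1 / 2) * ∑ i, ‖weakPartial i u‖ ^ 2 := by
  simp only [brownianForm_form, real_inner_self_eq_norm_sq]

/-! ### Translations -/

/-- The translation `u ↦ u (· + a)` of `L²(ℝ^d)`. -/
def translateL2 (a : Fin d → ℝ) : L2Space d →ₗᵢ[ℝ] L2Space d :=
  Lp.compMeasurePreservingₗᵢ ℝ (· + a) (measurePreserving_add_right volume a)

theorem coeFn_translateL2 (a : Fin d → ℝ) (u : L2Space d) :
    translateL2 a u =ᵐ[volume] fun x => u (x + a) :=
  Lp.coeFn_compMeasurePreserving u _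

theorem translateL2_toL2 (a : Fin d → ℝ) (φ : SmoothTest d) :
    translateL2 a (toL2 d φ) = toL2 d (φ.translate a) := rfl

theorem translateL2_translateL2 (a b : Fin d → ℝ) (u : L2Space d) :
    translateL2 a (translateL2 b u) = translateL2 (a + b) u := by
  refine Lp.ext ?_
  filter_upwards [coeFn_translateL2 a (translateL2 b u), coeFn_translateL2 (a + b) u,
    (measurePreserving_add_right (volume : Measure (Fin d → ℝ)) a).quasiMeasurePreserving.ae
      (coeFn_translateL2 b u)] with x h1 h2 h3
  rw [h1, h2, h3, add_assoc]

theorem translateL2_zero (u : L2Space d) : translateL2 0 u = u := by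
  refine Lp.ext ?_
  filter_upwards [coeFn_translateL2 0 u] with x h1
  rw [h1, add_zero]

theorem inner_translateL2 (a : Fin d → ℝ) (u v : L2Space d) :
    inner ℝ (translateL2 a u) v = inner ℝ u (translateL2 (-a) v) := by
  rw [← LinearIsometry.inner_map_map (translateL2 a) u, translateL2_translateL2, add_neg_cancel,
    translateL2_zero]

theorem continuous_translateL2 (u : L2Space d) : Continuous fun a => translateL2 a u := by
  have h : Continuous fun a : Fin d → ℝ => (⟨fun x => x + a, by fun_prop⟩ : C(Fin d → ℝ, Fin d → ℝ)) :=
    ContinuousMap.continuous_of_continuous_uncurry _ (by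
      change Continuous fun p : (Fin d → ℝ) × (Fin d → ℝ) => p.2 + p.1
      fun_prop)
  exact continuous_const.compMeasurePreservingLp h
    (fun a => measurePreserving_add_right volume a) (by norm_num)

theorem IsWeakPartial.translateL2 {u g : L2Space d} (h : IsWeakPartial i u g) (a : Fin d → ℝ) :
    IsWeakPartial i (translateL2 a u) (translateL2 a g) :=
  isWeakPartial_iff.2 fun φ : SmoothTest d => by
    rw [inner_translateL2, inner_translateL2, translateL2_toL2, translateL2_toL2,
      ← partialDeriv_translate, isWeakPartial_iff.1 h]

/-- The partial derivatives of test functions are the derivatives in `L²` along translations. -/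
theorem hasDerivAt_translateL2 (φ : SmoothTest d) (i : Fin d) (t : ℝ) :
    HasDerivAt (fun t : ℝ => translateL2 (Pi.single i t) (toL2 d φ))
      (translateL2 (Pi.single i t) (toL2 d (partialDeriv i φ))) t := by
  have h0 : HasDerivAt (fun t : ℝ => translateL2 (Pi.single i t) (toL2 d φ))
      (toL2 d (partialDeriv i φ)) 0 := by
    set ψ := partialDeriv i φ
    obtain ⟨C, hC⟩ := ContDiff.lipschitzWith_of_hasCompactSupport (𝕂 := ℝ) ψ.hasCompactSupport
      ψ.contDiff (by simp)
    have hLip : ∀ x, ∀ r : ℝ, |ψ.1 (x + Pi.single i r) - ψ.1 x| ≤ C * |r| := fun x r => by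
      have := hC.dist_le_mul (x + Pi.single i r) x
      rwa [Real.dist_eq, dist_eq_norm, add_sub_cancel_left, Pi.norm_single, Real.norm_eq_abs]
        at this
    -- a second order Taylor estimate, uniform in `x`
    have hT : ∀ x, ∀ t : ℝ, |φ.1 (x + Pi.single i t) - φ.1 x - t * ψ.1 x| ≤ C * |t| * |t| := by
      intro x t
      have hd : ∀ r ∈ uIcc 0 t, HasDerivWithinAt (fun r : ℝ => φ.1 (x + Pi.single i r) - r * ψ.1 x)
          (ψ.1 (x + Pi.single i r) - ψ.1 x) (uIcc 0 t) r := fun r _ => by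
        have := (φ.hasDerivAt i x r).sub ((hasDerivAt_id r).mul_const (ψ.1 x))
        rw [one_mul] at this
        exact this.hasDerivWithinAt
      have hb : ∀ r ∈ uIcc 0 t, ‖ψ.1 (x + Pi.single i r) - ψ.1 x‖ ≤ C * |t| := fun r hr => by
        refine (hLip x r).trans (mul_le_mul_of_nonneg_left ?_ C.2)
        have := abs_sub_left_of_mem_uIcc hr
        simpa using this
      have := (convex_uIcc (0 : ℝ) t).norm_image_sub_le_of_norm_hasDerivWithin_le hd hb
        left_mem_uIcc right_mem_uIcc
      simp only [Pi.single_zero, add_zero, zero_mul, sub_zero, Real.norm_eq_abs] at this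
      convert this using 2
      ring
    obtain ⟨R, hR⟩ := φ.hasCompactSupport.isBounded.subset_closedBall (0 : Fin d → ℝ)
    obtain ⟨R', hR'⟩ := ψ.hasCompactSupport.isBounded.subset_closedBall (0 : Fin d → ℝ)
    set K : Set (Fin d → ℝ) := Metric.closedBall 0 (max R R' + 1)
    have hK : IsCompact K := isCompact_closedBall _ _
    set M := (volume K ^ (1 / (2 : ℝ))).toReal
    have hM : 0 ≤ M := ENNReal.toReal_nonneg
    rw [hasDerivAt_iff_isLittleO_nhds_zero, Asymptotics.isLittleO_iff]
    intro c hc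
    have hev : ∀ᶠ t : ℝ in 𝓝 0, |t| < min 1 (c / (C * M + 1)) :=
      (continuous_abs.tendsto' (0 : ℝ) 0 abs_zero).eventually_lt_const (by positivity)
    filter_upwards [hev] with t ht
    rw [lt_min_iff, lt_div_iff₀ (by positivity)] at ht
    rw [zero_add, Pi.single_zero, translateL2_zero, translateL2_toL2, ← map_sub, ← map_smul]
    refine (dist_toLp_le hK hK.measure_lt_top.ne (c := C * |t| * |t|) (by positivity)
      (memLp _) (memLp _) ?_ ?_ (hT · t)).trans ?_
    · intro x hx
      rw [mem_closedBall_zero_iff]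
      by_contra hcon
      rw [not_le] at hcon
      have h1 : φ.1 x = 0 := by
        by_contra h
        have := mem_closedBall_zero_iff.1 (hR (subset_tsupport _ h))
        linarith [le_max_left R R']
      have h2 : φ.1 (x + Pi.single i t) = 0 := by
        by_contra h
        have := mem_closedBall_zero_iff.1 (hR (subset_tsupport _ h))
        have h3 := norm_sub_le (x + Pi.single i t) (Pi.single i t)
        rw [add_sub_cancel_right, Pi.norm_single, Real.norm_eq_abs] at h3
        linarith [le_max_left R R']
      exact hx (by change φ.1 (x + Pi.single i t) - φ.1 x = 0; rw [h1, h2, sub_zero])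
    · intro x hx
      rw [mem_closedBall_zero_iff]
      have h1 : ψ.1 x ≠ 0 := fun h => hx (by change t * ψ.1 x = 0; rw [h, mul_zero])
      have := mem_closedBall_zero_iff.1 (hR' (subset_tsupport _ h1))
      linarith [le_max_right R R']
    · rw [Real.norm_eq_abs]
      nlinarith [abs_nonneg t, mul_nonneg C.2 hM]
  have h1 : HasDerivAt (fun r : ℝ => translateL2 (Pi.single i r) (toL2 d φ))
      (toL2 d (partialDeriv i φ)) (t - t) := by rwa [sub_self]
  have h2 := (translateL2 (Pi.single i t)).toContinuousLinearMap.hasFDerivAt.comp_hasDerivAt t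
    (HasDerivAt.comp_sub_const t t h1)
  refine h2.congr_of_eventuallyEq (Eventually.of_forall fun r => ?_)
  change _ = translateL2 (Pi.single i t) (translateL2 (Pi.single i (r - t)) (toL2 d φ))
  rw [translateL2_translateL2, ← Pi.single_add, add_sub_cancel]

theorem IsWeakPartial.norm_translateL2_sub_le {u g : L2Space d} (h : IsWeakPartial i u g) (t : ℝ) :
    ‖_root_.translateL2 (Pi.single i t) u - u‖ ≤ ‖g‖ * |t| := by
  have key : ∀ φ : SmoothTest d, |inner ℝ (_root_.translateL2 (Pi.single i t) u - u) (toL2 d φ)| ≤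
      ‖g‖ * |t| * ‖toL2 d φ‖ := by
    intro φ
    have hd : ∀ r ∈ (univ : Set ℝ), HasDerivWithinAt
        (fun r : ℝ => inner ℝ u (_root_.translateL2 (Pi.single i r) (toL2 d φ)))
        (-inner ℝ g (_root_.translateL2 (Pi.single i r) (toL2 d φ))) univ r := fun r _ => by
      have h1 := (hasDerivAt_const r u).inner ℝ (hasDerivAt_translateL2 φ i r)
      rw [inner_zero_left, add_zero, translateL2_toL2, ← partialDeriv_translate,
        isWeakPartial_iff.1 h, ← translateL2_toL2] at h1
      exact h1.hasDerivWithinAt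
    have hb : ∀ r ∈ (univ : Set ℝ),
        ‖-inner ℝ g (_root_.translateL2 (Pi.single i r) (toL2 d φ))‖ ≤ ‖g‖ * ‖toL2 d φ‖ :=
      fun r _ => by
        rw [norm_neg, Real.norm_eq_abs]
        refine (abs_real_inner_le_norm _ _).trans ?_
        rw [LinearIsometry.norm_map]
    have := convex_univ.norm_image_sub_le_of_norm_hasDerivWithin_le hd hb (mem_univ 0)
      (mem_univ (-t))
    rw [Pi.single_zero, translateL2_zero, sub_zero, Pi.single_neg, ← inner_translateL2,
      ← inner_sub_left, Real.norm_eq_abs, norm_neg, Real.norm_eq_abs] at this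
    linarith
  have key' : ∀ v : L2Space d, |inner ℝ (_root_.translateL2 (Pi.single i t) u - u) v| ≤
      ‖g‖ * |t| * ‖v‖ := fun v =>
    (denseRange_toL2 d).induction_on (p := fun v : L2Space d =>
        |inner ℝ (_root_.translateL2 (Pi.single i t) u - u) v| ≤ ‖g‖ * |t| * ‖v‖) v
      (isClosed_le (by fun_prop) (by fun_prop)) key
  set w := _root_.translateL2 (Pi.single i t) u - u
  have h2 := key' w
  rw [real_inner_self_eq_norm_sq, abs_of_nonneg (sq_nonneg _)] at h2
  by_contra hcon
  rw [not_le] at hcon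
  have hw : 0 < ‖w‖ := (by positivity : 0 ≤ ‖g‖ * |t|).trans_lt hcon
  nlinarith

/-- A function whose translations depend on the `i`-th coordinate in a Lipschitz way has a weak
`i`-th partial derivative: `φ ↦ (u, ∂ᵢφ)` is a bounded functional, hence represented by a vector. -/
theorem exists_isWeakPartial_of_norm_translateL2_sub_le {u : L2Space d} {C : ℝ} (hC : 0 ≤ C)
    (h : ∀ t : ℝ, ‖translateL2 (Pi.single i t) u - u‖ ≤ C * |t|) :
    ∃ g : L2Space d, IsWeakPartial i u g ∧ ‖g‖ ≤ C := by
  have hb : ∀ φ : SmoothTest d, ‖inner ℝ u (toL2 d (partialDeriv i φ))‖ ≤ C * ‖toL2 d φ‖ := by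
    intro φ
    have h1 := (hasDerivAt_const (0 : ℝ) u).inner ℝ (hasDerivAt_translateL2 φ i 0)
    rw [inner_zero_left, add_zero, Pi.single_zero, translateL2_zero] at h1
    have h2 := (hasDerivAt_iff_tendsto_slope.1 h1).norm
    refine le_of_tendsto h2 ?_
    filter_upwards [self_mem_nhdsWithin] with t ht
    have ht' : t ≠ 0 := ht
    rw [slope_def_field, Pi.single_zero, translateL2_zero, sub_zero, norm_div,
      div_le_iff₀ (norm_pos_iff.2 ht')]
    have e : inner ℝ u (translateL2 (Pi.single i t) (toL2 d φ)) - inner ℝ u (toL2 d φ) =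
        inner ℝ (translateL2 (Pi.single i (-t)) u - u) (toL2 d φ) := by
      rw [inner_sub_left, inner_translateL2, ← Pi.single_neg, neg_neg]
    rw [e, Real.norm_eq_abs, Real.norm_eq_abs]
    refine (abs_real_inner_le_norm _ _).trans ?_
    have := mul_le_mul_of_nonneg_right (h (-t)) (norm_nonneg (toL2 d φ))
    rw [abs_neg] at this
    linarith
  let ℓ : SmoothTest d →ₗ[ℝ] ℝ :=
    (innerₛₗ ℝ u).comp ((toL2 d).comp (partialDeriv i))
  set L := ℓ.extendOfNorm (toL2 d)
  have hL : ∀ φ : SmoothTest d, L (toL2 d φ) = ℓ φ := fun φ : SmoothTest d =>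
    LinearMap.extendOfNorm_eq (denseRange_toL2 d) ⟨C, hb⟩ φ
  refine ⟨-(InnerProductSpace.toDual ℝ (L2Space d)).symm L, isWeakPartial_iff.2 fun φ : SmoothTest d => ?_, ?_⟩
  · rw [inner_neg_left, neg_neg, InnerProductSpace.toDual_symm_apply, hL]
    rfl
  · rw [norm_neg, LinearIsometryEquiv.norm_map]
    exact ContinuousLinearMap.opNorm_le_bound _ hC
      (LinearMap.norm_extendOfNorm_apply_le (denseRange_toL2 d) C hb)

/-- Pointwise contractions do not increase the norms of the weak partial derivatives. -/
theorem IsWeakPartial.exists_of_contraction {u v g : L2Space d} (h : IsWeakPartial i u g)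
    {τ : ℝ → ℝ} (hτ : ∀ y z, |τ y - τ z| ≤ |y - z|) (hv : v =ᵐ[volume] fun x => τ (u x)) :
    ∃ k : L2Space d, IsWeakPartial i v k ∧ ‖k‖ ≤ ‖g‖ := by
  refine exists_isWeakPartial_of_norm_translateL2_sub_le (norm_nonneg g) fun t => ?_
  refine le_trans ?_ (h.norm_translateL2_sub_le t)
  refine Lp.norm_le_norm_of_ae_le ?_
  set a : Fin d → ℝ := Pi.single i t
  filter_upwards [coeFn_translateL2 a u, coeFn_translateL2 a v, hv,
    (measurePreserving_add_right (volume : Measure (Fin d → ℝ)) a).quasiMeasurePreserving.ae hv,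
    Lp.coeFn_sub (_root_.translateL2 a u) u, Lp.coeFn_sub (_root_.translateL2 a v) v]
    with x h1 h2 h3 h4 h5 h6
  rw [h5, h6, Pi.sub_apply, Pi.sub_apply, h1, h2, h3, h4]
  exact hτ _ _

open SmoothTest

variable {d : ℕ} {i : Fin d}

/-! ### Regularity of the form of Brownian motion -/

theorem SmoothTest.exists_bound (χ : SmoothTest d) : ∃ C, 0 ≤ C ∧ ∀ x, |χ.1 x| ≤ C := by
  obtain ⟨C, hC⟩ := χ.hasCompactSupport.exists_bound_of_continuous χ.continuous
  exact ⟨C, (norm_nonneg _).trans (hC 0), hC⟩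

theorem SmoothTest.memLp_mul (χ : SmoothTest d) (u : L2Space d) :
    MemLp (fun x => χ.1 x * u x) 2 volume := by
  obtain ⟨C, -, hC⟩ := χ.exists_bound
  refine (Lp.memLp u).of_le_mul (c := C)
    (χ.continuous.aestronglyMeasurable.mul (Lp.aestronglyMeasurable u))
    (Eventually.of_forall fun x => ?_)
  rw [norm_mul]
  exact mul_le_mul_of_nonneg_right (hC x) (norm_nonneg _)

/-- The product of a test function and a square integrable function. -/
def mulL2 (χ : SmoothTest d) (u : L2Space d) : L2Space d := (χ.memLp_mul u).toLp

theorem coeFn_mulL2 (χ : SmoothTest d) (u : L2Space d) :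
    mulL2 χ u =ᵐ[volume] fun x => χ.1 x * u x := MemLp.coeFn_toLp _

theorem inner_mulL2 (χ : SmoothTest d) (u : L2Space d) (φ : SmoothTest d) :
    inner ℝ (mulL2 χ u) (toL2 d φ) = inner ℝ u (toL2 d (χ.mul φ)) := by
  rw [inner_toL2, inner_toL2]
  refine integral_congr_ae ?_
  filter_upwards [coeFn_mulL2 χ u] with x hx
  rw [hx]
  change _ = u x * (χ.1 x * φ.1 x)
  ring

theorem norm_mulL2_le {χ : SmoothTest d} {C : ℝ} (hC : ∀ x, |χ.1 x| ≤ C) (u : L2Space d) :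
    ‖mulL2 χ u‖ ≤ C * ‖u‖ := by
  refine Lp.norm_le_mul_norm_of_ae_le_mul ?_
  filter_upwards [coeFn_mulL2 χ u] with x hx
  rw [hx, norm_mul]
  exact mul_le_mul_of_nonneg_right (hC x) (norm_nonneg _)

theorem IsWeakPartial.mulL2 {u g : L2Space d} (h : IsWeakPartial i u g) (χ : SmoothTest d) :
    IsWeakPartial i (mulL2 χ u) (mulL2 χ g + mulL2 (partialDeriv i χ) u : L2Space d) := by
  refine isWeakPartial_iff.2 fun φ => ?_
  have e : toL2 d (partialDeriv i (χ.mul φ)) =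
      toL2 d (χ.mul (partialDeriv i φ)) + toL2 d ((partialDeriv i χ).mul φ) := by
    rw [← map_add]
    congr 1
    ext x
    rw [partialDeriv_mul, mul_comm (φ.1 x)]
    rfl
  have := isWeakPartial_iff.1 h (χ.mul φ)
  rw [e, inner_add_right] at this
  rw [inner_add_left, inner_mulL2, inner_mulL2, inner_mulL2]
  linarith

/-- Smooth cut-off functions that tend to one, with derivatives that tend to zero uniformly. -/
theorem exists_cutoff_seq (d : ℕ) : ∃ χ : ℕ → SmoothTest d, (∀ n x, 0 ≤ (χ n).1 x ∧ (χ n).1 x ≤ 1) ∧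
    (∀ x, Tendsto (fun n => (χ n).1 x) atTop (𝓝 1)) ∧
    ∃ C, 0 ≤ C ∧ ∀ n i x, |(partialDeriv i (χ n)).1 x| ≤ C * (1 / ((n : ℝ) + 1)) := by
  let b : ContDiffBump (0 : Fin d → ℝ) := ⟨1, 2, one_pos, one_lt_two⟩
  let B : SmoothTest d := ⟨b, b.contDiff, b.hasCompactSupport⟩
  have hpos : ∀ n : ℕ, 0 < 1 / ((n : ℝ) + 1) := fun n => by positivity
  refine ⟨fun n => ⟨fun x => b ((1 / ((n : ℝ) + 1)) • x), b.contDiff.comp (contDiff_const_smul _),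
    b.hasCompactSupport.comp_homeomorph (Homeomorph.smulOfNeZero _ (hpos n).ne')⟩,
    fun n x => ⟨b.nonneg, b.le_one⟩, fun x => ?_, ?_⟩
  · have h1 : Tendsto (fun n : ℕ => (1 / ((n : ℝ) + 1)) • x) atTop (𝓝 0) := by
      simpa using (tendsto_one_div_add_atTop_nhds_zero_nat (𝕜 := ℝ)).smul_const x
    have h2 := (b.continuous.tendsto 0).comp h1
    rwa [b.one_of_mem_closedBall (Metric.mem_closedBall_self b.rIn_pos.le)] at h2
  · choose C hC0 hC using fun i => (partialDeriv i B).exists_bound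
    refine ⟨∑ i, C i, Finset.sum_nonneg fun i _ => hC0 i, fun n i x => ?_⟩
    have e : fderiv ℝ (fun x => b ((1 / ((n : ℝ) + 1)) • x)) x =
        (1 / ((n : ℝ) + 1)) • fderiv ℝ b ((1 / ((n : ℝ) + 1)) • x) := by
      have h1 := (B.differentiable ((1 / ((n : ℝ) + 1)) • x)).hasFDerivAt.comp x
        ((hasFDerivAt_id x).const_smul (1 / ((n : ℝ) + 1)))
      refine h1.fderiv.trans ?_
      ext v
      simp [B]
    change |(fderiv ℝ (fun x => b ((1 / ((n : ℝ) + 1)) • x)) x) (Pi.single i 1)| ≤ _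
    rw [e, smul_apply, smul_eq_mul, abs_mul, abs_of_pos (hpos n), mul_comm]
    refine mul_le_mul_of_nonneg_right ((hC i _).trans ?_) (hpos n).le
    exact Finset.single_le_sum (f := C) (fun i _ => hC0 i) (Finset.mem_univ i)

theorem exists_mulL2_near {u : L2Space d} (hu : u ∈ sobolevH1 d) {ε : ℝ} (hε : 0 < ε) :
    ∃ χ : SmoothTest d, mulL2 χ u ∈ sobolevH1 d ∧ ‖u - mulL2 χ u‖ < ε ∧
      ∀ i, ‖weakPartial i u - weakPartial i (mulL2 χ u)‖ < ε := by
  obtain ⟨χ, h01, hlim, C, hC0, hC⟩ := exists_cutoff_seq d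
  have key : ∀ v : L2Space d, Tendsto (fun n => mulL2 (χ n) v) atTop (𝓝 v) := fun v => by
    have := tendsto_toLp_of_dominated (fun n => (χ n).memLp_mul v) (Lp.memLp v) (fun n x => ?_)
      fun x => by simpa using (hlim x).mul_const (v x)
    · rwa [Lp.toLp_coeFn] at this
    · have e : v x - (χ n).1 x * v x = (1 - (χ n).1 x) * v x := by ring
      rw [e, abs_mul, abs_of_nonneg (sub_nonneg.2 (h01 n x).2)]
      exact mul_le_of_le_one_left (abs_nonneg _) (by linarith [(h01 n x).1])
  have key' : ∀ i, Tendsto (fun n => mulL2 (partialDeriv i (χ n)) u) atTop (𝓝 0) := fun i => by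
    rw [tendsto_zero_iff_norm_tendsto_zero]
    refine squeeze_zero (fun n => norm_nonneg _) (fun n => norm_mulL2_le (hC n i) u) ?_
    simpa using ((tendsto_one_div_add_atTop_nhds_zero_nat (𝕜 := ℝ)).const_mul C).mul_const ‖u‖
  have hw : ∀ n i, IsWeakPartial i (mulL2 (χ n) u)
      (mulL2 (χ n) (weakPartial i u) + mulL2 (partialDeriv i (χ n)) u : L2Space d) := fun n i =>
    (isWeakPartial_weakPartial hu i).mulL2 (χ n)
  have h1 : ∀ᶠ n in atTop, ‖u - mulL2 (χ n) u‖ < ε := by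
    filter_upwards [Metric.tendsto_nhds.1 (key u) ε hε] with n hn
    rwa [dist_comm, dist_eq_norm] at hn
  have h2 : ∀ᶠ n in atTop, ∀ i, ‖weakPartial i u - weakPartial i (mulL2 (χ n) u)‖ < ε := by
    rw [eventually_all]
    intro i
    have h3 := (key (weakPartial i u)).add (key' i)
    rw [add_zero] at h3
    filter_upwards [Metric.tendsto_nhds.1 h3 ε hε] with n hn
    rwa [dist_comm, dist_eq_norm, ← (hw n i).weakPartial_eq] at hn
  obtain ⟨n, hn1, hn2⟩ := (h1.and h2).exists
  exact ⟨χ n, fun i => ⟨_, hw n i⟩, hn1, hn2⟩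

/-- The average of the translations of `u` with the weight `k`, as an integral in `L²(ℝ^d)`.  It is
the convolution of `k` and `u`. -/
def mollify (k : (Fin d → ℝ) → ℝ) (u : L2Space d) : L2Space d :=
  ∫ y, k y • translateL2 (-y) u

theorem integrable_smul_translateL2 {k : (Fin d → ℝ) → ℝ} (hk : Continuous k)
    (hkc : HasCompactSupport k) (u : L2Space d) :
    Integrable fun y => k y • translateL2 (-y) u :=
  Continuous.integrable_of_hasCompactSupport
    (hk.smul ((continuous_translateL2 u).comp continuous_neg)) (hkc.smul_right)

theorem inner_mollify {k : (Fin d → ℝ) → ℝ} (hk : Continuous k) (hkc : HasCompactSupport k)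
    (u v : L2Space d) : inner ℝ (mollify k u) v = ∫ y, k y * inner ℝ (translateL2 (-y) u) v := by
  rw [real_inner_comm, mollify, ← integral_inner (integrable_smul_translateL2 hk hkc u)]
  refine integral_congr_ae (Eventually.of_forall fun y => ?_)
  simp only [real_inner_smul_right, real_inner_comm v]

theorem IsWeakPartial.mollify {u g : L2Space d} (h : IsWeakPartial i u g)
    {k : (Fin d → ℝ) → ℝ} (hk : Continuous k) (hkc : HasCompactSupport k) :
    IsWeakPartial i (mollify k u) (mollify k g) := by
  refine isWeakPartial_iff.2 fun φ => ?_
  rw [inner_mollify hk hkc, inner_mollify hk hkc, ← integral_neg]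
  refine integral_congr_ae (Eventually.of_forall fun y => ?_)
  change _ * _ = -(_ * _)
  rw [isWeakPartial_iff.1 (h.translateL2 (-y)), mul_neg]

theorem norm_sub_mollify_le {k : (Fin d → ℝ) → ℝ} (hk : Continuous k) (hkc : HasCompactSupport k)
    (hk0 : ∀ y, 0 ≤ k y) (hk1 : ∫ y, k y = 1) {u : L2Space d} {δ : ℝ}
    (h : ∀ y, k y ≠ 0 → ‖u - translateL2 (-y) u‖ ≤ δ) : ‖u - mollify k u‖ ≤ δ := by
  have hint : Integrable k := hk.integrable_of_hasCompactSupport hkc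
  have e : u - mollify k u = ∫ y, k y • (u - translateL2 (-y) u) := by
    simp only [smul_sub]
    rw [integral_sub (hint.smul_const u) (integrable_smul_translateL2 hk hkc u),
      integral_smul_const, hk1, one_smul, mollify]
  rw [e]
  refine (norm_integral_le_of_norm_le (hint.mul_const δ) (Eventually.of_forall fun y => ?_)).trans
    (by rw [integral_mul_const, hk1, one_mul])
  rw [norm_smul, Real.norm_eq_abs, abs_of_nonneg (hk0 y)]
  rcases eq_or_ne (k y) 0 with h0 | h0
  · simp [h0]
  · exact mul_le_mul_of_nonneg_left (h y h0) (hk0 y)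

theorem coeFn_mollify {k : (Fin d → ℝ) → ℝ} (hk : Continuous k) (hkc : HasCompactSupport k)
    {u : L2Space d} {f : (Fin d → ℝ) → ℝ} (hu : u =ᵐ[volume] f) (hf : Integrable f) :
    mollify k u =ᵐ[volume] convolution k f (ContinuousLinearMap.mul ℝ ℝ) volume := by
  have hkint : Integrable k := hk.integrable_of_hasCompactSupport hkc
  refine ae_eq_of_integral_contDiff_smul_eq (Lp.locallyIntegrable _)
    (hkint.integrable_convolution _ hf).locallyIntegrable fun φ hφ hφc => ?_
  let φ' : SmoothTest d := ⟨φ, hφ, hφc⟩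
  have h1 : ∫ x, φ x • mollify k u x = inner ℝ (mollify k u) (toL2 d φ') := by
    rw [inner_toL2]
    exact integral_congr_ae (Eventually.of_forall fun x => mul_comm _ _)
  have h2 : ∀ y, inner ℝ (translateL2 (-y) u) (toL2 d φ') = ∫ x, φ x * f (x - y) := fun y => by
    rw [inner_toL2]
    refine integral_congr_ae ?_
    filter_upwards [coeFn_translateL2 (-y) u, (measurePreserving_add_right
      (volume : Measure (Fin d → ℝ)) (-y)).quasiMeasurePreserving.ae hu] with x h3 h4
    rw [h3, h4, mul_comm, sub_eq_add_neg]
  obtain ⟨C, -, hC⟩ := φ'.exists_bound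
  have hprod : Integrable (fun p : (Fin d → ℝ) × (Fin d → ℝ) => φ p.1 * (k p.2 * f (p.1 - p.2)))
      (volume.prod volume) :=
    (Integrable.convolution_integrand (ContinuousLinearMap.mul ℝ ℝ) hkint hf).bdd_mul
      (hφ.continuous.comp continuous_fst).aestronglyMeasurable
      (Eventually.of_forall fun p => hC p.1)
  rw [h1, inner_mollify hk hkc]
  simp only [h2, convolution_def, ContinuousLinearMap.mul_apply', smul_eq_mul,
    ← integral_const_mul]
  rw [integral_integral_swap]
  · refine integral_congr_ae (Eventually.of_forall fun x => ?_)
    exact integral_congr_ae (Eventually.of_forall fun y => by change _ * _ = _ * _; ring)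
  · refine hprod.swap.congr (Eventually.of_forall fun p => ?_)
    simp only [Function.comp, Prod.fst_swap, Prod.snd_swap, Function.uncurry]
    ring

theorem exists_compactlySupported_near {u : L2Space d} (hu : u ∈ sobolevH1 d) {ε : ℝ}
    (hε : 0 < ε) : ∃ f ∈ (brownianForm d).compactlySupported, ∃ v ∈ sobolevH1 d, v =ᵐ[volume] f ∧
      ‖u - v‖ < ε ∧ ∀ i, ‖weakPartial i u - weakPartial i v‖ < ε := by
  obtain ⟨χ, hw, hwu, hwi⟩ := exists_mulL2_near hu (show 0 < ε / 4 by positivity)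
  set w := mulL2 χ u
  have hev : ∀ v : L2Space d, ∀ᶠ y in 𝓝 (0 : Fin d → ℝ), ‖v - translateL2 (-y) v‖ < ε / 4 :=
    fun v => by
      have h : Tendsto (fun y => ‖v - translateL2 (-y) v‖) (𝓝 0) (𝓝 0) := by
        have := ((continuous_const (y := v)).sub
          ((continuous_translateL2 v).comp continuous_neg)).norm.tendsto (0 : Fin d → ℝ)
        simpa [translateL2_zero] using this
      exact h.eventually_lt_const (by positivity)
  obtain ⟨r, hr, hball⟩ := Metric.eventually_nhds_iff_ball.1
    ((hev w).and (eventually_all.2 fun i => hev (weakPartial i w)))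
  let b : ContDiffBump (0 : Fin d → ℝ) := ⟨r / 2, r, by positivity, by linarith⟩
  set k := b.normed volume
  have hk : Continuous k := b.continuous_normed
  have hkc : HasCompactSupport k := b.hasCompactSupport_normed
  have hk0 : ∀ y, k y ≠ 0 → y ∈ Metric.ball (0 : Fin d → ℝ) r := fun y hy => by
    have : y ∈ Function.support k := hy
    rwa [b.support_normed_eq] at this
  have hwk : ∀ i, IsWeakPartial i (mollify k w) (mollify k (weakPartial i w)) := fun i =>
    (isWeakPartial_weakPartial hw i).mollify hk hkc
  have hmem : mollify k w ∈ sobolevH1 d := fun i => ⟨_, hwk i⟩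
  have hfc : HasCompactSupport fun x => χ.1 x * u x := χ.hasCompactSupport.mul_right
  have hfi : Integrable fun x => χ.1 x * u x := by
    rw [← integrableOn_iff_integrable_of_support_subset (subset_tsupport _)]
    exact ((χ.memLp_mul u).locallyIntegrable (by norm_num)).integrableOn_isCompact hfc
  have hco := coeFn_mollify hk hkc (coeFn_mulL2 χ u) hfi
  refine ⟨_, ⟨?_, ?_, _, hmem, hco⟩, _, hmem, hco, ?_, fun i => ?_⟩
  · exact hkc.continuous_convolution_left _ hk hfi.locallyIntegrable
  · exact hkc.convolution _ hfc
  · have h1 := norm_sub_mollify_le hk hkc b.nonneg_normed b.integral_normed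
      (fun y hy => (hball y (hk0 y hy)).1.le)
    linarith [norm_sub_le_norm_sub_add_norm_sub u w (mollify k w)]
  · have h1 := norm_sub_mollify_le hk hkc b.nonneg_normed b.integral_normed
      (fun y hy => ((hball y (hk0 y hy)).2 i).le)
    rw [(hwk i).weakPartial_eq]
    linarith [hwi i, norm_sub_le_norm_sub_add_norm_sub (weakPartial i u) (weakPartial i w)
      (mollify k (weakPartial i w))]

theorem weakPartial_add {u v : L2Space d} (hu : u ∈ sobolevH1 d) (hv : v ∈ sobolevH1 d)
    (i : Fin d) : weakPartial i (u + v) = weakPartial i u + weakPartial i v :=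
  ((isWeakPartial_weakPartial hu i).add (isWeakPartial_weakPartial hv i)).weakPartial_eq

theorem weakPartial_sub {u v : L2Space d} (hu : u ∈ sobolevH1 d) (hv : v ∈ sobolevH1 d)
    (i : Fin d) : weakPartial i (u - v) = weakPartial i u - weakPartial i v :=
  ((isWeakPartial_weakPartial hu i).sub (isWeakPartial_weakPartial hv i)).weakPartial_eq

theorem weakPartial_smul {u : L2Space d} (c : ℝ) (hu : u ∈ sobolevH1 d) (i : Fin d) :
    weakPartial i (c • u) = c • weakPartial i u :=
  ((isWeakPartial_weakPartial hu i).smul c).weakPartial_eq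

theorem sobolevH1_add {u v : L2Space d} (hu : u ∈ sobolevH1 d) (hv : v ∈ sobolevH1 d) :
    u + v ∈ sobolevH1 d := fun i =>
  ⟨_, (isWeakPartial_weakPartial hu i).add (isWeakPartial_weakPartial hv i)⟩

theorem sobolevH1_sub {u v : L2Space d} (hu : u ∈ sobolevH1 d) (hv : v ∈ sobolevH1 d) :
    u - v ∈ sobolevH1 d := fun i =>
  ⟨_, (isWeakPartial_weakPartial hu i).sub (isWeakPartial_weakPartial hv i)⟩

theorem sobolevH1_smul {u : L2Space d} (c : ℝ) (hu : u ∈ sobolevH1 d) : c • u ∈ sobolevH1 d :=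
  fun i => ⟨_, (isWeakPartial_weakPartial hu i).smul c⟩

theorem brownianForm_add_left {u v w : L2Space d} (hu : u ∈ sobolevH1 d) (hv : v ∈ sobolevH1 d) :
    (brownianForm d).form (u + v) w = (brownianForm d).form u w + (brownianForm d).form v w := by
  simp only [brownianForm_form, weakPartial_add hu hv, inner_add_left, Finset.sum_add_distrib,
    mul_add]

theorem brownianForm_smul_left (c : ℝ) {u w : L2Space d} (hu : u ∈ sobolevH1 d) :
    (brownianForm d).form (c • u) w = c * (brownianForm d).form u w := by
  simp only [brownianForm_form, weakPartial_smul c hu, real_inner_smul_left, ← Finset.mul_sum]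
  ring

theorem brownianForm_comm (u v : L2Space d) :
    (brownianForm d).form u v = (brownianForm d).form v u := by
  simp only [brownianForm_form, real_inner_comm]

theorem brownianForm_nonneg (u : L2Space d) : 0 ≤ (brownianForm d).form u u := by
  rw [brownianForm_self]; positivity

/-- Completeness of `H¹(ℝ^d)`. -/
theorem exists_tendsto_sobolevH1 {u : ℕ → L2Space d} (hu : ∀ n, u n ∈ sobolevH1 d)
    (hc : ∀ ε > 0, ∃ N, ∀ k ≥ N, ∀ l ≥ N, (brownianForm d).form1 (u k - u l) (u k - u l) < ε) :
    ∃ w ∈ sobolevH1 d, Tendsto u atTop (𝓝 w) ∧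
      ∀ i, Tendsto (fun n => weakPartial i (u n)) atTop (𝓝 (weakPartial i w)) := by
  have hform : ∀ k l, (brownianForm d).form1 (u k - u l) (u k - u l) =
      (1 / 2) * ∑ i, ‖weakPartial i (u k) - weakPartial i (u l)‖ ^ 2 + ‖u k - u l‖ ^ 2 := by
    intro k l
    rw [L2Form.form1, brownianForm_self, real_inner_self_eq_norm_sq]
    simp only [weakPartial_sub (hu k) (hu l)]
  have hC1 : CauchySeq u := by
    rw [Metric.cauchySeq_iff]
    intro ε hε
    obtain ⟨N, hN⟩ := hc (ε ^ 2) (by positivity)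
    refine ⟨N, fun k hk l hl => ?_⟩
    have h := hN k hk l hl
    rw [hform] at h
    rw [dist_eq_norm]
    refine lt_of_pow_lt_pow_left₀ 2 hε.le (lt_of_le_of_lt ?_ h)
    have : 0 ≤ (1 / 2) * ∑ i, ‖weakPartial i (u k) - weakPartial i (u l)‖ ^ 2 := by positivity
    linarith
  have hC2 : ∀ i, CauchySeq fun n => weakPartial i (u n) := fun i => by
    rw [Metric.cauchySeq_iff]
    intro ε hε
    obtain ⟨N, hN⟩ := hc (ε ^ 2 / 2) (by positivity)
    refine ⟨N, fun k hk l hl => ?_⟩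
    have h := hN k hk l hl
    rw [hform] at h
    rw [dist_eq_norm]
    refine lt_of_pow_lt_pow_left₀ 2 hε.le ?_
    have := Finset.single_le_sum (f := fun i => ‖weakPartial i (u k) - weakPartial i (u l)‖ ^ 2)
      (fun i _ => sq_nonneg _) (Finset.mem_univ i)
    nlinarith [sq_nonneg ‖u k - u l‖]
  obtain ⟨w, hw⟩ := cauchySeq_tendsto_of_complete hC1
  choose g hg using fun i => cauchySeq_tendsto_of_complete (hC2 i)
  have hwg : ∀ i, IsWeakPartial i w (g i) := fun i =>
    IsWeakPartial.of_tendsto (fun n => isWeakPartial_weakPartial (hu n) i) hw (hg i)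
  refine ⟨w, fun i => ⟨_, hwg i⟩, hw, fun i => ?_⟩
  rw [(hwg i).weakPartial_eq]
  exact hg i

theorem tendsto_form1_sub {u : ℕ → L2Space d} (hu : ∀ n, u n ∈ sobolevH1 d) {w : L2Space d}
    (hw : w ∈ sobolevH1 d) (h : Tendsto u atTop (𝓝 w))
    (h' : ∀ i, Tendsto (fun n => weakPartial i (u n)) atTop (𝓝 (weakPartial i w))) :
    Tendsto (fun n => (brownianForm d).form1 (u n - w) (u n - w)) atTop (𝓝 0) := by
  simp only [L2Form.form1, brownianForm_self, real_inner_self_eq_norm_sq,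
    weakPartial_sub (hu _) hw]
  have h1 := (((tendsto_finsetSum Finset.univ fun i _ =>
    (((h' i).sub_const (weakPartial i w)).norm.pow 2)).const_mul (1 / 2)).add
    ((h.sub_const w).norm.pow 2))
  simpa using h1

theorem abs_unitContraction_sub_le (y z : ℝ) :
    |min (max y 0) 1 - min (max z 0) 1| ≤ |y - z| := by
  refine (abs_min_sub_min_le_max _ _ _ _).trans (max_le ?_ (by simp))
  refine (abs_max_sub_max_le_max _ _ _ _).trans (max_le le_rfl (by simp))

theorem isDirichletForm_brownianForm (d : ℕ) : (brownianForm d).IsDirichletForm where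
  zero_mem := fun i => ⟨0, IsWeakPartial.zero⟩
  add_mem _ hu _ hv := sobolevH1_add hu hv
  smul_mem c _ hu := sobolevH1_smul c hu
  dense := (denseRange_toL2 d).mono (by rintro _ ⟨φ, rfl⟩; exact toL2_mem_sobolevH1 φ)
  add_left _ hu _ hv _ _ := brownianForm_add_left hu hv
  smul_left c _ hu _ _ := brownianForm_smul_left c hu
  symm u _ v _ := brownianForm_comm u v
  nonneg u _ := brownianForm_nonneg u
  closed u hu hc := by
    obtain ⟨w, hw, h, h'⟩ := exists_tendsto_sobolevH1 hu hc
    exact ⟨w, hw, tendsto_form1_sub hu hw h h'⟩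
  markov u hu v hv := by
    choose k hk hkle using fun i =>
      (isWeakPartial_weakPartial hu i).exists_of_contraction abs_unitContraction_sub_le hv
    refine ⟨fun i => ⟨k i, hk i⟩, ?_⟩
    rw [brownianForm_self, brownianForm_self]
    refine mul_le_mul_of_nonneg_left (Finset.sum_le_sum fun i _ => ?_) (by norm_num)
    rw [(hk i).weakPartial_eq]
    exact pow_le_pow_left₀ (norm_nonneg _) (hkle i) 2

theorem isRegularDirichletForm_brownianForm (d : ℕ) :
    (brownianForm d).IsRegularDirichletForm := by
  refine ⟨isDirichletForm_brownianForm d, Subset.rfl, fun u hu ε hε => ?_, fun g hg hgc ε hε => ?_⟩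
  · have hd : (0 : ℝ) ≤ d := d.cast_nonneg
    set δ := min 1 (ε / (d + 2))
    have hδ : 0 < δ := by positivity
    obtain ⟨f, hf, v, hv, hvf, h1, h2⟩ := exists_compactlySupported_near hu hδ
    refine ⟨f, hf, v, hv, hvf, ?_⟩
    rw [L2Form.form1, brownianForm_self, real_inner_self_eq_norm_sq]
    have hsq : ∀ a : L2Space d, ‖a‖ < δ → ‖a‖ ^ 2 ≤ δ := fun a ha => by
      have : δ ≤ 1 := min_le_left _ _
      nlinarith [norm_nonneg a]
    have h3 : ∑ i, ‖weakPartial i (u - v)‖ ^ 2 ≤ d * δ := by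
      refine (Finset.sum_le_sum fun i _ => ?_).trans_eq (b := ∑ _i : Fin d, δ) (by simp)
      rw [weakPartial_sub hu hv]
      exact hsq _ (h2 i)
    have h4 : δ * (d + 2) ≤ ε := (le_div_iff₀ (by positivity)).1 (min_le_right _ _)
    nlinarith [hsq _ h1, mul_nonneg hd hδ.le]
  · obtain ⟨f, hf, hfg, hsupp⟩ := hg.exists_contDiff_approx ⊤ (ε := fun _ => ε) (by fun_prop)
      fun _ => hε
    let φ : SmoothTest d := ⟨f, hf, hgc.mono hsupp⟩
    refine ⟨f, ⟨φ.continuous, φ.hasCompactSupport, _, toL2_mem_sobolevH1 φ, coeFn_toL2 φ⟩,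
      fun x => ?_⟩
    rw [abs_sub_comm]
    exact hfg x

open SmoothTest

/-! ### Tensor products in `H¹(ℝ^d)` -/

/-- Fubini's theorem on `ℝ^{n+1}`, integrating over the `k`-th coordinate first. -/
theorem integral_insertNth {n : ℕ} (k : Fin (n + 1)) {G : (Fin (n + 1) → ℝ) → ℝ}
    (hG : Integrable G) : ∫ x, G x = ∫ y : Fin n → ℝ, ∫ a : ℝ, G (k.insertNth a y) := by
  have hmp := (volume_preserving_piFinSuccAbove (fun _ : Fin (n + 1) => ℝ) k).symm
  have h1 : Integrable (fun p : ℝ × (Fin n → ℝ) => G (k.insertNth p.1 p.2)) (volume.prod volume) :=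
    (hmp.integrable_comp_emb (MeasurableEquiv.measurableEmbedding _)).2 hG
  rw [← integral_prod_symm (fun p : ℝ × (Fin n → ℝ) => G (k.insertNth p.1 p.2)) h1]
  exact (hmp.integral_comp (MeasurableEquiv.measurableEmbedding _) G).symm

theorem insertNth_eq_add_single {n : ℕ} (k : Fin (n + 1)) (a : ℝ) (y : Fin n → ℝ) :
    (k.insertNth a y : Fin (n + 1) → ℝ) = k.insertNth 0 y + Pi.single k a := by
  ext j
  refine Fin.succAboveCases k ?_ (fun j => ?_) j <;> simp

/-- Integration by parts on a line parallel to a coordinate axis. -/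
theorem HasWeakDeriv.integral_line {u g : ℝ → ℝ} (h : HasWeakDeriv u g) {d : ℕ}
    (φ : SmoothTest d) (k : Fin d) (x : Fin d → ℝ) :
    ∫ a, u a * (partialDeriv k φ).1 (x + Pi.single k a) =
      -∫ a, g a * φ.1 (x + Pi.single k a) := by
  have hiso : Isometry fun a : ℝ => x + Pi.single k a := Isometry.of_dist_eq fun a b => by
    rw [dist_add_left, dist_eq_norm, ← Pi.single_sub, Pi.norm_single, dist_eq_norm]
  have hlin : ContDiff ℝ (⊤ : ℕ∞) fun a : ℝ => x + Pi.single k a :=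
    contDiff_const.add (ContinuousLinearMap.single ℝ (fun _ : Fin d => ℝ) k).contDiff
  have := h (fun a => φ.1 (x + Pi.single k a)) (φ.contDiff.comp hlin)
    (φ.hasCompactSupport.comp_isClosedEmbedding hiso.isClosedEmbedding)
  simpa only [(φ.hasDerivAt k x _).deriv] using this

variable {d : ℕ}

theorem prod_update_mul {u : Fin d → ℝ → ℝ} {k : Fin d} (a : ℝ → ℝ) (x : Fin d → ℝ) :
    ∏ i, Function.update u k a i (x i) = a (x k) * ∏ i ∈ Finset.univ.erase k, u i (x i) := by
  rw [← Finset.mul_prod_erase _ _ (Finset.mem_univ k), Function.update_self]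
  congr 1
  refine Finset.prod_congr rfl fun i hi => ?_
  rw [Function.update_of_ne (Finset.ne_of_mem_erase hi)]

/-- The `k`-th weak partial derivative of a tensor product is obtained by differentiating the
`k`-th factor. -/
theorem isWeakPartial_tensorLp (f : Fin d → Lp ℝ 2 (volume : Measure ℝ)) (k : Fin d)
    {g : Lp ℝ 2 (volume : Measure ℝ)} (h : HasWeakDeriv (f k) g) :
    IsWeakPartial k (tensorLp f) (tensorLp (Function.update f k g)) := by
  rcases d with _ | n
  · exact k.elim0
  refine isWeakPartial_iff.2 fun φ => ?_
  have key : ∀ (c : Fin (n + 1) → Lp ℝ 2 (volume : Measure ℝ)) (ψ : SmoothTest (n + 1)),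
      inner ℝ (tensorLp c) (toL2 (n + 1) ψ) = ∫ y : Fin n → ℝ,
        (∏ j, c (k.succAbove j) (y j)) *
          ∫ a, c k a * ψ.1 (k.insertNth 0 y + Pi.single k a) := by
    intro c ψ
    have e : (fun x => tensorLp c x * ψ.1 x) =ᵐ[volume] fun x => (∏ i, c i (x i)) * ψ.1 x := by
      filter_upwards [coeFn_tensorLp c] with x hx
      rw [hx]
    have hint : Integrable fun x => (∏ i, c i (x i)) * ψ.1 x :=
      (memLp_tensor fun i => Lp.memLp (c i)).integrable_mul ψ.memLp
    rw [inner_toL2, integral_congr_ae e, integral_insertNth k hint]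
    refine integral_congr_ae (Eventually.of_forall fun y => ?_)
    beta_reduce
    rw [← integral_const_mul]
    refine integral_congr_ae (Eventually.of_forall fun a => ?_)
    simp only [Fin.prod_univ_succAbove _ k, Fin.insertNth_apply_same,
      Fin.insertNth_apply_succAbove, ← insertNth_eq_add_single]
    ring
  rw [key, key, ← integral_neg]
  refine integral_congr_ae (Eventually.of_forall fun y => ?_)
  simp only [Function.update_self, h.integral_line, Function.update_of_ne (Fin.succAbove_ne k _)]
  ring

theorem inner_tensorLp_update (f g : Fin d → Lp ℝ 2 (volume : Measure ℝ)) (k : Fin d)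
    (a b : Lp ℝ 2 (volume : Measure ℝ)) :
    inner ℝ (tensorLp (Function.update f k a)) (tensorLp (Function.update g k b)) =
      inner ℝ a b * ∏ i ∈ Finset.univ.erase k, inner ℝ (f i) (g i) := by
  rw [inner_tensorLp, ← Finset.mul_prod_erase _ _ (Finset.mem_univ k), Function.update_self,
    Function.update_self]
  congr 1
  refine Finset.prod_congr rfl fun i hi => ?_
  rw [Function.update_of_ne (Finset.ne_of_mem_erase hi),
    Function.update_of_ne (Finset.ne_of_mem_erase hi)]

/-! ### Tensor products of function algebras -/

section TensorAlgebra

variable {d : ℕ} {A : Fin d → Set (ℝ → ℝ)}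

theorem tensor_mem_tensorSpan {f : Fin d → ℝ → ℝ} (hf : ∀ i, f i ∈ A i) :
    (fun x : Fin d → ℝ => ∏ i, f i (x i)) ∈ tensorSpan A :=
  Submodule.subset_span ⟨f, hf, rfl⟩

/-- Induction on the elements of an algebraic tensor product. -/
theorem tensorSpan_induction {p : ((Fin d → ℝ) → ℝ) → Prop}
    (tensor : ∀ f : Fin d → ℝ → ℝ, (∀ i, f i ∈ A i) → p fun x => ∏ i, f i (x i))
    (zero : p 0) (add : ∀ F G, p F → p G → p (F + G)) (smul : ∀ (c : ℝ) F, p F → p (c • F))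
    {F : (Fin d → ℝ) → ℝ} (hF : F ∈ tensorSpan A) : p F :=
  Submodule.span_induction (p := fun F _ => p F) (by rintro _ ⟨f, hf, rfl⟩; exact tensor f hf) zero
    (fun F G _ _ => add F G) (fun c F _ => smul c F) hF

theorem hasCompactSupport_tensor {f : Fin d → ℝ → ℝ} (hf : ∀ i, HasCompactSupport (f i)) :
    HasCompactSupport fun x : Fin d → ℝ => ∏ i, f i (x i) := by
  refine HasCompactSupport.intro (isCompact_univ_pi hf) fun x hx => ?_
  simp only [mem_univ_pi, not_forall] at hx
  obtain ⟨i, hi⟩ := hx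
  exact Finset.prod_eq_zero (Finset.mem_univ i) (image_eq_zero_of_notMem_tsupport hi)

theorem isCutoffAlgebra_tensorSpan (hA : ∀ i, IsCutoffAlgebra (A i)) :
    IsCutoffAlgebra (tensorSpan A) where
  continuous F hF := tensorSpan_induction
    (fun f hf => continuous_finsetProd _ fun i _ =>
      ((hA i).continuous _ (hf i)).comp (continuous_apply i))
    continuous_const (fun _ _ => Continuous.add) (fun c _ h => h.const_smul c) hF
  compactSupport F hF := tensorSpan_induction
    (fun f hf => hasCompactSupport_tensor fun i => (hA i).compactSupport _ (hf i))
    HasCompactSupport.zero (fun _ _ => HasCompactSupport.add)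
    (fun c _ h => h.smul_left (f := fun _ => c)) hF
  add_mem _ hF _ hG := Submodule.add_mem _ hF hG
  smul_mem c _ hF := Submodule.smul_mem _ c hF
  mul_mem F hF G hG := by
    refine tensorSpan_induction (p := fun F => F * G ∈ tensorSpan A) (fun f hf => ?_) ?_ ?_ ?_ hF
    · refine tensorSpan_induction (p := fun G => (fun x => ∏ i, f i (x i)) * G ∈ tensorSpan A)
        (fun g hg => ?_) ?_ ?_ ?_ hG
      · convert tensor_mem_tensorSpan fun i => (hA i).mul_mem _ (hf i) _ (hg i) using 1
        ext x
        simp [Finset.prod_mul_distrib]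
      · rw [mul_zero]; exact Submodule.zero_mem _
      · intro F G hF hG; rw [mul_add]; exact Submodule.add_mem _ hF hG
      · intro c F hF; rw [mul_smul_comm]; exact Submodule.smul_mem _ c hF
    · rw [zero_mul]; exact Submodule.zero_mem _
    · intro F G hF hG; rw [add_mul]; exact Submodule.add_mem _ hF hG
    · intro c F hF; rw [smul_mul_assoc]; exact Submodule.smul_mem _ c hF
  separates x y hxy := by
    obtain ⟨k, hk⟩ := Function.ne_iff.1 hxy
    obtain ⟨f, hf, hfxy⟩ := (hA k).separates _ _ hk
    choose χ hχ hχ1 _ using fun i =>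
      (hA i).cutoff _ ((isCompact_singleton (x := x i)).union (isCompact_singleton (x := y i)))
    refine ⟨_, tensor_mem_tensorSpan (f := Function.update χ k f) fun i => ?_, ?_⟩
    · rcases eq_or_ne i k with rfl | h
      · rwa [Function.update_self]
      · rw [Function.update_of_ne h]; exact hχ i
    · have e : ∀ z : Fin d → ℝ, (∀ i, z i ∈ ({x i} ∪ {y i} : Set ℝ)) →
          ∏ i, Function.update χ k f i (z i) = f (z k) := fun z hz => by
        rw [prod_update_mul, Finset.prod_eq_one fun i _ => hχ1 i _ (hz i), mul_one]
      simpa only [e x fun i => Or.inl rfl, e y fun i => Or.inr rfl] using hfxy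
  cutoff K hK := by
    choose χ hχ hχ1 hχ01 using fun i => (hA i).cutoff _ (hK.image (continuous_apply i))
    refine ⟨_, tensor_mem_tensorSpan hχ, fun x hx => ?_, fun x => ⟨?_, ?_⟩⟩
    · exact Finset.prod_eq_one fun i _ => hχ1 i _ ⟨x, hx, rfl⟩
    · exact Finset.prod_nonneg fun i _ => (hχ01 i _).1
    · exact Finset.prod_le_one (fun i _ => (hχ01 i _).1) fun i _ => (hχ01 i _).2

/-- The tensor product is jointly continuous: the norm of a difference of two tensor products is a
polynomial in the inner products of their factors. -/
theorem tendsto_tensorLp {f : ℕ → Fin d → Lp ℝ 2 (volume : Measure ℝ)}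
    {g : Fin d → Lp ℝ 2 (volume : Measure ℝ)} (h : ∀ i, Tendsto (fun n => f n i) atTop (𝓝 (g i))) :
    Tendsto (fun n => tensorLp (f n)) atTop (𝓝 (tensorLp g)) := by
  rw [tendsto_iff_norm_sub_tendsto_zero]
  have e : ∀ n, ‖tensorLp (f n) - tensorLp g‖ ^ 2 =
      ∏ i, inner ℝ (f n i) (f n i) - 2 * ∏ i, inner ℝ (f n i) (g i) + ∏ i, inner ℝ (g i) (g i) :=
    fun n => by
      rw [norm_sub_sq_real, ← real_inner_self_eq_norm_sq, ← real_inner_self_eq_norm_sq,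
        inner_tensorLp, inner_tensorLp, inner_tensorLp]
  have h1 := ((tendsto_finsetProd Finset.univ fun i _ => (h i).inner (h i)).sub
    ((tendsto_finsetProd Finset.univ fun i _ =>
      (h i).inner (tendsto_const_nhds (x := g i))).const_mul 2)).add_const
    (∏ i, inner ℝ (g i) (g i) : ℝ)
  have h2 : Tendsto (fun n => ‖tensorLp (f n) - tensorLp g‖ ^ 2) atTop (𝓝 0) := by
    simp only [e]
    convert h1 using 2
    ring
  simpa [Real.sqrt_sq] using h2.sqrt

end TensorAlgebra

/-! ### The form of the independent coupling -/

section Associated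

variable {E : Type*} [MeasurableSpace E] {m : Measure E} {P : MarkovTransition E} {𝓔 : L2Form m}

namespace IsSymmSemigroup

variable {H : Type*} [NormedAddCommGroup H] [InnerProductSpace ℝ H] {T : ℝ≥0 → H →L[ℝ] H}

theorem tendsto_inner_sub_apply {u : H} {l : ℝ}
    (h : Tendsto (fun t => quot T t u u) (𝓝[>] 0) (𝓝 l)) :
    Tendsto (fun t => inner ℝ (u - T t u) u) (𝓝[>] 0) (𝓝 0) := by
  have h1 := (tendsto_coe_nhdsGT_zero.mono_right nhdsWithin_le_nhds).mul h
  rw [zero_mul] at h1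
  refine h1.congr' ?_
  filter_upwards [self_mem_nhdsWithin] with t ht
  rw [quot, mul_inv_cancel_left₀ (NNReal.coe_ne_zero.2 (ne_of_gt ht))]

/-- The Cauchy–Schwarz inequality for the form of a symmetric semigroup. -/
theorem energy_sq_le (hT : IsSymmSemigroup T)
    (hc : ∀ u, Tendsto (fun t => T t u) (𝓝[>] 0) (𝓝 u)) {u v : H} (hu : u ∈ formDomain T)
    (hv : v ∈ formDomain T) : energy T u v ^ 2 ≤ energy T u u * energy T v v := by
  have key : ∀ x : ℝ, 0 ≤ energy T u u * (x * x) + 2 * energy T u v * x + energy T v v := by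
    intro x
    have hxu := hT.smul_mem x hu
    have h := hT.energy_nonneg hc (hT.add_mem hxu hv)
    rw [hT.energy_add_left hc hxu hv (hT.add_mem hxu hv),
      hT.energy_comm hc hxu (hT.add_mem hxu hv), hT.energy_comm hc hv (hT.add_mem hxu hv),
      hT.energy_add_left hc hxu hv hxu, hT.energy_add_left hc hxu hv hv,
      hT.energy_smul_left hc x hu hxu, hT.energy_smul_left hc x hu hv,
      hT.energy_comm hc hu hxu, hT.energy_smul_left hc x hu hu, hT.energy_comm hc hv hxu,
      hT.energy_smul_left hc x hu hv] at h
    linarith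
  have := discrim_le_zero key
  rw [discrim] at this
  linarith

theorem energy_add_self (hT : IsSymmSemigroup T)
    (hc : ∀ u, Tendsto (fun t => T t u) (𝓝[>] 0) (𝓝 u)) {u v : H} (hu : u ∈ formDomain T)
    (hv : v ∈ formDomain T) :
    energy T (u + v) (u + v) = energy T u u + 2 * energy T u v + energy T v v := by
  have huv := hT.add_mem hu hv
  rw [hT.energy_add_left hc hu hv huv, hT.energy_comm hc hu huv, hT.energy_comm hc hv huv,
    hT.energy_add_left hc hu hv hu, hT.energy_add_left hc hu hv hv, hT.energy_comm hc hv hu]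
  ring

/-- The form is continuous with respect to itself. -/
theorem tendsto_energy_self (hT : IsSymmSemigroup T)
    (hc : ∀ u, Tendsto (fun t => T t u) (𝓝[>] 0) (𝓝 u)) {u : ℕ → H} {w : H}
    (hu : ∀ n, u n ∈ formDomain T) (hw : w ∈ formDomain T)
    (h : Tendsto (fun n => energy T (u n - w) (u n - w)) atTop (𝓝 0)) :
    Tendsto (fun n => energy T (u n) (u n)) atTop (𝓝 (energy T w w)) := by
  have hs : ∀ n, u n - w ∈ formDomain T := fun n => hT.sub_mem (hu n) hw
  have h1 : Tendsto (fun n => energy T w (u n - w)) atTop (𝓝 0) := by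
    refine squeeze_zero_norm (a := fun n => √(energy T w w * energy T (u n - w) (u n - w)))
      (fun n => Real.abs_le_sqrt (hT.energy_sq_le hc hw (hs n))) ?_
    simpa using (h.const_mul (energy T w w)).sqrt
  have h2 := ((h1.const_mul 2).const_add (energy T w w)).add h
  rw [mul_zero, add_zero, add_zero] at h2
  refine h2.congr fun n => ?_
  rw [← hT.energy_add_self hc hw (hs n), add_sub_cancel]

end IsSymmSemigroup

namespace MarkovTransition.IsAssociated

theorem tendsto_quot (h : P.IsAssociated 𝓔) {u v : Lp ℝ 2 m} (hu : u ∈ 𝓔.domain)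
    (hv : v ∈ 𝓔.domain) :
    Tendsto (fun t => quot (P.semigroup h.symmetric) t u v) (𝓝[>] 0) (𝓝 (𝓔.form u v)) := by
  simpa only [approxForm_eq_quot P h.symmetric] using h.tendsto_form u hu v hv

theorem strongly_continuous (h : P.IsAssociated 𝓔) (hd : Dense 𝓔.domain) (u : Lp ℝ 2 m) :
    Tendsto (fun t => P.semigroup h.symmetric t u) (𝓝[>] 0) (𝓝 u) :=
  (P.isSymmSemigroup h.symmetric).tendsto_self hd
    (fun _ hu => IsSymmSemigroup.tendsto_inner_sub_apply (h.tendsto_quot hu hu)) u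

theorem domain_eq_formDomain (h : P.IsAssociated 𝓔) (hd : Dense 𝓔.domain) :
    𝓔.domain = formDomain (P.semigroup h.symmetric) := by
  ext u
  rw [(P.isSymmSemigroup h.symmetric).mem_formDomain_iff (h.strongly_continuous hd), h.domain_eq]
  simp only [approxForm_eq_quot P h.symmetric, mem_ofPred_eq]

theorem semigroup_mem (h : P.IsAssociated 𝓔) (hd : Dense 𝓔.domain) (t : ℝ≥0) {u : Lp ℝ 2 m}
    (hu : u ∈ 𝓔.domain) : P.semigroup h.symmetric t u ∈ 𝓔.domain := by
  have hT := P.isSymmSemigroup h.symmetric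
  rcases eq_zero_or_pos t with rfl | ht
  · rwa [hT.zero]
  · rw [h.domain_eq_formDomain hd]
    exact (hT.apply_mem (h.strongly_continuous hd) ht u).1

end MarkovTransition.IsAssociated

end Associated

section Coupling

variable {d : ℕ} (s : Fin d → BrownianScale)

/-- The algebraic tensor product `𝓕^{(s₁)} ⊗ ⋯ ⊗ 𝓕^{(s_d)}` in `L²(ℝ^d)`. -/
def tensorDomain : Submodule ℝ (L2Space d) :=
  Submodule.span ℝ {u | ∃ f : Fin d → Lp ℝ 2 (volume : Measure ℝ),
    (∀ i, f i ∈ (s i).scaleForm.domain) ∧ u = tensorLp f}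

variable {s}

theorem tensorDomain_induction {p : L2Space d → Prop}
    (tensor : ∀ f : Fin d → Lp ℝ 2 (volume : Measure ℝ), (∀ i, f i ∈ (s i).scaleForm.domain) →
      p (tensorLp f))
    (zero : p 0) (add : ∀ u v, p u → p v → p (u + v)) (smul : ∀ (c : ℝ) u, p u → p (c • u))
    {u : L2Space d} (hu : u ∈ tensorDomain s) : p u :=
  Submodule.span_induction (p := fun u _ => p u) (by rintro _ ⟨f, hf, rfl⟩; exact tensor f hf) zero
    (fun u v _ _ => add u v) (fun c u _ => smul c u) hu

theorem tensorLp_mem_tensorDomain {f : Fin d → Lp ℝ 2 (volume : Measure ℝ)}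
    (hf : ∀ i, f i ∈ (s i).scaleForm.domain) : tensorLp f ∈ tensorDomain s :=
  Submodule.subset_span ⟨f, hf, rfl⟩

theorem tensorLp_mem_sobolevH1 {f : Fin d → Lp ℝ 2 (volume : Measure ℝ)}
    (hf : ∀ i, f i ∈ (s i).scaleForm.domain) : tensorLp f ∈ sobolevH1 d := fun k => by
  obtain ⟨g, hg, -⟩ := BrownianScale.exists_hasWeakDeriv (hf k)
  exact ⟨_, isWeakPartial_tensorLp f k hg⟩

theorem tensorDomain_subset_sobolevH1 {u : L2Space d} (hu : u ∈ tensorDomain s) :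
    u ∈ sobolevH1 d :=
  tensorDomain_induction (fun _ hf => tensorLp_mem_sobolevH1 hf) (fun _ => ⟨0, IsWeakPartial.zero⟩)
    (fun _ _ => sobolevH1_add) (fun c _ => sobolevH1_smul c) hu

/-- On tensor products the form of Brownian motion is the tensor sum of the one-dimensional forms:
the weak derivatives of the factors vanish on the flat sets, so that no energy is lost in passing
from `ds` to Lebesgue measure. -/
theorem brownianForm_tensorLp {f g : Fin d → Lp ℝ 2 (volume : Measure ℝ)}
    (hf : ∀ i, f i ∈ (s i).scaleForm.domain) (hg : ∀ i, g i ∈ (s i).scaleForm.domain) :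
    (brownianForm d).form (tensorLp f) (tensorLp g) =
      ∑ k, (s k).scaleForm.form (f k) (g k) *
        ∏ i ∈ Finset.univ.erase k, inner ℝ (f i) (g i) := by
  rw [brownianForm_form, Finset.mul_sum]
  refine Finset.sum_congr rfl fun k _ => ?_
  obtain ⟨a, ha, -⟩ := BrownianScale.exists_hasWeakDeriv (hf k)
  obtain ⟨b, hb, -⟩ := BrownianScale.exists_hasWeakDeriv (hg k)
  rw [(isWeakPartial_tensorLp f k ha).weakPartial_eq, (isWeakPartial_tensorLp g k hb).weakPartial_eq,
    inner_tensorLp_update, BrownianScale.scaleForm_form_eq (hf k) (hg k) ha hb, mul_assoc]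

variable {X : Fin d → MarkovTransition ℝ}

/-- The transition semigroup of the independent coupling on `L²(ℝ^d)`. -/
def couplingSemigroup (hX : ∀ i, (X i).IsAssociated (s i).scaleForm) (t : ℝ≥0) :
    L2Space d →L[ℝ] L2Space d :=
  (MarkovTransition.independentCoupling X).semigroup
    (MarkovTransition.isSymmetric_independentCoupling X fun i => (hX i).symmetric) t

theorem isSymmSemigroup_couplingSemigroup (hX : ∀ i, (X i).IsAssociated (s i).scaleForm) :
    IsSymmSemigroup (couplingSemigroup hX) :=
  (MarkovTransition.independentCoupling X).isSymmSemigroup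
    (MarkovTransition.isSymmetric_independentCoupling X fun i => (hX i).symmetric)

theorem couplingSemigroup_mem_tensorDomain (hX : ∀ i, (X i).IsAssociated (s i).scaleForm) (t : ℝ≥0)
    {u : L2Space d} (hu : u ∈ tensorDomain s) : couplingSemigroup hX t u ∈ tensorDomain s := by
  refine tensorDomain_induction (s := s) (p := fun u => couplingSemigroup hX t u ∈ tensorDomain s)
    (fun f hf => ?_) ?_ ?_ ?_ hu
  · have := MarkovTransition.semigroup_tensorLp X (fun i => (hX i).symmetric) t f
    rw [couplingSemigroup, this]
    exact tensorLp_mem_tensorDomain fun i => (hX i).semigroup_mem (s i).dense_domain t (hf i)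
  · rw [map_zero]; exact Submodule.zero_mem _
  · intro u v hu hv; rw [map_add]; exact Submodule.add_mem _ hu hv
  · intro c u hu; rw [map_smul]; exact Submodule.smul_mem _ c hu

/-- On the algebraic tensor product the form of the coupling is that of Brownian motion. -/
theorem tendsto_quot_couplingSemigroup (hX : ∀ i, (X i).IsAssociated (s i).scaleForm)
    {u v : L2Space d} (hu : u ∈ tensorDomain s) (hv : v ∈ tensorDomain s) :
    Tendsto (fun t => quot (couplingSemigroup hX) t u v) (𝓝[>] 0)
      (𝓝 ((brownianForm d).form u v)) := by
  have hT := isSymmSemigroup_couplingSemigroup hX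
  have htt : ∀ f g : Fin d → Lp ℝ 2 (volume : Measure ℝ), (∀ i, f i ∈ (s i).scaleForm.domain) →
      (∀ i, g i ∈ (s i).scaleForm.domain) →
      Tendsto (fun t => quot (couplingSemigroup hX) t (tensorLp f) (tensorLp g)) (𝓝[>] 0)
        (𝓝 ((brownianForm d).form (tensorLp f) (tensorLp g))) := fun f g hf hg => by
    rw [brownianForm_tensorLp hf hg]
    exact tendsto_quot_tensorLp X (fun i => (hX i).symmetric)
      fun i => (hX i).tendsto_quot (hf i) (hg i)
  have hext : ∀ w : L2Space d,
      (∀ f : Fin d → Lp ℝ 2 (volume : Measure ℝ), (∀ i, f i ∈ (s i).scaleForm.domain) →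
        Tendsto (fun t => quot (couplingSemigroup hX) t (tensorLp f) w) (𝓝[>] 0)
          (𝓝 ((brownianForm d).form (tensorLp f) w))) →
      ∀ u ∈ tensorDomain s, Tendsto (fun t => quot (couplingSemigroup hX) t u w) (𝓝[>] 0)
        (𝓝 ((brownianForm d).form u w)) := by
    intro w hw u hu
    refine (tensorDomain_induction (s := s) (p := fun u => u ∈ sobolevH1 d ∧
      Tendsto (fun t => quot (couplingSemigroup hX) t u w) (𝓝[>] 0)
        (𝓝 ((brownianForm d).form u w))) (fun f hf => ⟨tensorLp_mem_sobolevH1 hf, hw f hf⟩)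
      ⟨fun _ => ⟨0, IsWeakPartial.zero⟩, ?_⟩ ?_ ?_ hu).2
    · have e : (brownianForm d).form 0 w = 0 := by
        have := brownianForm_smul_left (w := w) 0
          (fun _ => ⟨0, IsWeakPartial.zero⟩ : (0 : L2Space d) ∈ sobolevH1 d)
        simpa using this
      rw [e]
      simp [quot]
    · rintro u v ⟨hu, hu'⟩ ⟨hv, hv'⟩
      refine ⟨sobolevH1_add hu hv, ?_⟩
      rw [brownianForm_add_left hu hv]
      exact (hu'.add hv').congr fun t => (quot_add_left t u v w).symm
    · rintro c u ⟨hu, hu'⟩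
      refine ⟨sobolevH1_smul c hu, ?_⟩
      rw [brownianForm_smul_left c hu]
      exact (hu'.const_mul c).congr fun t => (quot_smul_left t c u w).symm
  refine hext v (fun f hf => ?_) u hu
  rw [brownianForm_comm]
  simp only [hT.quot_comm _ (tensorLp f)]
  exact hext (tensorLp f) (fun g hg => htt g f hg hf) v hv

theorem exists_tensorDomain_of_mem_tensorSpan {F : (Fin d → ℝ) → ℝ}
    (hF : F ∈ tensorSpan fun i => (s i).smoothCore) : ∃ u ∈ tensorDomain s, u =ᵐ[volume] F := by
  refine tensorSpan_induction (p := fun F => ∃ u ∈ tensorDomain s, u =ᵐ[volume] F)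
    (fun f hf => ?_) ⟨0, Submodule.zero_mem _, Lp.coeFn_zero _ _ _⟩ ?_ ?_ hF
  · have hL : ∀ i, MemLp (f i) 2 volume := fun i => BrownianScale.memLp_of_mem_smoothCore (hf i)
    exact ⟨tensorLp fun i => (hL i).toLp, tensorLp_mem_tensorDomain fun i =>
      BrownianScale.mem_domain_of_mem_smoothCore (hf i) (hL i).coeFn_toLp,
      coeFn_tensorLp_of_ae fun i => (hL i).coeFn_toLp⟩
  · rintro F G ⟨u, hu, huF⟩ ⟨v, hv, hvG⟩
    exact ⟨u + v, Submodule.add_mem _ hu hv, (Lp.coeFn_add u v).trans (huF.add hvG)⟩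
  · rintro c F ⟨u, hu, huF⟩
    exact ⟨c • u, Submodule.smul_mem _ c hu, (Lp.coeFn_smul c u).trans (huF.const_smul c)⟩

variable (s) in
theorem isCutoffAlgebra_tensorSpan_smoothCore :
    IsCutoffAlgebra (tensorSpan fun i => (s i).smoothCore) :=
  isCutoffAlgebra_tensorSpan fun i => (s i).isCutoffAlgebra_smoothCore

variable (s) in
theorem dense_tensorDomain : Dense (tensorDomain s : Set (L2Space d)) := by
  refine ((isCutoffAlgebra_tensorSpan_smoothCore s).dense_Lp (μ := volume)).mono ?_
  rintro u ⟨F, hF, huF⟩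
  obtain ⟨v, hv, hvF⟩ := exists_tensorDomain_of_mem_tensorSpan hF
  rwa [Lp.ext (huF.trans hvF.symm)]

theorem couplingSemigroup_strongly_continuous (hX : ∀ i, (X i).IsAssociated (s i).scaleForm)
    (u : L2Space d) : Tendsto (fun t => couplingSemigroup hX t u) (𝓝[>] 0) (𝓝 u) :=
  (isSymmSemigroup_couplingSemigroup hX).tendsto_self (dense_tensorDomain s)
    (fun _ hu => IsSymmSemigroup.tendsto_inner_sub_apply
      (tendsto_quot_couplingSemigroup hX hu hu)) u

theorem tensorDomain_subset_formDomain (hX : ∀ i, (X i).IsAssociated (s i).scaleForm)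
    {u : L2Space d} (hu : u ∈ tensorDomain s) : u ∈ formDomain (couplingSemigroup hX) :=
  ((isSymmSemigroup_couplingSemigroup hX).mem_formDomain_iff
    (couplingSemigroup_strongly_continuous hX) u).2 ⟨_, tendsto_quot_couplingSemigroup hX hu hu⟩

theorem energy_eq_of_mem_tensorDomain (hX : ∀ i, (X i).IsAssociated (s i).scaleForm)
    {u v : L2Space d} (hu : u ∈ tensorDomain s) (hv : v ∈ tensorDomain s) :
    energy (couplingSemigroup hX) u v = (brownianForm d).form u v :=
  tendsto_nhds_unique ((isSymmSemigroup_couplingSemigroup hX).tendsto_energy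
    (couplingSemigroup_strongly_continuous hX) (tensorDomain_subset_formDomain hX hu)
    (tensorDomain_subset_formDomain hX hv)) (tendsto_quot_couplingSemigroup hX hu hv)

/-- The algebraic tensor product is dense in the form domain of the coupling, with respect to the
norm of `H¹(ℝ^d)`: it is dense in `L²(ℝ^d)` and invariant under the semigroup. -/
theorem exists_tensorDomain_seq (hX : ∀ i, (X i).IsAssociated (s i).scaleForm) {u : L2Space d}
    (hu : u ∈ formDomain (couplingSemigroup hX)) :
    u ∈ sobolevH1 d ∧ energy (couplingSemigroup hX) u u = (brownianForm d).form u u ∧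
      ∃ v : ℕ → L2Space d, (∀ n, v n ∈ tensorDomain s) ∧ Tendsto v atTop (𝓝 u) ∧
        ∀ i, Tendsto (fun n => weakPartial i (v n)) atTop (𝓝 (weakPartial i u)) := by
  have hT := isSymmSemigroup_couplingSemigroup hX
  have hc := couplingSemigroup_strongly_continuous hX
  choose v hvD hvT hvE hvu using fun n : ℕ => hT.exists_energy_sub_lt hc (dense_tensorDomain s)
    (fun t _ hw => couplingSemigroup_mem_tensorDomain hX t hw) hu
    (show 0 < 1 / ((n : ℝ) + 1) by positivity)
  have h0 := tendsto_one_div_add_atTop_nhds_zero_nat (𝕜 := ℝ)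
  have hvlim : Tendsto v atTop (𝓝 u) := by
    rw [tendsto_iff_norm_sub_tendsto_zero]
    refine squeeze_zero (fun n => norm_nonneg _) (fun n => ?_) h0
    rw [norm_sub_rev]
    exact (hvu n).le
  have hsub : ∀ n, u - v n ∈ formDomain (couplingSemigroup hX) := fun n => hT.sub_mem hu (hvT n)
  have hneg : ∀ n, energy (couplingSemigroup hX) (v n - u) (v n - u) =
      energy (couplingSemigroup hX) (u - v n) (u - v n) := fun n => by
    have hm := hT.smul_mem (-1) (hsub n)
    rw [← neg_sub u, ← neg_one_smul ℝ (u - v n), hT.energy_smul_left hc _ (hsub n) hm,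
      hT.energy_comm hc (hsub n) hm, hT.energy_smul_left hc _ (hsub n) (hsub n)]
    ring
  have hElim : Tendsto (fun n => energy (couplingSemigroup hX) (v n - u) (v n - u)) atTop (𝓝 0) :=
    squeeze_zero (fun n => hT.energy_nonneg hc (hT.sub_mem (hvT n) hu))
      (fun n => by rw [hneg]; exact (hvE n).le) h0
  have hvH : ∀ n, v n ∈ sobolevH1 d := fun n => tensorDomain_subset_sobolevH1 (hvD n)
  obtain ⟨w, hw, hvw, hvw'⟩ := exists_tendsto_sobolevH1 hvH fun ε hε => by
    have h1 : ∀ᶠ n in atTop, energy (couplingSemigroup hX) (v n - u) (v n - u) < ε / 8 :=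
      hElim.eventually_lt_const (by positivity)
    have h2 : ∀ᶠ n in atTop, ‖v n - u‖ ^ 2 < ε / 8 := by
      have := (hvlim.sub_const u).norm.pow 2
      rw [sub_self, norm_zero, zero_pow two_ne_zero] at this
      exact this.eventually_lt_const (by positivity)
    obtain ⟨N, hN⟩ := eventually_atTop.1 (h1.and h2)
    refine ⟨N, fun k hk l hl => ?_⟩
    have e : v k - v l = (v k - u) + (u - v l) := by abel
    rw [L2Form.form1, ← energy_eq_of_mem_tensorDomain hX (Submodule.sub_mem _ (hvD k) (hvD l))
      (Submodule.sub_mem _ (hvD k) (hvD l)), real_inner_self_eq_norm_sq]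
    have h3 := hT.energy_add_le hc (hT.sub_mem (hvT k) hu) (hsub l)
    rw [← e, ← hneg] at h3
    have h4 : ‖v k - v l‖ ≤ ‖v k - u‖ + ‖v l - u‖ := by
      rw [norm_sub_rev (v l)]
      exact norm_sub_le_norm_sub_add_norm_sub _ _ _
    have h5 : ‖v k - v l‖ ^ 2 ≤ 2 * ‖v k - u‖ ^ 2 + 2 * ‖v l - u‖ ^ 2 := by
      nlinarith [norm_nonneg (v k - v l), sq_nonneg (‖v k - u‖ - ‖v l - u‖)]
    linarith [hN k hk, hN l hl, (hN k hk).1, (hN k hk).2, (hN l hl).1, (hN l hl).2]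
  obtain rfl := tendsto_nhds_unique hvw hvlim
  refine ⟨hw, ?_, v, hvD, hvw, hvw'⟩
  have h1 := hT.tendsto_energy_self hc hvT hu hElim
  refine tendsto_nhds_unique h1 ?_
  simp only [fun n => energy_eq_of_mem_tensorDomain hX (hvD n) (hvD n), brownianForm_self]
  exact (tendsto_finsetSum _ fun i _ => (hvw' i).norm.pow 2).const_mul _

/-- On its whole domain the form of the coupling is that of Brownian motion, by polarization. -/
theorem energy_eq (hX : ∀ i, (X i).IsAssociated (s i).scaleForm) {u v : L2Space d}
    (hu : u ∈ formDomain (couplingSemigroup hX)) (hv : v ∈ formDomain (couplingSemigroup hX)) :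
    energy (couplingSemigroup hX) u v = (brownianForm d).form u v := by
  have hT := isSymmSemigroup_couplingSemigroup hX
  have hc := couplingSemigroup_strongly_continuous hX
  obtain ⟨hu1, hu2, -⟩ := exists_tensorDomain_seq hX hu
  obtain ⟨hv1, hv2, -⟩ := exists_tensorDomain_seq hX hv
  have h := (exists_tensorDomain_seq hX (hT.add_mem hu hv)).2.1
  rw [hT.energy_add_self hc hu hv, brownianForm_add_left hu1 hv1,
    brownianForm_comm u, brownianForm_comm v, brownianForm_add_left hu1 hv1,
    brownianForm_add_left hu1 hv1, brownianForm_comm v u] at h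
  linarith

end Coupling

/-! ### The core and regularity of the form of the independent coupling -/

section Core

variable {d : ℕ} {s : Fin d → BrownianScale}

theorem BrownianScale.exists_smoothCore_seq {s : BrownianScale} {u : Lp ℝ 2 (volume : Measure ℝ)}
    (hu : u ∈ s.scaleForm.domain) {g : Lp ℝ 2 (volume : Measure ℝ)} (hg : HasWeakDeriv u g) :
    ∃ f : ℕ → ℝ → ℝ, ∃ v k : ℕ → Lp ℝ 2 (volume : Measure ℝ), (∀ n, f n ∈ s.smoothCore) ∧
      (∀ n, v n =ᵐ[volume] f n) ∧ (∀ n, HasWeakDeriv (v n) (k n)) ∧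
      Tendsto v atTop (𝓝 u) ∧ Tendsto k atTop (𝓝 g) := by
  choose f hf v gu k hvf hgu hk huv hgk using fun n : ℕ =>
    exists_smoothCore_near hu (show 0 < 1 / ((n : ℝ) + 1) by positivity)
  have h0 := tendsto_one_div_add_atTop_nhds_zero_nat (𝕜 := ℝ)
  refine ⟨f, v, k, hf, hvf, hk, ?_, ?_⟩ <;> rw [tendsto_iff_norm_sub_tendsto_zero] <;>
    refine squeeze_zero (fun n => norm_nonneg _) (fun n => ?_) h0 <;> rw [norm_sub_rev]
  · exact (huv n).le
  · have e : gu n = g := Lp.ext ((hgu n).ae_eq hg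
      ((Lp.memLp (gu n)).locallyIntegrable (by norm_num))
      ((Lp.memLp g).locallyIntegrable (by norm_num)))
    rw [← e]
    exact (hgk n).le

/-- The elements of `⊗ 𝓕^{(sᵢ)}` are limits of elements of `⊗ C_c^1(sᵢ)` in `H¹(ℝ^d)`. -/
theorem exists_tensorSpan_seq {u : L2Space d} (hu : u ∈ tensorDomain s) :
    ∃ F : ℕ → (Fin d → ℝ) → ℝ, ∃ v : ℕ → L2Space d,
      (∀ n, F n ∈ tensorSpan fun i => (s i).smoothCore) ∧ (∀ n, v n =ᵐ[volume] F n) ∧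
      Tendsto v atTop (𝓝 u) ∧
      ∀ i, Tendsto (fun n => weakPartial i (v n)) atTop (𝓝 (weakPartial i u)) := by
  have hH : ∀ {F : (Fin d → ℝ) → ℝ} {v : L2Space d}, F ∈ tensorSpan (fun i => (s i).smoothCore) →
      v =ᵐ[volume] F → v ∈ sobolevH1 d := fun {F v} hF hv => by
    obtain ⟨w, hw, hwF⟩ := exists_tensorDomain_of_mem_tensorSpan hF
    rw [Lp.ext (hv.trans hwF.symm)]
    exact tensorDomain_subset_sobolevH1 hw
  refine (tensorDomain_induction (s := s) (p := fun u => u ∈ sobolevH1 d ∧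
    ∃ F : ℕ → (Fin d → ℝ) → ℝ, ∃ v : ℕ → L2Space d,
      (∀ n, F n ∈ tensorSpan fun i => (s i).smoothCore) ∧ (∀ n, v n =ᵐ[volume] F n) ∧
      Tendsto v atTop (𝓝 u) ∧
      ∀ i, Tendsto (fun n => weakPartial i (v n)) atTop (𝓝 (weakPartial i u)))
    (fun f hf => ⟨tensorLp_mem_sobolevH1 hf, ?_⟩) ⟨fun _ => ⟨0, IsWeakPartial.zero⟩, ?_⟩
    ?_ ?_ hu).2
  · choose g hg _ using fun i => BrownianScale.exists_hasWeakDeriv (hf i)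
    choose F v k hF hvF hvk hv hk using fun i => BrownianScale.exists_smoothCore_seq (hf i) (hg i)
    refine ⟨fun n x => ∏ i, F i n (x i), fun n => tensorLp fun i => v i n,
      fun n => tensor_mem_tensorSpan fun i => hF i n,
      fun n => coeFn_tensorLp_of_ae fun i => hvF i n, tendsto_tensorLp hv, fun j => ?_⟩
    rw [(isWeakPartial_tensorLp f j (hg j)).weakPartial_eq]
    simp only [fun n => (isWeakPartial_tensorLp (fun i => v i n) j (hvk j n)).weakPartial_eq]
    refine tendsto_tensorLp fun i => ?_
    rcases eq_or_ne i j with rfl | hij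
    · simpa only [Function.update_self] using hk i
    · simpa only [Function.update_of_ne hij] using hv i
  · exact ⟨fun _ => 0, fun _ => 0, fun _ => Submodule.zero_mem _, fun _ => Lp.coeFn_zero _ _ _,
      tendsto_const_nhds, fun _ => tendsto_const_nhds⟩
  · rintro u u' ⟨hu, F, v, hF, hvF, hv, hw⟩ ⟨hu', F', v', hF', hvF', hv', hw'⟩
    refine ⟨sobolevH1_add hu hu', fun n => F n + F' n, fun n => v n + v' n,
      fun n => Submodule.add_mem _ (hF n) (hF' n),
      fun n => (Lp.coeFn_add _ _).trans ((hvF n).add (hvF' n)), hv.add hv', fun i => ?_⟩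
    simp only [weakPartial_add hu hu', fun n => weakPartial_add (hH (hF n) (hvF n))
      (hH (hF' n) (hvF' n))]
    exact (hw i).add (hw' i)
  · rintro c u ⟨hu, F, v, hF, hvF, hv, hw⟩
    refine ⟨sobolevH1_smul c hu, fun n => c • F n, fun n => c • v n,
      fun n => Submodule.smul_mem _ c (hF n),
      fun n => (Lp.coeFn_smul _ _).trans ((hvF n).const_smul c), hv.const_smul c, fun i => ?_⟩
    simp only [weakPartial_smul c hu, fun n => weakPartial_smul c (hH (hF n) (hvF n))]
    exact (hw i).const_smul c

variable {X : Fin d → MarkovTransition ℝ}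

/-- The form of the independent coupling: its domain is that of the semigroup, and its values are
those of the form of Brownian motion. -/
def couplingForm (hX : ∀ i, (X i).IsAssociated (s i).scaleForm) :
    L2Form (volume : Measure (Fin d → ℝ)) where
  domain := formDomain (couplingSemigroup hX)
  form := (brownianForm d).form

theorem isAssociated_couplingForm (hX : ∀ i, (X i).IsAssociated (s i).scaleForm) :
    (MarkovTransition.independentCoupling X).IsAssociated (couplingForm hX) := by
  have hS := MarkovTransition.isSymmetric_independentCoupling X fun i => (hX i).symmetric
  have hT := isSymmSemigroup_couplingSemigroup hX
  have hc := couplingSemigroup_strongly_continuous hX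
  refine ⟨hS, ?_, fun u hu v hv => ?_⟩
  · ext u
    refine (hT.mem_formDomain_iff hc u).trans ?_
    simp only [MarkovTransition.approxForm_eq_quot _ hS, mem_ofPred_eq]
    rfl
  · simp only [MarkovTransition.approxForm_eq_quot _ hS]
    have := hT.tendsto_energy hc hu hv
    rwa [energy_eq hX hu hv] at this

theorem couplingForm_domain_subset (hX : ∀ i, (X i).IsAssociated (s i).scaleForm) :
    (couplingForm hX).domain ⊆ sobolevH1 d := fun _ hu => (exists_tensorDomain_seq hX hu).1

theorem isDirichletForm_couplingForm (hX : ∀ i, (X i).IsAssociated (s i).scaleForm) :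
    (couplingForm hX).IsDirichletForm := by
  have hT := isSymmSemigroup_couplingSemigroup hX
  have hc := couplingSemigroup_strongly_continuous hX
  have hB := isDirichletForm_brownianForm d
  have hle := couplingForm_domain_subset hX
  exact
    { zero_mem := tensorDomain_subset_formDomain hX (Submodule.zero_mem _)
      add_mem := fun u hu v hv => hT.add_mem hu hv
      smul_mem := fun c u hu => hT.smul_mem c hu
      dense := (dense_tensorDomain s).mono fun u hu => tensorDomain_subset_formDomain hX hu
      add_left := fun u hu v hv w hw => hB.add_left u (hle hu) v (hle hv) w (hle hw)
      smul_left := fun c u hu v hv => hB.smul_left c u (hle hu) v (hle hv)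
      symm := fun u hu v hv => hB.symm u (hle hu) v (hle hv)
      nonneg := fun u hu => hB.nonneg u (hle hu)
      closed := fun u hu hC => by
        obtain ⟨w, hw, h, h'⟩ := exists_tendsto_sobolevH1 (fun n => hle (hu n)) hC
        -- the limit in `H¹` is in the domain by lower semicontinuity of the form
        have h1 : Tendsto (fun n => (brownianForm d).form (u n) (u n)) atTop
            (𝓝 ((brownianForm d).form w w)) := by
          simp only [brownianForm_self]
          exact (tendsto_finsetSum _ fun i _ => (h' i).norm.pow 2).const_mul _
        have hmem := (hT.mem_of_tendsto hc (C := (brownianForm d).form w w + 1) hu (by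
          filter_upwards [h1.eventually_le_const (lt_add_one _)] with n hn
          rwa [energy_eq hX (hu n) (hu n)]) h).1
        exact ⟨w, hmem, tendsto_form1_sub (fun n => hle (hu n)) hw h h'⟩
      markov := fun u hu v hv => by
        have hq : ∀ t, quot (couplingSemigroup hX) t v v ≤ quot (couplingSemigroup hX) t u u :=
          fun t => mul_le_mul_of_nonneg_left
            (IsSymmSubMarkov.inner_sub_op_le_of_unit_contraction (κ :=
              (MarkovTransition.independentCoupling X).kernel t)
              ⟨(MarkovTransition.independentCoupling X).mass_le_one t,
                MarkovTransition.isSymmetric_independentCoupling X (fun i => (hX i).symmetric) t⟩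
              hv) (by positivity)
        have hvm : v ∈ formDomain (couplingSemigroup hX) := by
          obtain ⟨C, hC⟩ := hu
          exact ⟨C, fun t ht => (hq t).trans (hC t ht)⟩
        refine ⟨hvm, ?_⟩
        change (brownianForm d).form v v ≤ (brownianForm d).form u u
        rw [← energy_eq hX hvm hvm, ← energy_eq hX hu hu]
        exact le_of_tendsto_of_tendsto' (hT.tendsto_energy hc hvm hvm)
          (hT.tendsto_energy hc hu hu) hq }

theorem tensorSpan_smoothCore_subset (hX : ∀ i, (X i).IsAssociated (s i).scaleForm) :
    (tensorSpan fun i => (s i).smoothCore) ⊆ (couplingForm hX).compactlySupported := fun F hF => by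
  have hA := isCutoffAlgebra_tensorSpan_smoothCore s
  obtain ⟨u, hu, huF⟩ := exists_tensorDomain_of_mem_tensorSpan hF
  exact ⟨hA.continuous F hF, hA.compactSupport F hF, u, tensorDomain_subset_formDomain hX hu, huF⟩

theorem isCore_tensorSpan_smoothCore (hX : ∀ i, (X i).IsAssociated (s i).scaleForm) :
    (couplingForm hX).IsCore (tensorSpan fun i => (s i).smoothCore) := by
  have key : ∀ {u : L2Space d} {v : ℕ → L2Space d}, u ∈ sobolevH1 d → (∀ n, v n ∈ sobolevH1 d) →
      Tendsto v atTop (𝓝 u) →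
      (∀ i, Tendsto (fun n => weakPartial i (v n)) atTop (𝓝 (weakPartial i u))) → ∀ ε > 0,
      ∃ n, (brownianForm d).form1 (v n - u) (v n - u) < ε := fun hu hv h h' ε hε =>
    ((tendsto_form1_sub hv hu h h').eventually_lt_const hε).exists
  have htri : ∀ a b : L2Space d, a ∈ sobolevH1 d → b ∈ sobolevH1 d →
      (brownianForm d).form1 (-(a + b)) (-(a + b)) ≤
        2 * (brownianForm d).form1 a a + 2 * (brownianForm d).form1 b b := by
    intro a b ha hb
    have e : -(a + b) = (-1 : ℝ) • (a + b) := (neg_one_smul ℝ _).symm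
    have hsq : ∀ x y : L2Space d, ‖x + y‖ ^ 2 ≤ 2 * ‖x‖ ^ 2 + 2 * ‖y‖ ^ 2 := fun x y => by
      nlinarith [norm_add_le x y, norm_nonneg (x + y), sq_nonneg (‖x‖ - ‖y‖)]
    simp only [L2Form.form1, brownianForm_self, real_inner_self_eq_norm_sq]
    rw [norm_neg, e]
    simp only [weakPartial_smul _ (sobolevH1_add ha hb), weakPartial_add ha hb, norm_smul, norm_neg,
      norm_one, one_mul]
    have h1 : ∑ i, ‖weakPartial i a + weakPartial i b‖ ^ 2 ≤
        2 * ∑ i, ‖weakPartial i a‖ ^ 2 + 2 * ∑ i, ‖weakPartial i b‖ ^ 2 := by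
      rw [Finset.mul_sum, Finset.mul_sum, ← Finset.sum_add_distrib]
      exact Finset.sum_le_sum fun i _ => hsq _ _
    linarith [hsq a b]
  refine ⟨tensorSpan_smoothCore_subset hX, fun u hu ε hε => ?_, fun g hg hgc ε hε => ?_⟩
  · obtain ⟨huH, -, v, hvD, hv, hv'⟩ := exists_tensorDomain_seq hX hu
    have hvH : ∀ n, v n ∈ sobolevH1 d := fun n => tensorDomain_subset_sobolevH1 (hvD n)
    obtain ⟨n, hn⟩ := key huH hvH hv hv' (ε / 4) (by positivity)
    obtain ⟨F, w, hF, hwF, hw, hw'⟩ := exists_tensorSpan_seq (hvD n)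
    have hwD : ∀ k, w k ∈ tensorDomain s := fun k => by
      obtain ⟨w', hw1, hw2⟩ := exists_tensorDomain_of_mem_tensorSpan (hF k)
      rwa [Lp.ext ((hwF k).trans hw2.symm)]
    have hwH : ∀ k, w k ∈ sobolevH1 d := fun k => tensorDomain_subset_sobolevH1 (hwD k)
    obtain ⟨k, hk⟩ := key (hvH n) hwH hw hw' (ε / 4) (by positivity)
    refine ⟨F k, hF k, w k, tensorDomain_subset_formDomain hX (hwD k), hwF k, ?_⟩
    have e : u - w k = -((v n - u) + (w k - v n)) := by abel
    rw [e]
    refine (htri _ _ (sobolevH1_sub (hvH n) huH) (sobolevH1_sub (hwH k) (hvH n))).trans_lt ?_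
    linarith
  · obtain ⟨K, -, -, h⟩ := (isCutoffAlgebra_tensorSpan_smoothCore s).exists_near hg hgc
    obtain ⟨F, hF, -, hgF⟩ := h ε hε
    exact ⟨F, hF, hgF⟩

theorem isRegularSubspace_couplingForm (hX : ∀ i, (X i).IsAssociated (s i).scaleForm) :
    (couplingForm hX).IsRegularSubspace (brownianForm d) := by
  have hcore := isCore_tensorSpan_smoothCore hX
  refine ⟨⟨isDirichletForm_couplingForm hX, Subset.rfl, fun u hu ε hε => ?_,
    fun g hg hgc ε hε => ?_⟩, isRegularDirichletForm_brownianForm d,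
    couplingForm_domain_subset hX, fun u _ v _ => rfl⟩
  · obtain ⟨f, hf, h⟩ := hcore.dense_domain u hu ε hε
    exact ⟨f, hcore.subset hf, h⟩
  · obtain ⟨f, hf, h⟩ := hcore.dense_continuous g hg hgc ε hε
    exact ⟨f, hcore.subset hf, h⟩

/-! ### Properness -/

theorem ae_weakPartial_eq_zero_of_mem_tensorDomain {u : L2Space d} (hu : u ∈ tensorDomain s)
    (i : Fin d) : ∀ᵐ x, x i ∈ (s i).flatSet → weakPartial i u x = 0 := by
  refine (tensorDomain_induction (s := s) (p := fun u => u ∈ sobolevH1 d ∧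
    ∀ᵐ x, x i ∈ (s i).flatSet → weakPartial i u x = 0)
    (fun f hf => ⟨tensorLp_mem_sobolevH1 hf, ?_⟩) ⟨fun _ => ⟨0, IsWeakPartial.zero⟩, ?_⟩
    ?_ ?_ hu).2
  · obtain ⟨g, hg, hg0⟩ := BrownianScale.exists_hasWeakDeriv (hf i)
    rw [(isWeakPartial_tensorLp f i hg).weakPartial_eq]
    filter_upwards [coeFn_tensorLp (Function.update f i g),
      (Measure.quasiMeasurePreserving_eval (fun _ : Fin d => (volume : Measure ℝ)) i).ae hg0]
      with x h1 h2 h3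
    rw [h1]
    refine Finset.prod_eq_zero (Finset.mem_univ i) ?_
    rw [Function.update_self]
    exact h2 h3
  · rw [IsWeakPartial.zero.weakPartial_eq]
    filter_upwards [Lp.coeFn_zero ℝ 2 (volume : Measure (Fin d → ℝ))] with x hx _
    rw [hx]; rfl
  · rintro u v ⟨hu, hu'⟩ ⟨hv, hv'⟩
    refine ⟨sobolevH1_add hu hv, ?_⟩
    rw [weakPartial_add hu hv]
    filter_upwards [hu', hv', Lp.coeFn_add (weakPartial i u) (weakPartial i v)] with x h1 h2 h3 hx
    rw [h3, Pi.add_apply, h1 hx, h2 hx, add_zero]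
  · rintro c u ⟨hu, hu'⟩
    refine ⟨sobolevH1_smul c hu, ?_⟩
    rw [weakPartial_smul c hu]
    filter_upwards [hu', Lp.coeFn_smul c (weakPartial i u)] with x h1 h3 hx
    rw [h3, Pi.smul_apply, h1 hx, smul_zero]

/-- The partial derivatives of the elements of the domain have no mass on the sets where the
corresponding coordinate lies in the flat set. -/
theorem setIntegral_weakPartial_eq_zero (hX : ∀ i, (X i).IsAssociated (s i).scaleForm)
    {u : L2Space d} (hu : u ∈ (couplingForm hX).domain) {i : Fin d} {B : Set (Fin d → ℝ)}
    (hB : MeasurableSet B) (hB' : volume B ≠ ∞) (hBi : ∀ x ∈ B, x i ∈ (s i).flatSet) :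
    ∫ x in B, weakPartial i u x = 0 := by
  obtain ⟨-, -, v, hvD, -, hv⟩ := exists_tensorDomain_seq hX hu
  have h1 : ∀ n, inner ℝ (indicatorConstLp 2 hB hB' (1 : ℝ)) (weakPartial i (v n)) = (0 : ℝ) := by
    intro n
    rw [L2.inner_indicatorConstLp_one]
    refine setIntegral_eq_zero_of_ae_eq_zero ?_
    filter_upwards [ae_weakPartial_eq_zero_of_mem_tensorDomain (hvD n) i] with x hx hxB
    exact hx (hBi x hxB)
  rw [← L2.inner_indicatorConstLp_one hB hB']
  refine tendsto_nhds_unique (tendsto_const_nhds.inner (hv i)) ?_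
  simp only [h1]
  exact tendsto_const_nhds

/-- There are test functions with `i`-th partial derivative equal to one on a given ball. -/
theorem exists_smoothTest_partialDeriv_eq_one (i : Fin d) {R : ℝ} (hR : 0 < R) :
    ∃ φ : SmoothTest d, ∀ x, ‖x‖ ≤ R → (SmoothTest.partialDeriv i φ).1 x = 1 := by
  let b : ContDiffBump (0 : Fin d → ℝ) := ⟨R + 1, R + 2, by linarith, by linarith⟩
  let φ : SmoothTest d := ⟨fun x => x i * b x, (contDiff_apply ℝ ℝ i).mul b.contDiff,
    b.hasCompactSupport.mul_left⟩
  refine ⟨φ, fun x hx => ?_⟩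
  have hev : φ.1 =ᶠ[𝓝 x] fun x => x i := by
    have hb : Metric.ball (0 : Fin d → ℝ) (R + 1) ∈ 𝓝 x :=
      Metric.isOpen_ball.mem_nhds (mem_ball_zero_iff.2 (by linarith))
    filter_upwards [hb] with y hy
    change y i * b y = y i
    rw [b.one_of_mem_closedBall (Metric.ball_subset_closedBall hy), mul_one]
  rw [SmoothTest.partialDeriv_apply, hev.fderiv_eq, (hasFDerivAt_apply i x).fderiv]
  simp

theorem couplingForm_domain_ne (hX : ∀ i, (X i).IsAssociated (s i).scaleForm) {i : Fin d}
    (hi : 0 < volume (s i).flatSet) : (couplingForm hX).domain ≠ (brownianForm d).domain := by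
  intro heq
  obtain ⟨n, hn⟩ : ∃ n : ℕ, 0 < volume ((s i).flatSet ∩ Icc (-(n + 1 : ℝ)) (n + 1)) := by
    by_contra! hcon
    refine hi.ne' (measure_mono_null (t := ⋃ n : ℕ, (s i).flatSet ∩ Icc (-(n + 1 : ℝ)) (n + 1))
      (fun x hx => ?_) (measure_iUnion_null fun n => le_antisymm (hcon n) bot_le))
    obtain ⟨n, hn⟩ := exists_nat_ge |x|
    have := abs_le.1 hn
    exact mem_iUnion.2 ⟨n, hx, by linarith [this.1], by linarith [this.2]⟩
  have hn0 : (0 : ℝ) < n + 1 := by positivity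
  set Q : Fin d → Set ℝ := Function.update (fun _ => Icc (-(n + 1 : ℝ)) (n + 1)) i
    ((s i).flatSet ∩ Icc (-(n + 1 : ℝ)) (n + 1))
  have hQi : Q i = (s i).flatSet ∩ Icc (-(n + 1 : ℝ)) (n + 1) := Function.update_self _ _ _
  have hQne : ∀ j, j ≠ i → Q j = Icc (-(n + 1 : ℝ)) (n + 1) := fun j hj =>
    Function.update_of_ne hj _ _
  have hQsub : ∀ j, Q j ⊆ Icc (-(n + 1 : ℝ)) (n + 1) := fun j => by
    rcases eq_or_ne j i with rfl | hj
    · rw [hQi]; exact inter_subset_right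
    · rw [hQne j hj]
  have hQm : ∀ j, MeasurableSet (Q j) := fun j => by
    rcases eq_or_ne j i with rfl | hj
    · rw [hQi]; exact ((s j).measurableSet_hasDerivAt 0).inter measurableSet_Icc
    · rw [hQne j hj]; exact measurableSet_Icc
  set B : Set (Fin d → ℝ) := univ.pi Q
  have hBm : MeasurableSet B := MeasurableSet.univ_pi hQm
  have hBfin : volume B ≠ ∞ := by
    rw [volume_pi_pi]
    exact (ENNReal.prod_lt_top fun j _ =>
      (measure_mono (hQsub j)).trans_lt (by simp)).ne
  have hBpos : volume B ≠ 0 := by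
    rw [volume_pi_pi, Finset.prod_ne_zero_iff]
    intro j _
    rcases eq_or_ne j i with rfl | hj
    · rw [hQi]; exact hn.ne'
    · rw [hQne j hj, Real.volume_Icc]
      exact (ENNReal.ofReal_pos.2 (by linarith)).ne'
  obtain ⟨φ, hφ⟩ := exists_smoothTest_partialDeriv_eq_one i hn0
  have hmem : SmoothTest.toL2 d φ ∈ (couplingForm hX).domain := by
    rw [heq]; exact toL2_mem_sobolevH1 φ
  have h0 := setIntegral_weakPartial_eq_zero hX hmem hBm hBfin fun x hx => by
    have := hx i (mem_univ i)
    rw [hQi] at this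
    exact this.1
  have h1 : ∫ x in B, weakPartial i (SmoothTest.toL2 d φ) x = ∫ x in B, (1 : ℝ) := by
    rw [(isWeakPartial_toL2 φ i).weakPartial_eq]
    refine setIntegral_congr_ae hBm ?_
    filter_upwards [SmoothTest.coeFn_toL2 (SmoothTest.partialDeriv i φ)] with x hx hxB
    rw [hx]
    refine hφ x ((pi_norm_le_iff_of_nonneg hn0.le).2 fun j => abs_le.2 ?_)
    exact hQsub j (hxB j (mem_univ j))
  rw [h0, setIntegral_const, smul_eq_mul, mul_one] at h1
  exact (ENNReal.toReal_pos hBpos hBfin).ne h1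

end Core

theorem theorem3p4 (d : ℕ) (s : Fin d → BrownianScale) (X : Fin d → MarkovTransition ℝ)
    (hX : ∀ i, (X i).IsAssociated (s i).scaleForm) :
    ∃ 𝓔 : L2Form (volume : Measure (Fin d → ℝ)),
      (MarkovTransition.independentCoupling X).IsAssociated 𝓔 ∧
      𝓔.IsRegularSubspace (brownianForm d) ∧
      𝓔.IsCore (tensorSpan fun i => (s i).smoothCore) ∧
      ((∃ i, 0 < volume (s i).flatSet) → 𝓔.IsProperRegularSubspace (brownianForm d)) :=
  ⟨couplingForm hX, isAssociated_couplingForm hX, isRegularSubspace_couplingForm hX,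
    isCore_tensorSpan_smoothCore hX, fun ⟨_, hi⟩ =>
      ⟨isRegularSubspace_couplingForm hX, couplingForm_domain_ne hX hi⟩⟩

end
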